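/- Let $G$ be a compact Lie group, $H\subset G$ a closed subgroup, and $M=G/H$ with a non-zero finite $G$-invariant Borel measure $dx$ (the Riemannian volume, up to normalization). Let $T_1,\dots,T_N$ be a basis of the Lie algebra of $G$, with $[T_i,T_j]=C^k_{ij}T_k$ and $(C_i)^j_k=C^j_{ik}$, and assume that the Killing tensor $K_{ij}=-\mathrm{tr}\,C_iC_j$ is positive definite; let $K^{ij}$ be its inverse. Let $v_i$ be the vector fields on $M$ generating the action of $G$ on functions, $(v_if)(x)=\frac{d}{dt}\big|_{t=0}f(e^{-tT_i}x)$, so that $[v_i,v_j]=C^k_{ij}v_k$, and let $e^{\varphi^iv_i}$ be the translation operator $(e^{\varphi^iv_i}f)(x)=f(e^{-\varphi^iT_i}x)$, whose kernel is $\langle x|e^{\varphi^iv_i}|y\rangle=\delta(x-e^{\varphi^iT_i}y)$. On functions of $\varphi\in\mathbb R^N$ put $$u_i=\left(\frac{-\varphi^kC_k}{e^{-\varphi^kC_k}-1}\right)^j_i\frac{\partial}{\partial\varphi^j},$$ which is defined on the set $R\subset\mathbb R^N$ of those $\varphi$ for which the matrix $\frac{e^{-\varphi^kC_k}-1}{-\varphi^kC_k}=\sum_{n\ge0}\frac{(-\varphi^kC_k)^n}{(n+1)!}$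 is invertible. Let $\beta\in\mathbb R$, $J\in\mathbb R^N$ and let $f\in C^\infty(M)$ be a real test function (of $y$). Assume that the series $$\sum_{n=0}^\infty\frac1{n!}\,\langle x|e^{\varphi^iv_i}\left(-\tfrac12\beta K^{ij}v_iv_j\right)^n|y\rangle,\qquad\varphi=\beta J,$$ applied to $f(y)$, i.e. the series $\sum_n\frac1{n!}e^{\varphi^iv_i}(-\frac12\beta K^{ij}v_iv_j)^nf$, converges in the space $\mathcal D'(M)$ of distributions in $x$. Then, as distributions in $x$ after application to $f(y)$, $$\langle x|e^{-\beta(\frac12K^{ij}v_iv_j-J^iv_i)}|y\rangle=\left.e^{-\frac12\beta K^{ij}u_iu_j}\langle x|e^{\varphi^iv_i}|y\rangle\right|_{\varphi=\beta J}.$$ Precisely: (a) the left side is defined: with $A=\frac12K^{ij}v_iv_j-J^iv_i$, the problem $\frac{d}{ds}U(s)=-A\,U(s)$, $U(0)=f$, has a solution $U$ with values in $\mathcal D'(M)$ for $s$ between $0$ and $\beta$ (differentiability being understood after pairing with each test function), and $U(\beta)=:e^{-\beta A}f$ is the same for all solutions; (b) for every $h\in C^\infty(M)$ the function $\Psi_h(\varphi)=\int_Mh\,(e^{\varphi^iv_i}f)\,dx$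 is smooth on $\mathbb R^N$, the point $\beta J$ lies in the closure of $R$, for every $n$ the limit $$t_n(h)=\lim_{\varphi\to\beta J,\ \varphi\in R}\frac1{n!}\left(-\tfrac12\beta K^{ij}u_iu_j\right)^n\Psi_h(\varphi)$$ exists (it is the value at $\beta J$ if $\beta J\in R$), and $\langle e^{-\beta A}f,h\rangle=\sum_{n=0}^\infty t_n(h)$. -/

import Mathlib

open scoped Manifold ContDiff Topology

noncomputable section

namespace HomSpace

open MeasureTheory Filter

variable {E : Type*} [NormedAddCommGroup E] [NormedSpace ℝ E]
  {G : Type*} [TopologicalSpace G] [ChartedSpace E G] [Group G]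

/-- The exponential map of a Lie group: the value at time `1` of the integral curve through the
identity of the left-invariant vector field with value `X` at the identity. -/
def lieExp (X : GroupLieAlgebra 𝓘(ℝ, E) G) : G :=
  open Classical in
  if h : ∃ γ : ℝ → G, γ 0 = 1 ∧
      IsMIntegralCurve (I := 𝓘(ℝ, E)) γ (mulInvariantVectorField X)
  then h.choose 1 else 1

section Algebra

variable {ι : Type*} [Fintype ι] [DecidableEq ι]
  (T : Module.Basis ι ℝ (GroupLieAlgebra 𝓘(ℝ, E) G))

/-- The matrix `φ^k C_k`, where `[T_i, T_j] = C^k_{ij} T_k` and `(C_i)^j_k = C^j_{ik}`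
(upper index: row, lower right index: column). -/
def adMatrix (φ : ι → ℝ) : Matrix ι ι ℝ :=
  Matrix.of fun j l => ∑ k, φ k * T.repr ⁅T k, T l⁆ j

/-- The Killing tensor `K_{ij} = - tr (C_i C_j)`. -/
def killing : Matrix ι ι ℝ :=
  Matrix.of fun i j => -(adMatrix T (Pi.single i 1) * adMatrix T (Pi.single j 1)).trace

/-- The matrix `ω(φ) = (e^{-X} - 1) / (-X)` with `X = φ^k C_k`, i.e. the entire function
`(e^z - 1) / z = ∑ z^n / (n+1)!` at `z = -X`. -/
def omegaMatrix (φ : ι → ℝ) : Matrix ι ι ℝ :=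
  ∑' n : ℕ, (((n + 1).factorial : ℝ)⁻¹) • (-adMatrix T φ) ^ n

/-- The points `φ` at which `(-X) / (e^{-X} - 1)`, `X = φ^k C_k`, is not singular. -/
def regularSet : Set (ι → ℝ) := {φ | IsUnit (omegaMatrix T φ).det}

/-- The first order differential operator `u_i = ((-X) / (e^{-X} - 1))^j_i ∂/∂φ^j`,
`X = φ^k C_k`, on functions of `φ`. -/
def uOp (i : ι) (Ψ : (ι → ℝ) → ℝ) : (ι → ℝ) → ℝ := fun φ =>
  ∑ j, (omegaMatrix T φ)⁻¹ j i * fderiv ℝ Ψ φ (Pi.single j 1)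

/-- The second order operator `-(β/2) K^{ij} u_i u_j`. -/
def uCasimir (β : ℝ) (Ψ : (ι → ℝ) → ℝ) : (ι → ℝ) → ℝ := fun φ =>
  -(1 / 2) * β * ∑ i, ∑ j, (killing T)⁻¹ i j * uOp T i (uOp T j Ψ) φ

/-- `e^{-(β/2) K^{ij} u_i u_j} Ψ` at `φ = φ₀` equals `a`: the exponential is its power series, and
since the `u_i` may be singular at `φ₀`, the value at `φ₀` of each term is its limit along regular
points (which is its actual value if `φ₀` is regular). -/
def HasDerivativeExpansion (β : ℝ) (Ψ : (ι → ℝ) → ℝ) (φ₀ : ι → ℝ) (a : ℝ) : Prop :=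
  ContDiff ℝ ∞ Ψ ∧
  ∃ t : ℕ → ℝ,
    (∀ n, Tendsto (fun φ => (uCasimir T β)^[n] Ψ φ / (n.factorial : ℝ))
      (𝓝[regularSet T] φ₀) (𝓝 (t n))) ∧
    Tendsto (fun N => ∑ n ∈ Finset.range N, t n) atTop (𝓝 a)

end Algebra

section Functions

variable (E) in
/-- The smooth functions on `G/H`: those whose pullback to `G` is smooth. -/
def smoothFn (H : Subgroup G) : Submodule ℝ (G ⧸ H → ℝ) where
  carrier := {f | ContMDiff 𝓘(ℝ, E) 𝓘(ℝ, ℝ) ∞ fun g : G => f (g : G ⧸ H)}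
  add_mem' hf hg := by
    simp only [Set.mem_ofPred_eq] at *
    exact hf.add hg
  zero_mem' := by
    simp only [Set.mem_ofPred_eq, Pi.zero_apply]
    exact contMDiff_const
  smul_mem' c f hf := by
    simp only [Set.mem_ofPred_eq, Pi.smul_apply, smul_eq_mul] at *
    exact contMDiff_const.mul hf

variable [LieGroup 𝓘(ℝ, E) ∞ G] {H : Subgroup G}

/-- The translation `f ↦ f (g⁻¹ · )`. -/
def translate (g : G) : Module.End ℝ (smoothFn E H) where
  toFun f := ⟨fun x => (f : G ⧸ H → ℝ) (g⁻¹ • x), by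
    have hf : ContMDiff 𝓘(ℝ, E) 𝓘(ℝ, ℝ) ∞ fun a : G => (f : G ⧸ H → ℝ) (a : G ⧸ H) := f.2
    exact hf.comp (contMDiff_mul_left (I := 𝓘(ℝ, E)) (n := ∞) (a := g⁻¹))⟩
  map_add' _ _ := rfl
  map_smul' _ _ := rfl

theorem contMDiff_orbit (f : smoothFn E H) (x : G ⧸ H) :
    ContMDiff 𝓘(ℝ, E) 𝓘(ℝ, ℝ) ∞ fun a : G => (f : G ⧸ H → ℝ) (a • x) := by
  have hf : ContMDiff 𝓘(ℝ, E) 𝓘(ℝ, ℝ) ∞ fun a : G => (f : G ⧸ H → ℝ) (a : G ⧸ H) := f.2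
  induction x using QuotientGroup.induction_on with
  | H g => exact hf.comp (contMDiff_mul_right (I := 𝓘(ℝ, E)) (n := ∞) (a := g))

theorem contMDiff_orbit_deriv (f : smoothFn E H) (X : GroupLieAlgebra 𝓘(ℝ, E) G) :
    ContMDiff 𝓘(ℝ, E) 𝓘(ℝ, ℝ) ∞ fun g : G =>
      mvfderiv 𝓘(ℝ, E) (fun a : G => (f : G ⧸ H → ℝ) (a • (g : G ⧸ H))) 1 X := by
  have hf : ContMDiff 𝓘(ℝ, E) 𝓘(ℝ, ℝ) ∞ fun a : G => (f : G ⧸ H → ℝ) (a : G ⧸ H) := f.2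
  have : IsManifold 𝓘(ℝ, E) ∞ G := inferInstance
  have : IsManifold 𝓘(ℝ, E) 1 G := IsManifold.of_le (n := ∞) (by simp)
  intro g₀
  have hu : ContMDiff (𝓘(ℝ, E).prod 𝓘(ℝ, E)) 𝓘(ℝ, ℝ) ∞
      (Function.uncurry fun g a : G => (f : G ⧸ H → ℝ) (a • (g : G ⧸ H))) :=
    hf.comp (contMDiff_snd.mul contMDiff_fst)
  have key := ContMDiffAt.mfderiv_apply (m := ∞) (n := ∞) (x₀ := g₀)
    (fun g a : G => (f : G ⧸ H → ℝ) (a • (g : G ⧸ H))) (fun _ : G => (1 : G)) (id : G → G)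
    (fun _ : G => (show E from X)) hu.contMDiffAt
    contMDiffAt_const contMDiffAt_id contMDiffAt_const (by simp)
  refine key.congr_of_eventuallyEq (Eventually.of_forall fun g => ?_)
  have h0 := inTangentCoordinates_eq (I := 𝓘(ℝ, E)) (I' := 𝓘(ℝ, ℝ)) (fun _ : G => (1 : G))
    (fun g : G => (f : G ⧸ H → ℝ) ((1 : G) • (g : G ⧸ H)))
    (fun g : G => mfderiv 𝓘(ℝ, E) 𝓘(ℝ, ℝ) (fun a : G => (f : G ⧸ H → ℝ) (a • (g : G ⧸ H))) 1)
    (x₀ := g₀) (x := g) (mem_chart_source E (1 : G)) (by simp [chartAt_self_eq])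
  have h1 := (tangentBundleCore 𝓘(ℝ, E) G).coordChange_self (achart E (1 : G)) 1
    (mem_chart_source E (1 : G)) (show E from X)
  rw [tangentBundleCore_coordChange_model_space] at h0
  refine Eq.trans ?_ (DFunLike.congr_fun h0 (show E from X)).symm
  exact (congrArg (fun Y : E => (show E →L[ℝ] ℝ from
    mfderiv 𝓘(ℝ, E) 𝓘(ℝ, ℝ) (fun a : G => (f : G ⧸ H → ℝ) (a • (g : G ⧸ H))) 1) Y) h1).symm

/-- The vector field `v_X` on `G/H`, as a derivation of smooth functions:
`(v_X f)(x) = d/dt f (exp (-t X) x)` at `t = 0`, written as a derivative along the orbit map.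
These are the infinitesimal generators of the translations `translate (exp (t X))`, and
`[v_X, v_Y] = v_[X, Y]`. -/
def vf (X : GroupLieAlgebra 𝓘(ℝ, E) G) : Module.End ℝ (smoothFn E H) where
  toFun f := ⟨fun x => -mvfderiv 𝓘(ℝ, E) (fun a : G => (f : G ⧸ H → ℝ) (a • x)) 1 X,
    (contMDiff_orbit_deriv f X).neg⟩
  map_add' f g := by
    ext x
    have h := mvfderiv_fun_add
      ((contMDiff_orbit f x).mdifferentiableAt (x := 1) (by simp))
      ((contMDiff_orbit g x).mdifferentiableAt (x := 1) (by simp))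
    simp only [Submodule.coe_add, Pi.add_apply, h, add_apply]
    ring
  map_smul' c f := by
    ext x
    have h := mvfderiv_fun_smul (mdifferentiableAt_const (c := c))
      ((contMDiff_orbit f x).mdifferentiableAt (x := 1) (by simp))
    simp only [smul_eq_mul] at h
    simp [h, mvfderiv_const]

variable {ι : Type*} [Fintype ι] [DecidableEq ι]
  (T : Module.Basis ι ℝ (GroupLieAlgebra 𝓘(ℝ, E) G))

/-- The operator `e^{φ^i v_i}`: translation by `exp (φ^i T_i)`. -/
def expV (φ : ι → ℝ) : Module.End ℝ (smoothFn E H) := translate (lieExp (∑ i, φ i • T i))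

/-- The operator `K^{ij} v_i v_j`. -/
def casimir : Module.End ℝ (smoothFn E H) :=
  ∑ i, ∑ j, (killing T)⁻¹ i j • (vf (T i) * vf (T j))

/-- A linear functional on smooth functions is a distribution on the compact manifold `G/H` if it
is continuous for the `C^∞` topology, i.e. bounded by a multiple of the sup norms of finitely many
of the derivatives `v_{i_1} ⋯ v_{i_m} h` (the `v_i` span every tangent space). -/
def IsDistribution (U : smoothFn E H →ₗ[ℝ] ℝ) : Prop :=
  ∃ (k : ℕ) (C : ℝ), ∀ (h : smoothFn E H) (B : ℝ),
    (∀ w : List ι, w.length ≤ k → ∀ x : G ⧸ H,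
      |((w.map fun i => vf (T i)).prod h : G ⧸ H → ℝ) x| ≤ B) → |U h| ≤ C * B

/-- The action of the vector field `v_X` on distributions, `(v_X U)(h) = -U (v_X h)`. -/
def distVf (X : GroupLieAlgebra 𝓘(ℝ, E) G) (U : smoothFn E H →ₗ[ℝ] ℝ) :
    smoothFn E H →ₗ[ℝ] ℝ := -(U ∘ₗ vf X)

/-- The operator `(1/2) K^{ij} v_i v_j - J^i v_i` on distributions. -/
def distGenerator (J : ι → ℝ) (U : smoothFn E H →ₗ[ℝ] ℝ) : smoothFn E H →ₗ[ℝ] ℝ :=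
  (1 / 2 : ℝ) • ∑ i, ∑ j, (killing T)⁻¹ i j • distVf (T i) (distVf (T j) U)
    - ∑ i, J i • distVf (T i) U

variable [MeasurableSpace (G ⧸ H)] (μ : Measure (G ⧸ H))

/-- The pairing `∫ h f` of functions on `G/H`. -/
def pairing (h f : smoothFn E H) : ℝ :=
  ∫ x, (h : G ⧸ H → ℝ) x * (f : G ⧸ H → ℝ) x ∂μ

/-- `U s = e^{-s A} f` for `s` between `0` and `β`, where `A = (1/2) K^{ij} v_i v_j - J^i v_i`:
a curve of distributions with `U 0 = f` and `dU/ds = -A U`. The kernel `⟨x| e^{-β A} |y⟩`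
integrated against `f(y)` is the distribution `U β` in `x`. -/
structure IsShiftedHeatEvolution (β : ℝ) (J : ι → ℝ) (f : smoothFn E H)
    (U : ℝ → smoothFn E H →ₗ[ℝ] ℝ) : Prop where
  isDistribution : ∀ s ∈ Set.uIcc 0 β, IsDistribution T (U s)
  initial : ∀ h, U 0 h = pairing μ h f
  evolution : ∀ s ∈ Set.uIcc 0 β, ∀ h,
    HasDerivWithinAt (fun r => U r h) (-(distGenerator T J (U s) h)) (Set.uIcc 0 β) s

/-- The series `∑ ⟨x| e^{φ^i v_i} (-(β/2) K^{ij} v_i v_j)^n |y⟩ / n!`, integrated against `f(y)`,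
converges in the space of distributions in `x`. -/
def SeriesConverges (β : ℝ) (φ : ι → ℝ) (f : smoothFn E H) : Prop :=
  ∃ S : smoothFn E H →ₗ[ℝ] ℝ, IsDistribution T S ∧ ∀ h,
    Tendsto (fun N => ∑ n ∈ Finset.range N,
      pairing μ h (expV T φ ((((-(1 / 2) * β) • casimir T) ^ n : Module.End ℝ (smoothFn E H)) f)) / (n.factorial : ℝ))
      atTop (𝓝 (S h))

end Functions
end HomSpace
end

open scoped Manifold ContDiff Topology

noncomputable section

namespace HomSpace

open MeasureTheory Filter

set_option linter.unusedSectionVars false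

/-! ### The exponential map as a flow of left-invariant fields -/

section Exponential

variable {E : Type*} [NormedAddCommGroup E] [NormedSpace ℝ E]
  {G : Type*} [TopologicalSpace G] [ChartedSpace E G] [Group G] [LieGroup 𝓘(ℝ, E) ∞ G]

/-! Write X = φ^k C_k, D = -(1/2) K^{ij} v_i v_j (`halfCasimir`) and v_J = J^i v_i. Two facts about
the translations e^{φv} carry the algebra. Moving v_j across e^{tφv} multiplies the row of fields by
the matrix e^{-tX} (`vf_translate_lieExp`); since the Killing tensor is ad-invariant, D therefore
commutes with translations (`casimir_translate`). By Duhamel's formula, the derivative of e^{φv} in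
φ^j is the sum over k of ω(φ)_{kj} e^{φv} v_k, with ω(φ) = ∫_0^1 e^{-tX} dt
(`hasFDerivAt_pairing_expV`).

The operators u_i contain ω⁻¹, so at regular φ they act on ⟨h, e^{φv} f⟩ by replacing f with v_i f.
Hence each term of the u-series equals ⟨h, e^{φv} (βD)^n f⟩ / n!, which is smooth in φ; this gives
the limits at singular points. Regular points are dense because det ω(sφ) is analytic in s and
equals 1 at s = 0.

It remains to identify the sum with e^{-βA} f. Testing the assumed series against e^{φv} D² h bounds
β^n/n! ⟨h, D^{n+2} f⟩; dividing by (n+1)(n+2) makes the series of β^n/n! ⟨h, D^n f⟩ absolutely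
convergent (`SeriesConverges.summable`). So F(s) = ∑ s^n/n! D^n f exists weakly for s between 0 and
β and solves F' = DF. Banach-Steinhaus (`exists_hasOrderBound`), available because the smooth
functions form a Fréchet space, makes F a curve of distributions of uniformly bounded order. As D
commutes with translations, e^{s v_J} F(s) solves the shifted equation, and at s = β it is the sum
of the series (`exists_isShiftedHeatEvolution`).

Uniqueness is less obvious: the v_i are skew, so D is nonnegative and for β > 0 the equation is a
backward heat equation. Translating by e^{-s v_J} removes J. Let W solve W' = DW with W(a) = 0, and
smear it to q_s(g) = W_s(h translated by g), a continuous function on G. D is symmetric for Haar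
measure, so ∫ q_s q_{a+β-s} is constant in s. It vanishes at s = a and equals ∫ q² at the midpoint,
so W vanishes at (a+β)/2 (`halfCasimir_evolution_midpoint`). Starting from a = 0, iteration gives
zeros accumulating at β, and continuity gives W(β) = 0. -/

theorem lieGroup_of_infty (n : ℕ) : LieGroup 𝓘(ℝ, E) n G :=
  LieGroup.of_le (n := ∞) (by exact_mod_cast le_top)

theorem lieGroup_minSmoothness (n : ℕ) : LieGroup 𝓘(ℝ, E) (minSmoothness ℝ n) G := by
  rw [minSmoothness_of_isRCLikeNormedField]
  exact lieGroup_of_infty n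

theorem isManifold_of_infty (n : ℕ) : IsManifold 𝓘(ℝ, E) n G :=
  IsManifold.of_le (n := ∞) (by exact_mod_cast le_top)

theorem contMDiff_one_mulInvariantVectorField (X : GroupLieAlgebra 𝓘(ℝ, E) G) :
    ContMDiff 𝓘(ℝ, E) 𝓘(ℝ, E).tangent 1
      (fun g : G => (⟨g, mulInvariantVectorField X g⟩ : TangentBundle 𝓘(ℝ, E) G)) := by
  have := lieGroup_minSmoothness (E := E) (G := G) 3
  have h := contMDiff_mulInvariantVectorField (I := 𝓘(ℝ, E)) (G := G) X
  exact h.of_le (by rw [minSmoothness_of_isRCLikeNormedField]; norm_num)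

theorem mfderiv_mul_left_mulInvariantVectorField (X : GroupLieAlgebra 𝓘(ℝ, E) G) (g a : G) :
    mfderiv 𝓘(ℝ, E) 𝓘(ℝ, E) (fun b : G => g * b) a (mulInvariantVectorField X a)
      = mulInvariantVectorField X (g * a) := by
  have hd : ∀ g a : G, MDifferentiableAt 𝓘(ℝ, E) 𝓘(ℝ, E) (fun b : G => g * b) a := fun g a =>
    (contMDiff_mul_left (I := 𝓘(ℝ, E)) (n := ∞) (a := g)).mdifferentiableAt (by simp)
  have hc : (fun b : G => g * a * b) = (fun b => g * b) ∘ (fun b => a * b) := by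
    ext b; simp [mul_assoc]
  have h1 : (mfderiv 𝓘(ℝ, E) 𝓘(ℝ, E) (fun b : G => g * a * b) 1 : E →L[ℝ] E) = _ :=
    (congrArg (fun F : G → G => (show E →L[ℝ] E from mfderiv 𝓘(ℝ, E) 𝓘(ℝ, E) F 1)) hc).trans
      (mfderiv_comp (I' := 𝓘(ℝ, E)) 1 (hd g (a * 1)) (hd a 1))
  have h2 : (mfderiv 𝓘(ℝ, E) 𝓘(ℝ, E) (fun b : G => g * b) (a * 1) : E →L[ℝ] E) =
      mfderiv 𝓘(ℝ, E) 𝓘(ℝ, E) (fun b : G => g * b) a :=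
    congrArg (fun c : G => (show E →L[ℝ] E from mfderiv 𝓘(ℝ, E) 𝓘(ℝ, E) (fun b : G => g * b) c))
      (mul_one a)
  refine (DFunLike.congr_fun h2 (show E from mulInvariantVectorField X a)).symm.trans ?_
  exact (DFunLike.congr_fun h1 (show E from X)).symm

theorem _root_.IsMIntegralCurveOn.mul_left {X : GroupLieAlgebra 𝓘(ℝ, E) G} {γ : ℝ → G} {s : Set ℝ}
    (hγ : IsMIntegralCurveOn (I := 𝓘(ℝ, E)) γ (mulInvariantVectorField X) s) (g : G) :
    IsMIntegralCurveOn (I := 𝓘(ℝ, E)) (fun t => g * γ t) (mulInvariantVectorField X) s := by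
  intro t ht
  have hd : MDifferentiableAt 𝓘(ℝ, E) 𝓘(ℝ, E) (fun b : G => g * b) (γ t) :=
    (contMDiff_mul_left (I := 𝓘(ℝ, E)) (n := ∞) (a := g)).mdifferentiableAt (by simp)
  have := hd.hasMFDerivAt.comp_hasMFDerivWithinAt t (hγ t ht)
  have h2 : ((1 : ℝ →L[ℝ] ℝ).smulRight (show E from mulInvariantVectorField X (g * γ t))) =
      (show E →L[ℝ] E from mfderiv 𝓘(ℝ, E) 𝓘(ℝ, E) (fun b : G => g * b) (γ t)).comp
        ((1 : ℝ →L[ℝ] ℝ).smulRight (show E from mulInvariantVectorField X (γ t))) := by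
    ext
    refine Eq.trans ?_ (congrArg (fun y : E => (show E →L[ℝ] E from mfderiv 𝓘(ℝ, E) 𝓘(ℝ, E)
      (fun b : G => g * b) (γ t)) y) (one_smul ℝ (show E from mulInvariantVectorField X (γ t)))).symm
    refine (one_smul ℝ (show E from mulInvariantVectorField X (g * γ t))).trans ?_
    exact (mfderiv_mul_left_mulInvariantVectorField X g (γ t)).symm
  exact h2 ▸ this

theorem mulInvariantVectorField_one (X : GroupLieAlgebra 𝓘(ℝ, E) G) :
    mulInvariantVectorField X (1 : G) = X := by
  have h : (fun b : G => 1 * b) = id := by ext b; simp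
  have h1 : (mfderiv 𝓘(ℝ, E) 𝓘(ℝ, E) (fun b : G => 1 * b) 1 : E →L[ℝ] E) =
      ContinuousLinearMap.id ℝ E :=
    (congrArg (fun F : G → G => (show E →L[ℝ] E from mfderiv 𝓘(ℝ, E) 𝓘(ℝ, E) F 1)) h).trans
      (mfderiv_id (x := (1 : G)))
  exact DFunLike.congr_fun h1 (show E from X)

variable [CompleteSpace E] [T2Space G]

/-- Left translation carries the local curve through 1 to every point with the same time interval
(-ε, ε), and a uniform existence time extends curves to all of ℝ. -/
theorem exists_isMIntegralCurve_mulInvariantVectorField (X : GroupLieAlgebra 𝓘(ℝ, E) G) :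
    ∃ γ : ℝ → G, γ 0 = 1 ∧ IsMIntegralCurve (I := 𝓘(ℝ, E)) γ (mulInvariantVectorField X) := by
  have := isManifold_of_infty (E := E) (G := G) 1
  have hX := contMDiff_one_mulInvariantVectorField X
  obtain ⟨γ, hγ0, hγ⟩ := exists_isMIntegralCurveAt_of_contMDiffAt_boundaryless (t₀ := 0)
    (hX.contMDiffAt (x := (1 : G)))
  rw [isMIntegralCurveAt_iff'] at hγ
  obtain ⟨ε, hε, hγ⟩ := hγ
  rw [Real.ball_eq_Ioo, zero_sub, zero_add] at hγ
  exact exists_isMIntegralCurve_of_isMIntegralCurveOn hX hε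
    (fun g => ⟨fun t => g * γ t, by simp [hγ0], hγ.mul_left g⟩) 1

/-- Completeness of the field excludes the default value `1` in the definition of `lieExp`. -/
theorem lieExp_spec (X : GroupLieAlgebra 𝓘(ℝ, E) G) :
    ∃ γ : ℝ → G, γ 0 = 1 ∧ IsMIntegralCurve (I := 𝓘(ℝ, E)) γ (mulInvariantVectorField X) ∧
      lieExp X = γ 1 := by
  have h := exists_isMIntegralCurve_mulInvariantVectorField X
  refine ⟨h.choose, h.choose_spec.1, h.choose_spec.2, ?_⟩
  simp only [lieExp]
  rw [dif_pos h]

theorem integralCurve_unique {X : GroupLieAlgebra 𝓘(ℝ, E) G} {γ γ' : ℝ → G}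
    (h : IsMIntegralCurve (I := 𝓘(ℝ, E)) γ (mulInvariantVectorField X))
    (h' : IsMIntegralCurve (I := 𝓘(ℝ, E)) γ' (mulInvariantVectorField X)) (h0 : γ 0 = γ' 0) :
    γ = γ' := by
  have := isManifold_of_infty (E := E) (G := G) 1
  exact isMIntegralCurve_Ioo_eq_of_contMDiff_boundaryless
    (contMDiff_one_mulInvariantVectorField X) h h' h0

theorem isMIntegralCurve_lieExp (X : GroupLieAlgebra 𝓘(ℝ, E) G) :
    IsMIntegralCurve (I := 𝓘(ℝ, E)) (fun t : ℝ => lieExp (t • X)) (mulInvariantVectorField X) := by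
  obtain ⟨γ, h0, hγ, -⟩ := lieExp_spec X
  have key : (fun t : ℝ => lieExp (t • X)) = γ := by
    ext t
    obtain ⟨γ', h0', hγ', h1⟩ := lieExp_spec (t • X)
    have h2 := hγ.comp_mul t
    rw [← mulInvariantVectorField_smul] at h2
    have := integralCurve_unique hγ' h2 (by simp [h0, h0'])
    rw [h1, this]
    simp
  rwa [key]

theorem lieExp_zero : lieExp (0 : GroupLieAlgebra 𝓘(ℝ, E) G) = 1 := by
  obtain ⟨γ, h0, hγ, h1⟩ := lieExp_spec (0 : GroupLieAlgebra 𝓘(ℝ, E) G)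
  have h2 : IsMIntegralCurve (I := 𝓘(ℝ, E)) (fun _ : ℝ => (1 : G))
      (mulInvariantVectorField (0 : GroupLieAlgebra 𝓘(ℝ, E) G)) :=
    isMIntegralCurve_const (map_zero (mfderiv 𝓘(ℝ, E) 𝓘(ℝ, E) (fun b : G => 1 * b) 1))
  rw [h1, integralCurve_unique hγ h2 h0]

theorem lieExp_add_smul (X : GroupLieAlgebra 𝓘(ℝ, E) G) (s t : ℝ) :
    lieExp ((s + t) • X) = lieExp (s • X) * lieExp (t • X) := by
  have h1 := (isMIntegralCurve_lieExp X).comp_add s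
  have h2 : IsMIntegralCurve (I := 𝓘(ℝ, E)) (fun t : ℝ => lieExp (s • X) * lieExp (t • X))
      (mulInvariantVectorField X) := by
    rw [isMIntegralCurve_iff_isMIntegralCurveOn]
    exact ((isMIntegralCurve_lieExp X).isMIntegralCurveOn _).mul_left _
  have := congrFun (integralCurve_unique h1 h2 (by simp [lieExp_zero])) t
  simpa [add_comm] using this

theorem lieExp_neg (X : GroupLieAlgebra 𝓘(ℝ, E) G) : lieExp (-X) = (lieExp X)⁻¹ := by
  have := lieExp_add_smul X (-1) 1
  simp only [neg_add_cancel, zero_smul, lieExp_zero, neg_smul, one_smul] at this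
  exact eq_inv_of_mul_eq_one_left this.symm

theorem continuous_lieExp_smul (X : GroupLieAlgebra 𝓘(ℝ, E) G) :
    Continuous fun t : ℝ => lieExp (t • X) :=
  continuous_iff_continuousAt.2 fun t => (isMIntegralCurve_lieExp X t).continuousAt

theorem hasMFDerivAt_lieExp_zero (X : GroupLieAlgebra 𝓘(ℝ, E) G) :
    HasMFDerivAt 𝓘(ℝ, ℝ) 𝓘(ℝ, E) (fun t : ℝ => (lieExp (t • X) : G)) 0
      ((1 : ℝ →L[ℝ] ℝ).smulRight (show E from X)) := by
  have h := isMIntegralCurve_lieExp X 0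
  have h0 : (lieExp ((0 : ℝ) • X) : G) = 1 := by rw [zero_smul, lieExp_zero]
  have h1 : (show E from mulInvariantVectorField X (lieExp ((0 : ℝ) • X) : G)) = (show E from X) :=
    (congrArg (fun g : G => (show E from mulInvariantVectorField X g)) h0).trans
      (mulInvariantVectorField_one X)
  exact (congrArg (fun Y : E => HasMFDerivAt 𝓘(ℝ, ℝ) 𝓘(ℝ, E) (fun t : ℝ => (lieExp (t • X) : G)) 0
    ((1 : ℝ →L[ℝ] ℝ).smulRight Y)) h1).mp h

/-- The derivative of a differentiable function along `t ↦ exp (t X)` at `t = 0`. -/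
theorem hasDerivAt_comp_lieExp {F : Type*} [NormedAddCommGroup F] [NormedSpace ℝ F] {Φ : G → F}
    (hΦ : MDifferentiableAt 𝓘(ℝ, E) 𝓘(ℝ, F) Φ 1) (X : GroupLieAlgebra 𝓘(ℝ, E) G) :
    HasDerivAt (fun t : ℝ => Φ (lieExp (t • X))) (mvfderiv 𝓘(ℝ, E) Φ 1 X) 0 := by
  have h0 : (lieExp ((0 : ℝ) • X) : G) = 1 := by simp [lieExp_zero]
  have h := HasMFDerivAt.comp (x := (0 : ℝ)) (g := Φ) (g' := mfderiv 𝓘(ℝ, E) 𝓘(ℝ, F) Φ 1)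
    (by rw [h0]; exact hΦ.hasMFDerivAt) (hasMFDerivAt_lieExp_zero X)
  have h2 := (show HasFDerivAt (fun t : ℝ => Φ (lieExp (t • X)))
    ((show E →L[ℝ] F from mfderiv 𝓘(ℝ, E) 𝓘(ℝ, F) Φ 1).comp
      ((1 : ℝ →L[ℝ] ℝ).smulRight (show E from X))) 0 from h.hasFDerivAt).hasDerivAt
  have h3 : (show E →L[ℝ] F from mfderiv 𝓘(ℝ, E) 𝓘(ℝ, F) Φ 1).comp
      ((1 : ℝ →L[ℝ] ℝ).smulRight (show E from X)) 1 = mvfderiv 𝓘(ℝ, E) Φ 1 X :=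
    congrArg (fun y : E => (show E →L[ℝ] F from mfderiv 𝓘(ℝ, E) 𝓘(ℝ, F) Φ 1) y)
      (one_smul ℝ (show E from X))
  rwa [h3] at h2

end Exponential

/-! ### Translations and their generators -/

section Translations

variable {E : Type*} [NormedAddCommGroup E] [NormedSpace ℝ E]
  {G : Type*} [TopologicalSpace G] [ChartedSpace E G] [Group G] [LieGroup 𝓘(ℝ, E) ∞ G]
  {H : Subgroup G}

theorem translate_apply (g : G) (f : smoothFn E H) (x : G ⧸ H) :
    (translate g f : G ⧸ H → ℝ) x = (f : G ⧸ H → ℝ) (g⁻¹ • x) := rfl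

theorem translate_mul (g g' : G) :
    translate (E := E) (H := H) (g * g') = translate g * translate g' := by
  ext f x
  simp [translate_apply, mul_smul]

theorem translate_one : translate (E := E) (H := H) (1 : G) = 1 := by
  ext f x
  simp [translate_apply]

theorem translate_inv_translate (g : G) (f : smoothFn E H) :
    translate g⁻¹ (translate g f) = f := by
  rw [← Module.End.mul_apply, ← translate_mul, inv_mul_cancel, translate_one, Module.End.one_apply]

theorem translate_translate_inv (g : G) (f : smoothFn E H) :
    translate g (translate g⁻¹ f) = f := by
  rw [← Module.End.mul_apply, ← translate_mul, mul_inv_cancel, translate_one, Module.End.one_apply]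

theorem vf_apply (X : GroupLieAlgebra 𝓘(ℝ, E) G) (f : smoothFn E H) (x : G ⧸ H) :
    (vf X f : G ⧸ H → ℝ) x
      = -mvfderiv 𝓘(ℝ, E) (fun a : G => (f : G ⧸ H → ℝ) (a • x)) 1 X := rfl

variable [CompleteSpace E] [T2Space G]

/-- The translations `translate (exp (t X))` are generated by `vf X`. -/
theorem hasDerivAt_translate_lieExp (X : GroupLieAlgebra 𝓘(ℝ, E) G) (f : smoothFn E H)
    (x : G ⧸ H) (t : ℝ) :
    HasDerivAt (fun t : ℝ => (translate (lieExp (t • X)) f : G ⧸ H → ℝ) x)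
      ((translate (lieExp (t • X)) (vf X f) : G ⧸ H → ℝ) x) t := by
  -- By the group law, the derivative at t is a derivative at 0 along the orbit of exp(tX)⁻¹x, in
  -- the variable t - s; the time reversal absorbs the minus sign of `vf`.
  have h := hasDerivAt_comp_lieExp ((contMDiff_orbit f ((lieExp (t • X))⁻¹ • x)).mdifferentiableAt
    (x := 1) (by simp)) X
  have h' : HasDerivAt (fun s : ℝ => t - s) (-1) t := by
    simpa using (hasDerivAt_id t).const_sub t
  have h0 : t - t = 0 := sub_self t
  rw [← h0] at h
  have h2 := h.scomp t h'
  have h3 : (fun s : ℝ => (translate (lieExp (s • X)) f : G ⧸ H → ℝ) x) =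
      (fun r : ℝ => (f : G ⧸ H → ℝ) (lieExp (r • X) • (lieExp (t • X))⁻¹ • x)) ∘ fun s => t - s := by
    ext s
    simp only [translate_apply, Function.comp_apply, ← mul_smul, ← lieExp_neg]
    rw [← neg_smul, ← neg_smul, ← lieExp_add_smul]
    ring_nf
  rw [h3]
  refine h2.congr_deriv ?_
  simp [translate_apply, vf_apply]

end Translations

theorem two_le_infty : (2 : WithTop ℕ∞) ≤ ∞ := by
  exact WithTop.coe_le_coe.2 (le_top : (2 : ℕ∞) ≤ ⊤)

/-! ### Derivatives at the identity in the preferred chart -/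

section ChartAtOne

variable {E : Type*} [NormedAddCommGroup E] [NormedSpace ℝ E]
  {G : Type*} [TopologicalSpace G] [ChartedSpace E G] [Group G]
  {F : Type*} [NormedAddCommGroup F] [NormedSpace ℝ F]

variable (E G) in
/-- The inverse of the preferred chart at the identity. -/
def oneChartInv : E → G := (extChartAt 𝓘(ℝ, E) (1 : G)).symm

variable (E G) in
/-- The coordinates of the identity in its preferred chart. -/
def oneCoord : E := extChartAt 𝓘(ℝ, E) (1 : G) 1

/-- A tangent vector at the identity, in the coordinates of the preferred chart. -/
def modelVec (X : GroupLieAlgebra 𝓘(ℝ, E) G) : E := X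

theorem oneChartInv_oneCoord : oneChartInv E G (oneCoord E G) = 1 :=
  extChartAt_to_inv (I := 𝓘(ℝ, E)) (1 : G)

/-- The preferred chart at 1 is also the one that trivialises the tangent space there, so no
transition map appears. -/
theorem mvfderiv_one_eq {Φ : G → F} (hΦ : MDifferentiableAt 𝓘(ℝ, E) 𝓘(ℝ, F) Φ 1)
    (X : GroupLieAlgebra 𝓘(ℝ, E) G) :
    mvfderiv 𝓘(ℝ, E) Φ 1 X
      = fderiv ℝ (fun y => Φ (oneChartInv E G y)) (oneCoord E G) (modelVec X) := by
  have h : (show E →L[ℝ] F from mfderiv 𝓘(ℝ, E) 𝓘(ℝ, F) Φ 1)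
      = fderiv ℝ (fun y => Φ (oneChartInv E G y)) (oneCoord E G) := by
    refine (MDifferentiableAt.mfderiv hΦ).trans ?_
    simp only [modelWithCornersSelf_coe, Set.range_id, fderivWithin_univ]
    rfl
  exact DFunLike.congr_fun h (show E from X)

variable [LieGroup 𝓘(ℝ, E) ∞ G]

theorem contMDiffAt_oneChartInv {y : E} (hy : y ∈ (extChartAt 𝓘(ℝ, E) (1 : G)).target) :
    ContMDiffAt 𝓘(ℝ, E) 𝓘(ℝ, E) ∞ (oneChartInv E G) y :=
  (contMDiffOn_extChartAt_symm (n := ∞) (1 : G)).contMDiffAt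
    ((isOpen_extChartAt_target (I := 𝓘(ℝ, E)) (1 : G)).mem_nhds hy)

theorem eventually_mem_target_oneCoord :
    ∀ᶠ y in 𝓝 (oneCoord E G), y ∈ (extChartAt 𝓘(ℝ, E) (1 : G)).target :=
  (isOpen_extChartAt_target (I := 𝓘(ℝ, E)) (1 : G)).mem_nhds (mem_extChartAt_target 1)

theorem contDiffAt_comp_oneChartInv {Φ : G → F} (hΦ : ContMDiff 𝓘(ℝ, E) 𝓘(ℝ, F) ∞ Φ) {y : E}
    (hy : y ∈ (extChartAt 𝓘(ℝ, E) (1 : G)).target) :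
    ContDiffAt ℝ ∞ (fun y => Φ (oneChartInv E G y)) y :=
  (hΦ.contMDiffAt.comp y (contMDiffAt_oneChartInv hy)).contDiffAt

theorem contDiffAt_comp_oneChartInv_prod {N : G × G → F}
    (hN : ContMDiff (𝓘(ℝ, E).prod 𝓘(ℝ, E)) 𝓘(ℝ, F) ∞ N) {p : E × E}
    (h1 : p.1 ∈ (extChartAt 𝓘(ℝ, E) (1 : G)).target)
    (h2 : p.2 ∈ (extChartAt 𝓘(ℝ, E) (1 : G)).target) :
    ContDiffAt ℝ ∞ (fun p : E × E => N (oneChartInv E G p.1, oneChartInv E G p.2)) p := by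
  have hf : ContMDiffAt 𝓘(ℝ, E × E) 𝓘(ℝ, E) ∞ (fun p : E × E => oneChartInv E G p.1) p :=
    (contMDiffAt_oneChartInv h1).comp p contDiff_fst.contMDiff.contMDiffAt
  have hs : ContMDiffAt 𝓘(ℝ, E × E) 𝓘(ℝ, E) ∞ (fun p : E × E => oneChartInv E G p.2) p :=
    (contMDiffAt_oneChartInv h2).comp p contDiff_snd.contMDiff.contMDiffAt
  exact (hN.contMDiffAt.comp p (hf.prodMk hs)).contDiffAt

/-- Smoothness of derivatives at the identity with respect to parameters. -/
theorem contMDiff_mvfderiv_one_param {EP HP P : Type*} [NormedAddCommGroup EP] [NormedSpace ℝ EP]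
    [TopologicalSpace HP] {I : ModelWithCorners ℝ EP HP} [TopologicalSpace P] [ChartedSpace HP P]
    [IsManifold I ∞ P] {N : P → G → ℝ}
    (hN : ContMDiff (I.prod 𝓘(ℝ, E)) 𝓘(ℝ, ℝ) ∞ (Function.uncurry N))
    (X : GroupLieAlgebra 𝓘(ℝ, E) G) :
    ContMDiff I 𝓘(ℝ, ℝ) ∞ fun p : P => mvfderiv 𝓘(ℝ, E) (N p) 1 X := by
  have : IsManifold 𝓘(ℝ, E) 1 G := IsManifold.of_le (n := ∞) (by simp)
  have : IsManifold I 1 P := IsManifold.of_le (n := ∞) (by simp)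
  intro p₀
  have key := ContMDiffAt.mfderiv_apply (m := ∞) (n := ∞) (x₀ := p₀)
    N (fun _ : P => (1 : G)) (id : P → P)
    (fun _ : P => (show E from X)) hN.contMDiffAt
    contMDiffAt_const contMDiffAt_id contMDiffAt_const (by simp)
  refine key.congr_of_eventuallyEq (Eventually.of_forall fun p => ?_)
  have h0 := inTangentCoordinates_eq (I := 𝓘(ℝ, E)) (I' := 𝓘(ℝ, ℝ)) (fun _ : P => (1 : G))
    (fun p : P => N p 1)
    (fun p : P => mfderiv 𝓘(ℝ, E) 𝓘(ℝ, ℝ) (N p) 1)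
    (x₀ := p₀) (x := p) (mem_chart_source E (1 : G)) (by simp [chartAt_self_eq])
  have h1 := (tangentBundleCore 𝓘(ℝ, E) G).coordChange_self (achart E (1 : G)) 1
    (mem_chart_source E (1 : G)) (show E from X)
  rw [tangentBundleCore_coordChange_model_space] at h0
  refine Eq.trans ?_ (DFunLike.congr_fun h0 (show E from X)).symm
  exact (congrArg (fun Y : E => (show E →L[ℝ] ℝ from
    mfderiv 𝓘(ℝ, E) 𝓘(ℝ, ℝ) (N p) 1) Y) h1).symm

/-- The mixed second derivative at `(1, 1)`, in the chart at the identity. -/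
theorem mvfderiv_mvfderiv_one_eq {N : G → G → ℝ}
    (hN : ContMDiff (𝓘(ℝ, E).prod 𝓘(ℝ, E)) 𝓘(ℝ, ℝ) ∞ (Function.uncurry N))
    (X Y : GroupLieAlgebra 𝓘(ℝ, E) G) :
    mvfderiv 𝓘(ℝ, E) (fun a : G => mvfderiv 𝓘(ℝ, E) (N a) 1 Y) 1 X
      = fderiv ℝ (fderiv ℝ fun p : E × E => N (oneChartInv E G p.1) (oneChartInv E G p.2))
        (oneCoord E G, oneCoord E G) (modelVec X, 0) (0, modelVec Y) := by
  set n : E × E → ℝ := fun p => N (oneChartInv E G p.1) (oneChartInv E G p.2) with hn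
  set e := oneCoord E G with he
  have hem : e ∈ (extChartAt 𝓘(ℝ, E) (1 : G)).target := mem_extChartAt_target 1
  have hcd : ∀ y ∈ (extChartAt 𝓘(ℝ, E) (1 : G)).target, ContDiffAt ℝ ∞ n (y, e) := fun y hy =>
    contDiffAt_comp_oneChartInv_prod hN hy hem
  have hsm := contMDiff_mvfderiv_one_param hN Y
  rw [mvfderiv_one_eq (hsm.mdifferentiableAt (by simp))]
  have hev : (fun y : E => mvfderiv 𝓘(ℝ, E) (N (oneChartInv E G y)) 1 Y) =ᶠ[𝓝 e]
      fun y => fderiv ℝ n (y, e) (0, modelVec Y) := by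
    filter_upwards [eventually_mem_target_oneCoord (E := E) (G := G)] with y hy
    have hs : ContMDiff 𝓘(ℝ, E) 𝓘(ℝ, ℝ) ∞ (N (oneChartInv E G y)) :=
      hN.comp (contMDiff_const.prodMk contMDiff_id)
    rw [mvfderiv_one_eq (hs.mdifferentiableAt (by simp))]
    have h1 : HasFDerivAt n (fderiv ℝ n (y, e)) (y, e) :=
      ((hcd y hy).differentiableAt (by simp)).hasFDerivAt
    have h2 : HasFDerivAt (fun z => n (y, z)) _ e :=
      h1.comp e ((hasFDerivAt_const y e).prodMk (hasFDerivAt_id e))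
    have h3 : (fun z => N (oneChartInv E G y) (oneChartInv E G z)) = fun z => n (y, z) := rfl
    rw [h3, h2.fderiv]
    simp
  rw [hev.fderiv_eq]
  have h4 : HasFDerivAt (fderiv ℝ n) (fderiv ℝ (fderiv ℝ n) (e, e)) (e, e) :=
    (((hcd e hem).fderiv_right (m := ∞) (by simp)).differentiableAt
      (by simp)).hasFDerivAt
  have h5 : HasFDerivAt (fun y => fderiv ℝ n (y, e)) _ e :=
    HasFDerivAt.comp (f := fun y => (y, e)) e h4
      ((hasFDerivAt_id e).prodMk (hasFDerivAt_const e e))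
  rw [(h5.clm_apply (hasFDerivAt_const ((0, modelVec Y) : E × E) e)).fderiv]
  simp

/-- Schwarz's theorem in the chart: exchanging the arguments of N is composition with the swap of E
× E. The commutator computations below rest on it. -/
theorem mvfderiv_mvfderiv_one_comm {N : G → G → ℝ}
    (hN : ContMDiff (𝓘(ℝ, E).prod 𝓘(ℝ, E)) 𝓘(ℝ, ℝ) ∞ (Function.uncurry N))
    (X Y : GroupLieAlgebra 𝓘(ℝ, E) G) :
    mvfderiv 𝓘(ℝ, E) (fun a : G => mvfderiv 𝓘(ℝ, E) (N a) 1 Y) 1 X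
      = mvfderiv 𝓘(ℝ, E) (fun b : G => mvfderiv 𝓘(ℝ, E) (fun a => N a b) 1 X) 1 Y := by
  have hN' : ContMDiff (𝓘(ℝ, E).prod 𝓘(ℝ, E)) 𝓘(ℝ, ℝ) ∞
      (Function.uncurry fun b a => N a b) := hN.comp (contMDiff_snd.prodMk contMDiff_fst)
  rw [mvfderiv_mvfderiv_one_eq hN, mvfderiv_mvfderiv_one_eq hN']
  set n : E × E → ℝ := fun p => N (oneChartInv E G p.1) (oneChartInv E G p.2) with hn
  set e := oneCoord E G with he
  have hem : e ∈ (extChartAt 𝓘(ℝ, E) (1 : G)).target := mem_extChartAt_target 1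
  have hcd : ContDiffAt ℝ ∞ n (e, e) := contDiffAt_comp_oneChartInv_prod hN hem hem
  have hsw : (fun p : E × E => N (oneChartInv E G p.2) (oneChartInv E G p.1))
      = n ∘ (ContinuousLinearEquiv.prodComm ℝ E E) := rfl
  have h1 : fderiv ℝ (n ∘ (ContinuousLinearEquiv.prodComm ℝ E E))
      = fun p => (fderiv ℝ n (ContinuousLinearEquiv.prodComm ℝ E E p)).comp
        (ContinuousLinearEquiv.prodComm ℝ E E : E × E →L[ℝ] E × E) := by
    ext1 p
    rw [ContinuousLinearEquiv.comp_right_fderiv]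
  have h4 : HasFDerivAt (fderiv ℝ n) (fderiv ℝ (fderiv ℝ n) (e, e))
      (ContinuousLinearEquiv.prodComm ℝ E E (e, e)) :=
    ((hcd.fderiv_right (m := ∞) (by simp)).differentiableAt (by simp)).hasFDerivAt
  have h5 := (h4.comp (e, e) (ContinuousLinearEquiv.prodComm ℝ E E).hasFDerivAt).clm_comp
    (hasFDerivAt_const (ContinuousLinearEquiv.prodComm ℝ E E : E × E →L[ℝ] E × E) (e, e))
  rw [hsw, h1]
  have h6 := h5.fderiv
  simp only [Function.comp_def] at h6
  rw [h6]
  have hsymm := hcd.isSymmSndFDerivAt (by simpa using two_le_infty)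
  simp [hsymm.eq (modelVec X, 0) (0, modelVec Y)]

end ChartAtOne

/-! ### The bracket as a commutator of derivations -/

section Bracket

variable {E : Type*} [NormedAddCommGroup E] [NormedSpace ℝ E]
  {G : Type*} [TopologicalSpace G] [ChartedSpace E G] [Group G] [LieGroup 𝓘(ℝ, E) ∞ G]

/-- A left-invariant vector field in the chart at the identity. -/
def chartField (X : GroupLieAlgebra 𝓘(ℝ, E) G) (y : E) : E :=
  VectorField.mpullbackWithin 𝓘(ℝ, E) 𝓘(ℝ, E) (extChartAt 𝓘(ℝ, E) (1 : G)).symm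
    (mulInvariantVectorField X) (Set.range 𝓘(ℝ, E)) y

theorem mvfderiv_mulInvariantVectorField {F : G → ℝ} (hF : ContMDiff 𝓘(ℝ, E) 𝓘(ℝ, ℝ) ∞ F)
    (X : GroupLieAlgebra 𝓘(ℝ, E) G) (g : G) :
    mvfderiv 𝓘(ℝ, E) F g (mulInvariantVectorField X g)
      = mvfderiv 𝓘(ℝ, E) (fun b => F (g * b)) 1 X := by
  have hd : MDifferentiableAt 𝓘(ℝ, E) 𝓘(ℝ, E) (fun b : G => g * b) 1 :=
    (contMDiff_mul_left (I := 𝓘(ℝ, E)) (n := ∞) (a := g)).mdifferentiableAt (by simp)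
  have h1 : (show E →L[ℝ] ℝ from mfderiv 𝓘(ℝ, E) 𝓘(ℝ, ℝ) (fun b => F (g * b)) 1) = _ :=
    mfderiv_comp (I' := 𝓘(ℝ, E)) 1 (hF.mdifferentiableAt (x := g * 1) (by simp)) hd
  have h2 : (show E →L[ℝ] ℝ from mfderiv 𝓘(ℝ, E) 𝓘(ℝ, ℝ) F (g * 1)) =
      mfderiv 𝓘(ℝ, E) 𝓘(ℝ, ℝ) F g :=
    congrArg (fun c : G => (show E →L[ℝ] ℝ from mfderiv 𝓘(ℝ, E) 𝓘(ℝ, ℝ) F c)) (mul_one g)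
  refine (DFunLike.congr_fun h2 (show E from mulInvariantVectorField X g)).symm.trans ?_
  exact (DFunLike.congr_fun h1 (modelVec X)).symm

theorem fderiv_comp_oneChartInv_chartField [CompleteSpace E] {F : G → ℝ}
    (hF : ContMDiff 𝓘(ℝ, E) 𝓘(ℝ, ℝ) ∞ F)
    (X : GroupLieAlgebra 𝓘(ℝ, E) G) {y : E} (hy : y ∈ (extChartAt 𝓘(ℝ, E) (1 : G)).target) :
    fderiv ℝ (fun y => F (oneChartInv E G y)) y (chartField X y)
      = mvfderiv 𝓘(ℝ, E) (fun b => F (oneChartInv E G y * b)) 1 X := by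
  have := isManifold_of_infty (E := E) (G := G) 1
  rw [← mvfderiv_mulInvariantVectorField hF]
  have hψ : MDifferentiableAt 𝓘(ℝ, E) 𝓘(ℝ, E) (oneChartInv E G) y :=
    (contMDiffAt_oneChartInv hy).mdifferentiableAt (by simp)
  have h1 : (show E →L[ℝ] ℝ from mfderiv 𝓘(ℝ, E) 𝓘(ℝ, ℝ) (fun y => F (oneChartInv E G y)) y) =
    (show E →L[ℝ] ℝ from mfderiv 𝓘(ℝ, E) 𝓘(ℝ, ℝ) F (oneChartInv E G y)).comp
      (show E →L[ℝ] E from mfderiv 𝓘(ℝ, E) 𝓘(ℝ, E) (oneChartInv E G) y) :=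
    mfderiv_comp (I' := 𝓘(ℝ, E)) y (hF.mdifferentiableAt (by simp)) hψ
  have h2 : fderiv ℝ (fun y => F (oneChartInv E G y)) y = _ := mfderiv_eq_fderiv.symm.trans h1
  -- `chartField` is built with `ContinuousLinearMap.inverse`, which is 0 on non-invertible maps.
  have hinv : (show E →L[ℝ] E from mfderivWithin 𝓘(ℝ, E) 𝓘(ℝ, E)
      (extChartAt 𝓘(ℝ, E) (1 : G)).symm (Set.range 𝓘(ℝ, E)) y).IsInvertible :=
    isInvertible_mfderivWithin_extChartAt_symm hy
  have h3 : (show E →L[ℝ] E from mfderivWithin 𝓘(ℝ, E) 𝓘(ℝ, E)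
      (extChartAt 𝓘(ℝ, E) (1 : G)).symm (Set.range 𝓘(ℝ, E)) y) =
      (show E →L[ℝ] E from mfderiv 𝓘(ℝ, E) 𝓘(ℝ, E) (oneChartInv E G) y) := by
    have hr : Set.range 𝓘(ℝ, E) = Set.univ := by simp
    exact (congrArg (fun s : Set E => (show E →L[ℝ] E from mfderivWithin 𝓘(ℝ, E) 𝓘(ℝ, E)
      (extChartAt 𝓘(ℝ, E) (1 : G)).symm s y)) hr).trans
      (congrFun mfderivWithin_univ y)
  rw [h2]
  have h4 : (show E →L[ℝ] E from mfderiv 𝓘(ℝ, E) 𝓘(ℝ, E) (oneChartInv E G) y) (chartField X y)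
      = (show E from mulInvariantVectorField X (oneChartInv E G y)) := by
    rw [← h3]
    exact hinv.self_apply_inverse _
  exact congrArg (fun z : E => (show E →L[ℝ] ℝ from mfderiv 𝓘(ℝ, E) 𝓘(ℝ, ℝ) F
    (oneChartInv E G y)) z) h4

theorem eventuallyEq_chart_oneChartInv :
    (fun y => extChartAt 𝓘(ℝ, E) (1 : G) (oneChartInv E G y)) =ᶠ[𝓝 (oneCoord E G)] id := by
  filter_upwards [eventually_mem_target_oneCoord (E := E) (G := G)] with y hy
  exact (extChartAt 𝓘(ℝ, E) (1 : G)).right_inv hy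

theorem mfderiv_extChartAt_one :
    (show E →L[ℝ] E from mfderiv 𝓘(ℝ, E) 𝓘(ℝ, E) (extChartAt 𝓘(ℝ, E) (1 : G)) 1)
      = ContinuousLinearMap.id ℝ E := by
  have := isManifold_of_infty (E := E) (G := G) 1
  have hd : MDifferentiableAt 𝓘(ℝ, E) 𝓘(ℝ, E) (extChartAt 𝓘(ℝ, E) (1 : G)) 1 :=
    mdifferentiableAt_extChartAt (mem_chart_source E (1 : G))
  refine (MDifferentiableAt.mfderiv hd).trans ?_
  simp only [modelWithCornersSelf_coe, Set.range_id, fderivWithin_univ]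
  exact (eventuallyEq_chart_oneChartInv (E := E) (G := G)).fderiv_eq.trans fderiv_id

theorem mfderiv_oneChartInv :
    (show E →L[ℝ] E from mfderiv 𝓘(ℝ, E) 𝓘(ℝ, E) (oneChartInv E G) (oneCoord E G))
      = ContinuousLinearMap.id ℝ E := by
  have hd : MDifferentiableAt 𝓘(ℝ, E) 𝓘(ℝ, E) (oneChartInv E G) (oneCoord E G) :=
    (contMDiffAt_oneChartInv (mem_extChartAt_target 1)).mdifferentiableAt (by simp)
  refine (MDifferentiableAt.mfderiv hd).trans ?_
  simp only [modelWithCornersSelf_coe, Set.range_id, fderivWithin_univ]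
  have h : (fun y => extChartAt 𝓘(ℝ, E) (oneChartInv E G (oneCoord E G)) (oneChartInv E G y))
      =ᶠ[𝓝 (oneCoord E G)] id := by
    rw [oneChartInv_oneCoord]
    exact eventuallyEq_chart_oneChartInv
  exact h.fderiv_eq.trans fderiv_id

theorem chartField_oneCoord [CompleteSpace E] (X : GroupLieAlgebra 𝓘(ℝ, E) G) :
    chartField X (oneCoord E G) = modelVec X := by
  have h3 : (show E →L[ℝ] E from mfderivWithin 𝓘(ℝ, E) 𝓘(ℝ, E)
      (extChartAt 𝓘(ℝ, E) (1 : G)).symm (Set.range 𝓘(ℝ, E)) (oneCoord E G)) =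
      ContinuousLinearMap.id ℝ E := by
    have hr : Set.range 𝓘(ℝ, E) = Set.univ := by simp
    exact ((congrArg (fun s : Set E => (show E →L[ℝ] E from mfderivWithin 𝓘(ℝ, E) 𝓘(ℝ, E)
      (extChartAt 𝓘(ℝ, E) (1 : G)).symm s (oneCoord E G))) hr).trans
      (congrFun mfderivWithin_univ (oneCoord E G))).trans mfderiv_oneChartInv
  have h4 : chartField X (oneCoord E G) = (show E →L[ℝ] E from mfderivWithin 𝓘(ℝ, E) 𝓘(ℝ, E)
      (extChartAt 𝓘(ℝ, E) (1 : G)).symm (Set.range 𝓘(ℝ, E)) (oneCoord E G)).inverse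
      (show E from mulInvariantVectorField X (oneChartInv E G (oneCoord E G))) := rfl
  rw [h4, h3, ContinuousLinearMap.inverse_id]
  exact (congrArg (fun g : G => (show E from mulInvariantVectorField X g))
    (oneChartInv_oneCoord (E := E) (G := G))).trans (mulInvariantVectorField_one X)

theorem differentiableAt_chartField [CompleteSpace E] (X : GroupLieAlgebra 𝓘(ℝ, E) G) :
    DifferentiableAt ℝ (chartField X) (oneCoord E G) := by
  have := isManifold_of_infty (E := E) (G := G) 2
  have h := (contMDiff_one_mulInvariantVectorField X).mdifferentiableAt (x := (1 : G)) (by simp)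
  have h2 := h.mdifferentiableWithinAt.differentiableWithinAt_mpullbackWithin_vectorField
    (s := Set.univ)
  have h3 : ((extChartAt 𝓘(ℝ, E) (1 : G)).symm ⁻¹' Set.univ ∩ Set.range 𝓘(ℝ, E)) = Set.univ := by
    simp
  rw [h3] at h2
  exact differentiableWithinAt_univ.1 h2

/-- By definition the bracket is that of the left-invariant fields read in the chart; the chart has
derivative the identity at 1. -/
theorem modelVec_bracket (X Y : GroupLieAlgebra 𝓘(ℝ, E) G) :
    modelVec ⁅X, Y⁆ = fderiv ℝ (chartField Y) (oneCoord E G) (chartField X (oneCoord E G))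
      - fderiv ℝ (chartField X) (oneCoord E G) (chartField Y (oneCoord E G)) := by
  have h : modelVec ⁅X, Y⁆ =
      (show E →L[ℝ] E from mfderiv 𝓘(ℝ, E) 𝓘(ℝ, E) (extChartAt 𝓘(ℝ, E) (1 : G)) 1).inverse
      (VectorField.lieBracketWithin ℝ (chartField X) (chartField Y)
        ((extChartAt 𝓘(ℝ, E) (1 : G)).symm ⁻¹' Set.univ ∩ Set.range 𝓘(ℝ, E))
        (oneCoord E G)) := rfl
  rw [h, mfderiv_extChartAt_one, ContinuousLinearMap.inverse_id]
  simp [VectorField.lieBracketWithin_univ, VectorField.lieBracket]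

/-- The bracket of the Lie algebra acts on functions as a commutator. -/
theorem mvfderiv_one_bracket [CompleteSpace E] {F : G → ℝ}
    (hF : ContMDiff 𝓘(ℝ, E) 𝓘(ℝ, ℝ) ∞ F) (X Y : GroupLieAlgebra 𝓘(ℝ, E) G) :
    mvfderiv 𝓘(ℝ, E) F 1 ⁅X, Y⁆
      = mvfderiv 𝓘(ℝ, E) (fun a => mvfderiv 𝓘(ℝ, E) (fun b => F (a * b)) 1 Y) 1 X
        - mvfderiv 𝓘(ℝ, E) (fun a => mvfderiv 𝓘(ℝ, E) (fun b => F (a * b)) 1 X) 1 Y := by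
  have hN : ContMDiff (𝓘(ℝ, E).prod 𝓘(ℝ, E)) 𝓘(ℝ, ℝ) ∞ (Function.uncurry fun a b => F (a * b)) :=
    hF.comp (contMDiff_fst.mul contMDiff_snd)
  set e := oneCoord E G with he
  set f : E → ℝ := fun y => F (oneChartInv E G y) with hf
  have hem : e ∈ (extChartAt 𝓘(ℝ, E) (1 : G)).target := mem_extChartAt_target 1
  have hcd : ContDiffAt ℝ ∞ f e := contDiffAt_comp_oneChartInv hF hem
  have h4 : HasFDerivAt (fderiv ℝ f) (fderiv ℝ (fderiv ℝ f) e) e :=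
    ((hcd.fderiv_right (m := ∞) (by simp)).differentiableAt (by simp)).hasFDerivAt
  have key : ∀ X Y : GroupLieAlgebra 𝓘(ℝ, E) G,
      mvfderiv 𝓘(ℝ, E) (fun a => mvfderiv 𝓘(ℝ, E) (fun b => F (a * b)) 1 Y) 1 X
        = fderiv ℝ (fderiv ℝ f) e (modelVec X) (modelVec Y)
          + fderiv ℝ f e (fderiv ℝ (chartField Y) e (modelVec X)) := by
    intro X Y
    rw [mvfderiv_one_eq ((contMDiff_mvfderiv_one_param hN Y).mdifferentiableAt (by simp))]
    have hev : (fun y => mvfderiv 𝓘(ℝ, E) (fun b => F (oneChartInv E G y * b)) 1 Y)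
        =ᶠ[𝓝 e] fun y => fderiv ℝ f y (chartField Y y) := by
      filter_upwards [eventually_mem_target_oneCoord (E := E) (G := G)] with y hy
      exact (fderiv_comp_oneChartInv_chartField hF Y hy).symm
    rw [hev.fderiv_eq, (h4.clm_apply (differentiableAt_chartField Y).hasFDerivAt).fderiv]
    have h5 : chartField Y e = modelVec Y := chartField_oneCoord Y
    simp [← he, h5, add_comm]
  -- The second derivatives of f are symmetric and cancel; the first-order terms form the bracket of
  -- the chart fields.
  rw [key, key, mvfderiv_one_eq (hF.mdifferentiableAt (by simp)), modelVec_bracket]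
  have hsymm := hcd.isSymmSndFDerivAt (by simpa using two_le_infty)
  rw [hsymm.eq (modelVec X) (modelVec Y), chartField_oneCoord, chartField_oneCoord, map_sub]
  ring

variable {H : Subgroup G}

/-- The two minus signs cancel. The inner derivative naturally falls on (b * a) • x; Schwarz
restores the order of factors used in `mvfderiv_one_bracket`, at the price of exchanging X and Y. -/
theorem vf_vf_apply (X Y : GroupLieAlgebra 𝓘(ℝ, E) G) (f : smoothFn E H) (x : G ⧸ H) :
    (vf X (vf Y f) : G ⧸ H → ℝ) x = mvfderiv 𝓘(ℝ, E)
      (fun a => mvfderiv 𝓘(ℝ, E) (fun b => (f : G ⧸ H → ℝ) ((a * b) • x)) 1 X) 1 Y := by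
  have h2 : ∀ a : G, (vf Y f : G ⧸ H → ℝ) (a • x)
      = -mvfderiv 𝓘(ℝ, E) (fun b : G => (f : G ⧸ H → ℝ) ((b * a) • x)) 1 Y := by
    intro a
    simp only [vf_apply, mul_smul]
  rw [vf_apply]
  simp only [h2]
  rw [mvfderiv_fun_neg]
  simp only [neg_apply, neg_neg]
  exact mvfderiv_mvfderiv_one_comm (N := fun a b => (f : G ⧸ H → ℝ) ((b * a) • x))
    ((contMDiff_orbit f x).comp (contMDiff_snd.mul contMDiff_fst)) X Y

/-- The exchange of X and Y in `vf_vf_apply` compensates the minus sign in `vf`, so v is a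
homomorphism and not an antihomomorphism. -/
theorem vf_bracket [CompleteSpace E] (X Y : GroupLieAlgebra 𝓘(ℝ, E) G) :
    vf (H := H) ⁅X, Y⁆ = vf X * vf Y - vf Y * vf X := by
  ext f x
  simp only [LinearMap.sub_apply, Module.End.mul_apply, Submodule.coe_sub, Pi.sub_apply,
    vf_vf_apply]
  rw [vf_apply, mvfderiv_one_bracket (contMDiff_orbit f x)]
  ring

theorem vf_add (X Y : GroupLieAlgebra 𝓘(ℝ, E) G) : vf (H := H) (X + Y) = vf X + vf Y := by
  ext f x
  simp only [LinearMap.add_apply, Submodule.coe_add, Pi.add_apply, vf_apply, map_add]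
  ring

theorem vf_smul (c : ℝ) (X : GroupLieAlgebra 𝓘(ℝ, E) G) : vf (H := H) (c • X) = c • vf X := by
  ext f x
  simp only [LinearMap.smul_apply, Submodule.coe_smul, Pi.smul_apply, vf_apply, map_smul,
    smul_eq_mul]
  ring

variable (H) in
/-- The map `X ↦ v_X`. -/
def vfLinear : GroupLieAlgebra 𝓘(ℝ, E) G →ₗ[ℝ] Module.End ℝ (smoothFn E H) where
  toFun := vf
  map_add' := vf_add
  map_smul' := vf_smul

end Bracket

/-! ### Infinitesimal conjugation of the vector fields -/

section Conjugation

variable {E : Type*} [NormedAddCommGroup E] [NormedSpace ℝ E]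
  {G : Type*} [TopologicalSpace G] [ChartedSpace E G] [Group G] [LieGroup 𝓘(ℝ, E) ∞ G]

/-- The chain rule along the diagonal; it serves to differentiate g⁻¹bg, where g occurs twice. -/
theorem mvfderiv_one_diag {N : G → G → ℝ}
    (hN : ContMDiff (𝓘(ℝ, E).prod 𝓘(ℝ, E)) 𝓘(ℝ, ℝ) ∞ (Function.uncurry N))
    (X : GroupLieAlgebra 𝓘(ℝ, E) G) :
    mvfderiv 𝓘(ℝ, E) (fun g => N g g) 1 X
      = mvfderiv 𝓘(ℝ, E) (fun g => N g 1) 1 X + mvfderiv 𝓘(ℝ, E) (fun g => N 1 g) 1 X := by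
  set n : E × E → ℝ := fun p => N (oneChartInv E G p.1) (oneChartInv E G p.2) with hn
  set e := oneCoord E G with he
  have hem : e ∈ (extChartAt 𝓘(ℝ, E) (1 : G)).target := mem_extChartAt_target 1
  have hn' : HasFDerivAt n (fderiv ℝ n (e, e)) (e, e) :=
    ((contDiffAt_comp_oneChartInv_prod hN hem hem).differentiableAt (by simp)).hasFDerivAt
  have h0 : oneChartInv E G e = 1 := oneChartInv_oneCoord
  have hd : ContMDiff 𝓘(ℝ, E) 𝓘(ℝ, ℝ) ∞ fun g => N g g :=
    hN.comp (contMDiff_id.prodMk contMDiff_id)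
  have h1 : ContMDiff 𝓘(ℝ, E) 𝓘(ℝ, ℝ) ∞ fun g => N g 1 :=
    hN.comp (contMDiff_id.prodMk contMDiff_const)
  have h2 : ContMDiff 𝓘(ℝ, E) 𝓘(ℝ, ℝ) ∞ fun g => N 1 g :=
    hN.comp (contMDiff_const.prodMk contMDiff_id)
  rw [mvfderiv_one_eq (hd.mdifferentiableAt (by simp)),
    mvfderiv_one_eq (h1.mdifferentiableAt (by simp)),
    mvfderiv_one_eq (h2.mdifferentiableAt (by simp))]
  have k1 : HasFDerivAt (fun y => n (y, y)) _ e :=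
    HasFDerivAt.comp (f := fun y => (y, y)) e hn' ((hasFDerivAt_id e).prodMk (hasFDerivAt_id e))
  have k2 : HasFDerivAt (fun y => n (y, e)) _ e :=
    HasFDerivAt.comp (f := fun y => (y, e)) e hn' ((hasFDerivAt_id e).prodMk (hasFDerivAt_const e e))
  have k3 : HasFDerivAt (fun y => n (e, y)) _ e :=
    HasFDerivAt.comp (f := fun y => (e, y)) e hn' ((hasFDerivAt_const e e).prodMk (hasFDerivAt_id e))
  have e1 : (fun y => N (oneChartInv E G y) (oneChartInv E G y)) = fun y => n (y, y) := rfl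
  have e2 : (fun y => N (oneChartInv E G y) 1) = fun y => n (y, e) := by simp [hn, h0]
  have e3 : (fun y => N 1 (oneChartInv E G y)) = fun y => n (e, y) := by simp [hn, h0]
  rw [e1, e2, e3, k1.fderiv, k2.fderiv, k3.fderiv]
  simp [← map_add]

variable [CompleteSpace E] [T2Space G]

theorem mvfderiv_one_inv {F : G → ℝ} (hF : ContMDiff 𝓘(ℝ, E) 𝓘(ℝ, ℝ) ∞ F)
    (X : GroupLieAlgebra 𝓘(ℝ, E) G) :
    mvfderiv 𝓘(ℝ, E) (fun g => F g⁻¹) 1 X = -mvfderiv 𝓘(ℝ, E) F 1 X := by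
  have h1 := hasDerivAt_comp_lieExp (hF.mdifferentiableAt (x := 1) (by simp)) X
  have h2 := hasDerivAt_comp_lieExp (Φ := fun g => F g⁻¹)
    ((hF.comp (contMDiff_inv 𝓘(ℝ, E) ∞)).mdifferentiableAt (x := 1) (by simp)) X
  have h3 : HasDerivAt (fun t : ℝ => F (lieExp ((-t) • X))) (-mvfderiv 𝓘(ℝ, E) F 1 X) 0 := by
    have hn : HasDerivAt (fun t : ℝ => -t) (-1) 0 := hasDerivAt_neg 0
    have h1' : HasDerivAt (fun t : ℝ => F (lieExp (t • X))) (mvfderiv 𝓘(ℝ, E) F 1 X) (-0) := by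
      simpa using h1
    exact (h1'.scomp 0 hn).congr_deriv (by simp)
  refine h2.unique ?_
  simpa only [neg_smul, lieExp_neg] using h3

variable {H : Subgroup G}

/-- With F(a) = f(ax), the function is minus the b-derivative of F(g⁻¹bg) at 1. Exchange the
derivatives in g and b; the two occurrences of g contribute F(bg) and -F(gb), and their
b-derivatives form the commutator. -/
theorem hasDerivAt_conj_vf_zero (A Z : GroupLieAlgebra 𝓘(ℝ, E) G) (f : smoothFn E H) (x : G ⧸ H) :
    HasDerivAt (fun s : ℝ => (vf Z (translate (lieExp (s • A)) f) : G ⧸ H → ℝ) (lieExp (s • A) • x))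
      (-(vf ⁅A, Z⁆ f : G ⧸ H → ℝ) x) 0 := by
  set F : G → ℝ := fun a => (f : G ⧸ H → ℝ) (a • x) with hF
  have hFs : ContMDiff 𝓘(ℝ, E) 𝓘(ℝ, ℝ) ∞ F := contMDiff_orbit f x
  have hN : ContMDiff (𝓘(ℝ, E).prod 𝓘(ℝ, E)) 𝓘(ℝ, ℝ) ∞
      (Function.uncurry fun g b : G => F (g⁻¹ * b * g)) :=
    hFs.comp ((contMDiff_fst.inv.mul contMDiff_snd).mul contMDiff_fst)
  have h1 := hasDerivAt_comp_lieExp ((contMDiff_mvfderiv_one_param hN Z).mdifferentiableAt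
    (x := 1) (by simp)) A
  have h2 : (fun s : ℝ =>
      (vf Z (translate (lieExp (s • A)) f) : G ⧸ H → ℝ) (lieExp (s • A) • x)) =
      fun s : ℝ => -mvfderiv 𝓘(ℝ, E)
        (fun b => F ((lieExp (s • A))⁻¹ * b * lieExp (s • A))) 1 Z := by
    ext s
    simp only [vf_apply, translate_apply, hF, mul_smul]
  rw [h2]
  refine h1.neg.congr_deriv ?_
  rw [mvfderiv_mvfderiv_one_comm hN A Z]
  have h3 : ∀ b : G, mvfderiv 𝓘(ℝ, E) (fun g => F (g⁻¹ * b * g)) 1 A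
      = mvfderiv 𝓘(ℝ, E) (fun g => F (b * g)) 1 A
        - mvfderiv 𝓘(ℝ, E) (fun g => F (g * b)) 1 A := by
    intro b
    have hM : ContMDiff (𝓘(ℝ, E).prod 𝓘(ℝ, E)) 𝓘(ℝ, ℝ) ∞
        (Function.uncurry fun g g' : G => F (g⁻¹ * b * g')) :=
      hFs.comp ((contMDiff_fst.inv.mul contMDiff_const).mul contMDiff_snd)
    rw [mvfderiv_one_diag hM]
    have hb : ContMDiff 𝓘(ℝ, E) 𝓘(ℝ, ℝ) ∞ fun g => F (g * b) :=
      hFs.comp (contMDiff_id.mul contMDiff_const)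
    simp only [inv_one, one_mul, mul_one]
    rw [mvfderiv_one_inv hb]
    ring
  simp only [h3]
  have s1 : ContMDiff (𝓘(ℝ, E).prod 𝓘(ℝ, E)) 𝓘(ℝ, ℝ) ∞
      (Function.uncurry fun b g : G => F (b * g)) := hFs.comp (contMDiff_fst.mul contMDiff_snd)
  have s2 : ContMDiff (𝓘(ℝ, E).prod 𝓘(ℝ, E)) 𝓘(ℝ, ℝ) ∞
      (Function.uncurry fun b g : G => F (g * b)) := hFs.comp (contMDiff_snd.mul contMDiff_fst)
  rw [mvfderiv_fun_sub ((contMDiff_mvfderiv_one_param s1 A).mdifferentiableAt (by simp))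
    ((contMDiff_mvfderiv_one_param s2 A).mdifferentiableAt (by simp)), vf_bracket]
  simp only [sub_apply, LinearMap.sub_apply, Module.End.mul_apply,
    Submodule.coe_sub, Pi.sub_apply, vf_vf_apply]
  rw [mvfderiv_mvfderiv_one_comm s2 Z A]

theorem hasDerivAt_conj_vf (A Z : GroupLieAlgebra 𝓘(ℝ, E) G) (f : smoothFn E H) (x : G ⧸ H)
    (t : ℝ) :
    HasDerivAt (fun s : ℝ => (vf Z (translate (lieExp (s • A)) f) : G ⧸ H → ℝ) (lieExp (s • A) • x))
      (-(vf ⁅A, Z⁆ (translate (lieExp (t • A)) f) : G ⧸ H → ℝ) (lieExp (t • A) • x)) t := by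
  have h := hasDerivAt_conj_vf_zero A Z (translate (lieExp (t • A)) f) (lieExp (t • A) • x)
  rw [← sub_self t] at h
  have h2 := h.comp_sub_const t t
  refine h2.congr_of_eventuallyEq (Eventually.of_forall fun s => ?_)
  simp only [← Module.End.mul_apply, ← translate_mul, ← lieExp_add_smul, ← mul_smul, sub_add_cancel]

end Conjugation

/-! ### A linear matrix differential equation -/

section MatrixODE

open scoped Matrix.Norms.Operator Matrix

variable {ι : Type*} [Fintype ι] [DecidableEq ι]

theorem hasDerivAt_exp_smul_entry (X : Matrix ι ι ℝ) (k j : ι) (t : ℝ) :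
    HasDerivAt (fun t : ℝ => NormedSpace.exp (t • X) k j)
      ((X * NormedSpace.exp (t • X)) k j) t :=
  (LinearMap.toContinuousLinearMap (Matrix.entryLinearMap ℝ ℝ k j)).hasFDerivAt.comp_hasDerivAt t
    (hasDerivAt_exp_smul_const' X t)

theorem exp_neg_mul_exp (X : Matrix ι ι ℝ) :
    NormedSpace.exp X * NormedSpace.exp (-X) = 1 := by
  rw [← Matrix.exp_add_of_commute _ _ (Commute.neg_right (Commute.refl X))]
  simp

/-- The solution of the linear system `dy/dt = -y X`. -/
theorem eq_vecMul_exp_of_hasDerivAt {X : Matrix ι ι ℝ} {y : ℝ → ι → ℝ}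
    (hy : ∀ t j, HasDerivAt (fun t => y t j) (-(y t ᵥ* X) j) t) (t : ℝ) :
    y t = y 0 ᵥ* NormedSpace.exp (t • -X) := by
  -- The product y e^{tX} is constant, its derivative being -yXe^{tX} + yXe^{tX}.
  have hz : ∀ j t, HasDerivAt (fun t => (y t ᵥ* NormedSpace.exp (t • X)) j) 0 t := by
    intro j t
    have h : HasDerivAt (fun t => ∑ k, y t k * NormedSpace.exp (t • X) k j)
        (∑ k, (-(y t ᵥ* X) k * NormedSpace.exp (t • X) k j
          + y t k * (X * NormedSpace.exp (t • X)) k j)) t :=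
      HasDerivAt.fun_sum fun k _ => (hy t k).mul (hasDerivAt_exp_smul_entry X k j t)
    refine h.congr_deriv ?_
    rw [Finset.sum_add_distrib]
    have h1 : ∑ k, y t k * (X * NormedSpace.exp (t • X)) k j
        = (y t ᵥ* (X * NormedSpace.exp (t • X))) j := rfl
    have h2 : ∑ k, -(y t ᵥ* X) k * NormedSpace.exp (t • X) k j
        = -((y t ᵥ* X) ᵥ* NormedSpace.exp (t • X)) j := by
      simp [Matrix.vecMul, dotProduct]
    rw [h1, h2, Matrix.vecMul_vecMul]
    ring
  have hc : y t ᵥ* NormedSpace.exp (t • X) = y 0 := by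
    ext j
    have := is_const_of_deriv_eq_zero (fun t => (hz j t).differentiableAt)
      (fun t => (hz j t).deriv) t 0
    simpa using this
  rw [← hc, Matrix.vecMul_vecMul, smul_neg, exp_neg_mul_exp, Matrix.vecMul_one]

end MatrixODE

/-! ### The adjoint action on the fields v_j -/

section AdjointAction

variable {E : Type*} [NormedAddCommGroup E] [NormedSpace ℝ E]
  {G : Type*} [TopologicalSpace G] [ChartedSpace E G] [Group G] [LieGroup 𝓘(ℝ, E) ∞ G]
  [CompleteSpace E] {ι : Type*} [Fintype ι] [DecidableEq ι]
  (T : Module.Basis ι ℝ (GroupLieAlgebra 𝓘(ℝ, E) G))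

/-- The element `φ^i T_i` of the Lie algebra. -/
def lieVec (φ : ι → ℝ) : GroupLieAlgebra 𝓘(ℝ, E) G := ∑ i, φ i • T i

theorem lieVec_add (φ ψ : ι → ℝ) : lieVec T (φ + ψ) = lieVec T φ + lieVec T ψ := by
  simp [lieVec, add_smul, Finset.sum_add_distrib]

theorem lieVec_smul (c : ℝ) (φ : ι → ℝ) : lieVec T (c • φ) = c • lieVec T φ := by
  simp [lieVec, mul_smul, Finset.smul_sum]

theorem lieVec_bracket (φ : ι → ℝ) (j : ι) :
    ⁅lieVec T φ, T j⁆ = ∑ k, adMatrix T φ k j • T k := by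
  have := lieGroup_minSmoothness (E := E) (G := G) 3
  rw [lieVec, sum_lie]
  simp only [smul_lie]
  rw [← T.sum_repr (∑ i, φ i • ⁅T i, T j⁆)]
  refine Finset.sum_congr rfl fun k _ => ?_
  simp [adMatrix]

variable [T2Space G] {H : Subgroup G}

theorem vf_sum {κ : Type*} (s : Finset κ) (X : κ → GroupLieAlgebra 𝓘(ℝ, E) G) :
    vf (H := H) (∑ i ∈ s, X i) = ∑ i ∈ s, vf (X i) :=
  map_sum (vfLinear H) X s

theorem vf_lieVec (φ : ι → ℝ) : vf (H := H) (lieVec T φ) = ∑ i, φ i • vf (T i) := by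
  simp [lieVec, vf_sum, vf_smul]

/-- Conjugating the vector fields `v_j` with `e^{t φ^i v_i}` amounts to applying the
matrix `e^{-t φ^k C_k}`. -/
theorem vf_translate_lieExp (φ : ι → ℝ) (t : ℝ) (j : ι) (f : smoothFn E H) :
    vf (T j) (translate (lieExp (t • lieVec T φ)) f)
      = ∑ k, NormedSpace.exp (t • -adMatrix T φ) k j •
        translate (lieExp (t • lieVec T φ)) (vf (T k) f) := by
  set A := lieVec T φ with hA
  ext x
  set x₀ : G ⧸ H := (lieExp (t • A))⁻¹ • x with hx₀
  have hx : x = lieExp (t • A) • x₀ := by simp [hx₀]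
  -- Following the flow from the fixed point x₀ turns the conjugation formula into y' = -yX, because
  -- ⁅A, T_j⁆ has the j-th column of X as coordinates.
  have key := congrFun (eq_vecMul_exp_of_hasDerivAt (X := adMatrix T φ)
    (y := fun s j => (vf (T j) (translate (lieExp (s • A)) f) : G ⧸ H → ℝ) (lieExp (s • A) • x₀))
    (fun s j => (hasDerivAt_conj_vf A (T j) f x₀ s).congr_deriv (by
      rw [hA, lieVec_bracket, vf_sum]
      simp [Matrix.vecMul, dotProduct, vf_smul, mul_comm])) t) j
  rw [hx]
  refine key.trans ?_
  simp [Matrix.vecMul, dotProduct, lieExp_zero, translate_one, translate_apply, mul_comm]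

end AdjointAction

/-! ### From pointwise to uniform differentiability -/

section UniformDerivative

/-- The mean value inequality for u_r(x) - r u'_t(x) at each x, with a bound uniform in x by
continuity of u' in the sup norm. -/
theorem hasDerivAt_of_pointwise {M : Type*} [TopologicalSpace M] [CompactSpace M]
    {u u' : ℝ → C(M, ℝ)} (h : ∀ x t, HasDerivAt (fun t => u t x) (u' t x) t)
    (hc : Continuous u') (t : ℝ) : HasDerivAt u (u' t) t := by
  rw [hasDerivAt_iff_isLittleO, Asymptotics.isLittleO_iff]
  intro ε hε
  obtain ⟨δ, hδ, hball⟩ := Metric.continuousAt_iff.1 hc.continuousAt ε hε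
  filter_upwards [Metric.ball_mem_nhds t hδ] with s hs
  rw [ContinuousMap.norm_le _ (by positivity)]
  intro x
  have hconv : Convex ℝ (Metric.ball t δ) := convex_ball t δ
  have key := hconv.norm_image_sub_le_of_norm_hasDerivWithin_le
    (f := fun r => u r x - r * u' t x) (f' := fun r => u' r x - u' t x) (C := ε)
    (fun r _ => ((h x r).sub (by simpa using (hasDerivAt_id r).mul_const (u' t x))).hasDerivWithinAt)
    (fun r hr => by
      have h1 := hball (Metric.mem_ball.1 hr)
      rw [dist_eq_norm] at h1
      exact ((u' r - u' t).norm_coe_le_norm x).trans h1.le) (Metric.mem_ball_self hδ) hs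
  refine le_trans (le_of_eq ?_) key
  congr 1
  simp
  ring

end UniformDerivative

/-! ### Translations in the C^k norms -/

section SupNorm

variable {E : Type*} [NormedAddCommGroup E] [NormedSpace ℝ E]
  {G : Type*} [TopologicalSpace G] [ChartedSpace E G] [Group G] [LieGroup 𝓘(ℝ, E) ∞ G]
  {H : Subgroup G}

theorem continuous_smoothFn (f : smoothFn E H) : Continuous (f : G ⧸ H → ℝ) := by
  have hf : ContMDiff 𝓘(ℝ, E) 𝓘(ℝ, ℝ) ∞ fun a : G => (f : G ⧸ H → ℝ) (a : G ⧸ H) := f.2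
  exact continuous_coinduced_dom.2 hf.continuous

/-- Smooth functions as continuous functions. -/
def toC : smoothFn E H →ₗ[ℝ] C(G ⧸ H, ℝ) where
  toFun f := ⟨f, continuous_smoothFn f⟩
  map_add' _ _ := rfl
  map_smul' _ _ := rfl

theorem norm_toC_translate [CompactSpace G] (g : G) (f : smoothFn E H) :
    ‖toC (translate g f)‖ = ‖toC f‖ := by
  have key : ∀ (g : G) (f : smoothFn E H), ‖toC (translate g f)‖ ≤ ‖toC f‖ := fun g f =>
    (ContinuousMap.norm_le _ (norm_nonneg _)).2 fun x => (toC f).norm_coe_le_norm (g⁻¹ • x)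
  refine le_antisymm (key g f) ?_
  conv_lhs => rw [← translate_inv_translate g f]
  exact key _ _

/-- A family of smooth functions on `G/H` depending smoothly on a parameter in `G`. -/
def SmoothFamily (q : G → smoothFn E H) : Prop :=
  ContMDiff (𝓘(ℝ, E).prod 𝓘(ℝ, E)) 𝓘(ℝ, ℝ) ∞
    fun p : G × G => (q p.1 : G ⧸ H → ℝ) (p.2 : G ⧸ H)

theorem smoothFamily_translate (f : smoothFn E H) :
    SmoothFamily fun g : G => translate g f := by
  have hf : ContMDiff 𝓘(ℝ, E) 𝓘(ℝ, ℝ) ∞ fun a : G => (f : G ⧸ H → ℝ) (a : G ⧸ H) := f.2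
  exact hf.comp (contMDiff_fst.inv.mul contMDiff_snd)

theorem SmoothFamily.vf {q : G → smoothFn E H} (hq : SmoothFamily q)
    (X : GroupLieAlgebra 𝓘(ℝ, E) G) : SmoothFamily fun g => vf X (q g) := by
  have h : ContMDiff ((𝓘(ℝ, E).prod 𝓘(ℝ, E)).prod 𝓘(ℝ, E)) 𝓘(ℝ, ℝ) ∞
      (Function.uncurry fun (p : G × G) (b : G) =>
        (q p.1 : G ⧸ H → ℝ) ((b * p.2 : G) : G ⧸ H)) := by
    have h1 : ContMDiff ((𝓘(ℝ, E).prod 𝓘(ℝ, E)).prod 𝓘(ℝ, E)) (𝓘(ℝ, E).prod 𝓘(ℝ, E)) ∞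
        fun p : (G × G) × G => (p.1.1, p.2 * p.1.2) :=
      (contMDiff_fst.comp contMDiff_fst).prodMk
        (contMDiff_snd.mul (contMDiff_snd.comp contMDiff_fst))
    exact ContMDiff.comp (g := fun p : G × G => (q p.1 : G ⧸ H → ℝ) (p.2 : G ⧸ H)) hq h1
  exact (contMDiff_mvfderiv_one_param h X).neg

/-- The map G × G → G × G/H is an open quotient map, so joint continuity can be checked on G × G. -/
theorem SmoothFamily.continuous_toC [CompactSpace G] {q : G → smoothFn E H} (hq : SmoothFamily q) :
    Continuous fun g => toC (q g) := by
  have : IsTopologicalGroup G := topologicalGroup_of_lieGroup 𝓘(ℝ, E) ∞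
  refine ContinuousMap.continuous_of_continuous_uncurry _ ?_
  have hm : IsOpenQuotientMap (Prod.map (id : G → G) (QuotientGroup.mk : G → G ⧸ H)) :=
    IsOpenQuotientMap.id.prodMap ⟨QuotientGroup.mk_surjective, QuotientGroup.continuous_mk,
      QuotientGroup.isOpenMap_coe⟩
  refine hm.isQuotientMap.continuous_iff.2 ?_
  exact hq.continuous

variable {ι : Type*} [Fintype ι] [DecidableEq ι]
  (T : Module.Basis ι ℝ (GroupLieAlgebra 𝓘(ℝ, E) G))

/-- The differential operator `v_{i_1} ⋯ v_{i_m}`. -/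
def wordOp (w : List ι) : Module.End ℝ (smoothFn E H) := (w.map fun i => vf (T i)).prod

@[simp]
theorem wordOp_nil : wordOp (H := H) T [] = 1 := rfl

@[simp]
theorem wordOp_cons (i : ι) (w : List ι) :
    wordOp (H := H) T (i :: w) = vf (T i) * wordOp T w := by simp [wordOp]

theorem wordOp_append (w w' : List ι) :
    wordOp (H := H) T (w ++ w') = wordOp T w * wordOp T w' := by simp [wordOp]

theorem continuous_toC_wordOp_translate [CompactSpace G] (w : List ι) (f : smoothFn E H) :
    Continuous fun g : G => toC (wordOp T w (translate g f)) := by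
  refine SmoothFamily.continuous_toC ?_
  induction w with
  | nil => exact smoothFamily_translate f
  | cons i w ih => simpa using ih.vf (T i)

variable [CompactSpace G] [T2Space G] [CompleteSpace E]

theorem hasDerivAt_toC_translate (A : GroupLieAlgebra 𝓘(ℝ, E) G) (f : smoothFn E H) (t : ℝ) :
    HasDerivAt (fun t : ℝ => toC (translate (lieExp (t • A)) f))
      (toC (translate (lieExp (t • A)) (vf A f))) t := by
  refine hasDerivAt_of_pointwise (u' := fun t => toC (translate (lieExp (t • A)) (vf A f)))
    (fun x t => hasDerivAt_translate_lieExp A f x t) ?_ t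
  exact (smoothFamily_translate (vf A f)).continuous_toC.comp (continuous_lieExp_smul A)

/-- The translations `translate (exp (t A))` are differentiable in all `C^k` norms. -/
theorem hasDerivAt_toC_wordOp_translate (φ : ι → ℝ) (w : List ι) (f : smoothFn E H) (t : ℝ) :
    HasDerivAt (fun t : ℝ => toC (wordOp T w (translate (lieExp (t • lieVec T φ)) f)))
      (toC (wordOp T w (translate (lieExp (t • lieVec T φ)) (vf (lieVec T φ) f)))) t := by
  -- The word is shortened from the right, so that its last field v_j meets the translation first
  -- and crosses it. The derivative of the coefficient e^{-tX} then cancels the commutator of v_φ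
  -- with v_k.
  induction w using List.reverseRecOn generalizing f with
  | nil => exact hasDerivAt_toC_translate _ f t
  | append_singleton w j ih =>
    simp only [wordOp_append, wordOp_cons, wordOp_nil, mul_one, Module.End.mul_apply,
      vf_translate_lieExp, map_sum, map_smul]
    set X := -adMatrix T φ with hX
    have h : HasDerivAt (fun t : ℝ => ∑ k, NormedSpace.exp (t • X) k j •
        toC (wordOp T w (translate (lieExp (t • lieVec T φ)) (vf (T k) f))))
        (∑ k, (NormedSpace.exp (t • X) k j •
          toC (wordOp T w (translate (lieExp (t • lieVec T φ)) (vf (lieVec T φ) (vf (T k) f))))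
          + (X * NormedSpace.exp (t • X)) k j •
            toC (wordOp T w (translate (lieExp (t • lieVec T φ)) (vf (T k) f))))) t :=
      HasDerivAt.fun_sum fun k _ => (hasDerivAt_exp_smul_entry X k j t).smul (ih (vf (T k) f))
    refine h.congr_deriv ?_
    have hcomm : ∀ k, vf (lieVec T φ) (vf (T k) f)
        = vf (T k) (vf (lieVec T φ) f) + ∑ l, adMatrix T φ l k • vf (T l) f := by
      intro k
      have h1 := congrArg (fun D : Module.End ℝ (smoothFn E H) => D f)
        (vf_bracket (H := H) (lieVec T φ) (T k))
      simp only [lieVec_bracket, vf_sum, vf_smul, LinearMap.sum_apply, LinearMap.smul_apply,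
        LinearMap.sub_apply, Module.End.mul_apply] at h1
      rw [h1]
      abel
    simp only [hcomm, map_add, map_sum, map_smul, smul_add, Finset.sum_add_distrib,
      Matrix.mul_apply, Finset.sum_smul, Finset.smul_sum, smul_smul]
    rw [add_assoc, Finset.sum_comm (γ := ι), ← Finset.sum_add_distrib]
    simp only [← Finset.sum_add_distrib, ← add_smul, hX, Matrix.neg_apply]
    simp [mul_comm]

end SupNorm

theorem sum_reverse_four {ι N : Type*} [Fintype ι] [AddCommMonoid N] (F : ι → ι → ι → ι → N) :
    ∑ i, ∑ j, ∑ k, ∑ l, F i j k l = ∑ l, ∑ k, ∑ j, ∑ i, F i j k l := by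
  have h3 : ∀ F : ι → ι → ι → N, ∑ j, ∑ k, ∑ l, F j k l = ∑ l, ∑ k, ∑ j, F j k l := fun F =>
    (Finset.sum_congr rfl fun j _ => Finset.sum_comm).trans
      (Finset.sum_comm.trans (Finset.sum_congr rfl fun l _ => Finset.sum_comm))
  refine (Finset.sum_congr rfl fun i _ => h3 (F i)).trans (Finset.sum_comm.trans ?_)
  exact Finset.sum_congr rfl fun l _ => Finset.sum_comm.trans
    (Finset.sum_congr rfl fun k _ => Finset.sum_comm)

/-! ### Invariance of the Casimir operator -/

section Casimir

variable {E : Type*} [NormedAddCommGroup E] [NormedSpace ℝ E]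
  {G : Type*} [TopologicalSpace G] [ChartedSpace E G] [Group G] [LieGroup 𝓘(ℝ, E) ∞ G]
  [CompleteSpace E] {ι : Type*} [Fintype ι] [DecidableEq ι]
  (T : Module.Basis ι ℝ (GroupLieAlgebra 𝓘(ℝ, E) G))

theorem killing_transpose : (killing T).transpose = killing T := by
  ext i j
  simp [killing, Matrix.trace_mul_comm (adMatrix T (Pi.single j 1))]

theorem killing_inv_symm (i j : ι) : (killing T)⁻¹ i j = (killing T)⁻¹ j i := by
  have h := Matrix.transpose_nonsing_inv (killing T)
  rw [killing_transpose] at h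
  conv_rhs => rw [← h]
  rfl

/-- The matrix K is minus the Killing form in the basis T, and the Killing form is ad-invariant. -/
theorem killing_invariant (φ : ι → ℝ) :
    (adMatrix T φ).transpose * killing T + killing T * adMatrix T φ = 0 := by
  have := lieGroup_minSmoothness (E := E) (G := G) 3
  have had : ∀ i, adMatrix T (Pi.single i 1)
      = LinearMap.toMatrix T T (LieAlgebra.ad ℝ (GroupLieAlgebra 𝓘(ℝ, E) G) (T i)) := by
    intro i
    ext j l
    rw [LinearMap.toMatrix_apply]
    simp [adMatrix, Pi.single_apply]
  have hK : ∀ i j, killing T i j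
      = -killingForm ℝ (GroupLieAlgebra 𝓘(ℝ, E) G) (T i) (T j) := by
    intro i j
    simp only [killing, Matrix.of_apply, had]
    rw [killingForm_apply_apply, LinearMap.trace_eq_matrix_trace ℝ T, LinearMap.toMatrix_comp T T T]
  ext i j
  have hl : ∑ l, adMatrix T φ l i * killing T l j
      = -killingForm ℝ (GroupLieAlgebra 𝓘(ℝ, E) G) ⁅lieVec T φ, T i⁆ (T j) := by
    rw [lieVec_bracket]
    simp [hK, map_sum, LinearMap.sum_apply]
  have hr : ∑ l, killing T i l * adMatrix T φ l j
      = -killingForm ℝ (GroupLieAlgebra 𝓘(ℝ, E) G) (T i) ⁅lieVec T φ, T j⁆ := by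
    rw [lieVec_bracket]
    simp [hK, map_sum, mul_comm]
  simp only [Matrix.add_apply, Matrix.mul_apply, Matrix.transpose_apply, hl, hr]
  rw [LieModule.traceForm_apply_lie_apply']
  simp

theorem killing_inv_invariant (hK : (killing T).PosDef) (φ : ι → ℝ) :
    adMatrix T φ * (killing T)⁻¹ + (killing T)⁻¹ * (adMatrix T φ).transpose = 0 := by
  have hu : IsUnit (killing T).det := hK.det_pos.ne'.isUnit
  have h := congrArg (fun M => (killing T)⁻¹ * M * (killing T)⁻¹) (killing_invariant T φ)
  simp only [mul_add, add_mul, mul_zero, zero_mul] at h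
  rw [mul_assoc _ (_ * killing T), mul_assoc _ (killing T), Matrix.mul_nonsing_inv _ hu, mul_one,
    ← mul_assoc _ (killing T), Matrix.nonsing_inv_mul _ hu, one_mul, add_comm] at h
  exact h

/-- Infinitesimal invariance says that K⁻¹ conjugates minus the transpose of -tX into -tX.
Exponentials respect conjugation, and the two resulting transposed exponentials are inverse to each
other. -/
theorem exp_killing_inv (hK : (killing T).PosDef) (φ : ι → ℝ) (t : ℝ) :
    NormedSpace.exp (t • -adMatrix T φ) * (killing T)⁻¹
      * (NormedSpace.exp (t • -adMatrix T φ)).transpose = (killing T)⁻¹ := by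
  have hu : IsUnit (killing T).det := hK.det_pos.ne'.isUnit
  have hi : IsUnit (killing T)⁻¹ :=
    (Matrix.isUnit_iff_isUnit_det _).2 (Matrix.isUnit_nonsing_inv_det _ hu)
  have h := eq_neg_of_add_eq_zero_left (killing_inv_invariant T hK φ)
  have h1 : t • -adMatrix T φ
      = (killing T)⁻¹ * (-(t • -adMatrix T φ).transpose) * ((killing T)⁻¹)⁻¹ := by
    rw [Matrix.nonsing_inv_nonsing_inv _ hu]
    have h2 : adMatrix T φ = -((killing T)⁻¹ * (adMatrix T φ).transpose * killing T) := by
      have := congrArg (fun M => M * killing T) h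
      simp only [mul_assoc, Matrix.nonsing_inv_mul _ hu, mul_one] at this
      exact this.trans (by rw [neg_mul, mul_assoc])
    conv_lhs => rw [h2]
    simp
  conv_lhs =>
    enter [1, 1]
    rw [h1]
  rw [Matrix.exp_conj _ _ hi, ← Matrix.exp_transpose, mul_assoc _ _ ((killing T)⁻¹),
    Matrix.nonsing_inv_nonsing_inv _ hu, Matrix.mul_nonsing_inv _ hu, mul_one, mul_assoc]
  have h3 := exp_neg_mul_exp (-(t • -adMatrix T φ).transpose)
  rw [neg_neg] at h3
  rw [h3, mul_one]

variable [T2Space G] {H : Subgroup G}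

theorem casimir_apply (f : smoothFn E H) :
    casimir T f = ∑ i, ∑ j, (killing T)⁻¹ i j • vf (T i) (vf (T j) f) := by
  simp [casimir, LinearMap.sum_apply]

/-- When both fields cross the translation, K⁻¹ is multiplied by e^{-tX} on the left and by its
transpose on the right, which changes nothing by `exp_killing_inv`. -/
theorem casimir_translate (hK : (killing T).PosDef) (φ : ι → ℝ) (t : ℝ) (f : smoothFn E H) :
    casimir T (translate (lieExp (t • lieVec T φ)) f)
      = translate (lieExp (t • lieVec T φ)) (casimir T f) := by
  set g := lieExp (t • lieVec T φ) with hg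
  set X := NormedSpace.exp (t • -adMatrix T φ) with hX
  set Q := (killing T)⁻¹ with hQ
  have h : ∀ i j, vf (T i) (vf (T j) (translate g f))
      = ∑ k, ∑ l, (X l i * X k j) • translate g (vf (T l) (vf (T k) f)) := by
    intro i j
    rw [hg, vf_translate_lieExp]
    simp only [map_sum, map_smul, vf_translate_lieExp, Finset.smul_sum, smul_smul, ← hX, mul_comm]
  have hQX : ∀ l k, Q l k = ∑ j, ∑ i, Q i j * (X l i * X k j) := by
    intro l k
    have h1 := congrFun (congrFun (exp_killing_inv T hK φ t) l) k
    rw [← hX, ← hQ] at h1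
    rw [← h1]
    simp only [Matrix.mul_apply, Matrix.transpose_apply, Finset.sum_mul]
    exact Finset.sum_congr rfl fun j _ => Finset.sum_congr rfl fun i _ => by ring
  simp only [casimir_apply, h, map_sum, map_smul, Finset.smul_sum, smul_smul, ← hQ]
  have hR : ∑ l, ∑ k, Q l k • translate g (vf (T l) (vf (T k) f))
      = ∑ l, ∑ k, ∑ j, ∑ i, (Q i j * (X l i * X k j)) • translate g (vf (T l) (vf (T k) f)) := by
    refine Finset.sum_congr rfl fun l _ => Finset.sum_congr rfl fun k _ => ?_
    conv_lhs => rw [hQX l k]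
    simp only [Finset.sum_smul]
  rw [hR]
  exact sum_reverse_four _

end Casimir

/-! ### Integration against the invariant measure -/

section Pairing

variable {M : Type*} [TopologicalSpace M] [CompactSpace M] [MeasurableSpace M] [BorelSpace M]

theorem integrable_continuousMap (μ : Measure M) [IsFiniteMeasure μ] (F : C(M, ℝ)) :
    Integrable F μ :=
  Integrable.of_bound F.continuous.aestronglyMeasurable ‖F‖
    (Eventually.of_forall F.norm_coe_le_norm)

/-- Integration as a continuous linear functional on continuous functions. -/
def integralCLM (μ : Measure M) [IsFiniteMeasure μ] : C(M, ℝ) →L[ℝ] ℝ :=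
  LinearMap.mkContinuous
    { toFun := fun F => ∫ x, F x ∂μ
      map_add' := fun F F' =>
        integral_add (integrable_continuousMap μ F) (integrable_continuousMap μ F')
      map_smul' := fun c F => integral_const_mul c _ } (μ.real Set.univ) fun F => by
    have := norm_integral_le_of_norm_le_const (μ := μ) (Eventually.of_forall F.norm_coe_le_norm)
    rw [mul_comm]
    exact this

theorem integralCLM_apply (μ : Measure M) [IsFiniteMeasure μ] (F : C(M, ℝ)) :
    integralCLM μ F = ∫ x, F x ∂μ := rfl

end Pairing

section PairingSmooth

variable {E : Type*} [NormedAddCommGroup E] [NormedSpace ℝ E]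
  {G : Type*} [TopologicalSpace G] [ChartedSpace E G] [Group G] [LieGroup 𝓘(ℝ, E) ∞ G]
  [CompactSpace G] {H : Subgroup G} [MeasurableSpace (G ⧸ H)] [BorelSpace (G ⧸ H)]
  (μ : Measure (G ⧸ H)) [IsFiniteMeasure μ]

theorem pairing_eq (h f : smoothFn E H) : pairing μ h f = integralCLM μ (toC h * toC f) := rfl

/-- The pairing as a bilinear map. -/
def pairingBilin : smoothFn E H →ₗ[ℝ] smoothFn E H →ₗ[ℝ] ℝ :=
  LinearMap.mk₂ ℝ (pairing μ)
    (fun h h' f => by simp [pairing_eq, add_mul])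
    (fun c h f => by simp [pairing_eq])
    (fun h f f' => by simp [pairing_eq, mul_add])
    (fun c h f => by simp [pairing_eq])

@[simp]
theorem pairingBilin_apply (h f : smoothFn E H) : pairingBilin μ h f = pairing μ h f := rfl

theorem abs_pairing_le (h f : smoothFn E H) :
    |pairing μ h f| ≤ ‖integralCLM μ‖ * ‖toC f‖ * ‖toC h‖ := by
  rw [pairing_eq, mul_assoc]
  refine ((integralCLM μ).le_opNorm _).trans ?_
  gcongr
  rw [mul_comm]
  exact norm_mul_le _ _

variable [SMulInvariantMeasure G (G ⧸ H) μ]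

theorem pairing_translate_translate (g : G) (h f : smoothFn E H) :
    pairing μ (translate g h) (translate g f) = pairing μ h f := by
  have : IsTopologicalGroup G := topologicalGroup_of_lieGroup 𝓘(ℝ, E) ∞
  exact integral_smul_eq_self (μ := μ)
    (fun x => (h : G ⧸ H → ℝ) x * (f : G ⧸ H → ℝ) x) (g := g⁻¹)

theorem pairing_translate_right (g : G) (h f : smoothFn E H) :
    pairing μ h (translate g f) = pairing μ (translate g⁻¹ h) f := by
  rw [← pairing_translate_translate μ g⁻¹ h, translate_inv_translate]

variable [CompleteSpace E] [T2Space G]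

/-- Translating both arguments by exp(tX) leaves the pairing unchanged; differentiate at t = 0. -/
theorem pairing_vf (X : GroupLieAlgebra 𝓘(ℝ, E) G) (h f : smoothFn E H) :
    pairing μ h (vf X f) = -pairing μ (vf X h) f := by
  have h1 := (integralCLM μ).hasFDerivAt.comp_hasDerivAt (0 : ℝ)
    ((hasDerivAt_toC_translate X h 0).mul (hasDerivAt_toC_translate X f 0))
  have h2 : (fun t : ℝ => integralCLM μ (toC (translate (lieExp (t • X)) h)
      * toC (translate (lieExp (t • X)) f))) = fun _ => pairing μ h f := by
    ext t
    rw [← pairing_eq, pairing_translate_translate]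
  have h3 := h1.unique (f := fun t : ℝ => integralCLM μ (toC (translate (lieExp (t • X)) h)
      * toC (translate (lieExp (t • X)) f))) (by rw [h2]; exact hasDerivAt_const 0 _)
  simp only [zero_smul, lieExp_zero, translate_one, Module.End.one_apply, map_add,
    ← pairing_eq] at h3
  linarith

variable {ι : Type*} [Fintype ι] [DecidableEq ι]
  (T : Module.Basis ι ℝ (GroupLieAlgebra 𝓘(ℝ, E) G))

theorem casimir_apply_swap (f : smoothFn E H) :
    casimir T f = ∑ i, ∑ j, (killing T)⁻¹ i j • vf (T j) (vf (T i) f) := by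
  rw [casimir_apply, Finset.sum_comm]
  exact Finset.sum_congr rfl fun i _ => Finset.sum_congr rfl fun j _ => by
    rw [killing_inv_symm]

theorem pairing_casimir (h f : smoothFn E H) :
    pairing μ h (casimir T f) = pairing μ (casimir T h) f := by
  rw [casimir_apply, casimir_apply_swap]
  simp only [← pairingBilin_apply, map_sum, map_smul, LinearMap.sum_apply, LinearMap.smul_apply]
  simp only [pairingBilin_apply, pairing_vf, neg_neg]

/-- The operator `-(1/2) K^{ij} v_i v_j`. -/
def halfCasimir : Module.End ℝ (smoothFn E H) := (-(1 / 2) : ℝ) • casimir T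

theorem pairing_halfCasimir (h f : smoothFn E H) :
    pairing μ h (halfCasimir T f) = pairing μ (halfCasimir T h) f := by
  simp only [halfCasimir, LinearMap.smul_apply]
  rw [← pairingBilin_apply, ← pairingBilin_apply, map_smul, map_smul, LinearMap.smul_apply,
    pairingBilin_apply, pairingBilin_apply, pairing_casimir]

theorem halfCasimir_translate (hK : (killing T).PosDef) (φ : ι → ℝ) (t : ℝ) (f : smoothFn E H) :
    halfCasimir T (translate (lieExp (t • lieVec T φ)) f)
      = translate (lieExp (t • lieVec T φ)) (halfCasimir T f) := by
  simp only [halfCasimir, LinearMap.smul_apply, casimir_translate T hK, map_smul]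

theorem smul_casimir_pow (β : ℝ) (n : ℕ) (f : smoothFn E H) :
    (((-(1 / 2) * β) • casimir T) ^ n : Module.End ℝ (smoothFn E H)) f
      = β ^ n • (halfCasimir T ^ n) f := by
  have : (-(1 / 2) * β) • casimir (H := H) T = β • halfCasimir T := by
    rw [halfCasimir, smul_smul, mul_comm]
  rw [this, smul_pow, LinearMap.smul_apply]

/-- Transposition reverses the order of the two fields, which is harmless because K⁻¹ is symmetric,
and their two signs cancel. On test functions -A thus becomes D - v_J. -/
theorem distGenerator_apply (J : ι → ℝ) (U : smoothFn E H →ₗ[ℝ] ℝ) (h : smoothFn E H) :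
    -(distGenerator T J U h) = U (halfCasimir T h) - U (vf (lieVec T J) h) := by
  simp only [distGenerator, distVf, LinearMap.sub_apply, LinearMap.smul_apply, LinearMap.sum_apply,
    LinearMap.neg_apply, LinearMap.comp_apply, neg_neg, smul_eq_mul, halfCasimir,
    casimir_apply_swap, vf_lieVec, map_sum, map_smul]
  simp only [mul_neg, Finset.sum_neg_distrib]
  ring

end PairingSmooth

/-! ### The v_i as a local frame -/

section LocalFrame

variable {E : Type*} [NormedAddCommGroup E] [NormedSpace ℝ E]
  {G : Type*} [TopologicalSpace G] [ChartedSpace E G] [Group G] [LieGroup 𝓘(ℝ, E) ∞ G]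

variable (E G) in
/-- The multiplication of the group in the chart at the identity. -/
def chartMul (p : E × E) : E :=
  extChartAt 𝓘(ℝ, E) (1 : G) (oneChartInv E G p.1 * oneChartInv E G p.2)

variable (E G) in
/-- The derivative of `chartMul` in its first variable at the identity. -/
def chartMulDeriv (y : E) : E →L[ℝ] E :=
  (fderiv ℝ (chartMul E G) (oneCoord E G, y)).comp (ContinuousLinearMap.inl ℝ E E)

theorem oneChartInv_mem_source {y : E} (hy : y ∈ (extChartAt 𝓘(ℝ, E) (1 : G)).target) :
    oneChartInv E G y ∈ (chartAt E (1 : G)).source := by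
  have := (extChartAt 𝓘(ℝ, E) (1 : G)).map_target hy
  rwa [extChartAt_source] at this

theorem contDiffAt_chartMul {y : E} (hy : y ∈ (extChartAt 𝓘(ℝ, E) (1 : G)).target) :
    ContDiffAt ℝ ∞ (chartMul E G) (oneCoord E G, y) := by
  have hf : ContMDiffAt 𝓘(ℝ, E × E) 𝓘(ℝ, E) ∞ (fun p : E × E => oneChartInv E G p.1)
      (oneCoord E G, y) :=
    (contMDiffAt_oneChartInv (G := G) (y := oneCoord E G) (mem_extChartAt_target 1)).comp
      (oneCoord E G, y) contDiff_fst.contMDiff.contMDiffAt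
  have hs : ContMDiffAt 𝓘(ℝ, E × E) 𝓘(ℝ, E) ∞ (fun p : E × E => oneChartInv E G p.2)
      (oneCoord E G, y) :=
    (contMDiffAt_oneChartInv hy).comp (oneCoord E G, y) contDiff_snd.contMDiff.contMDiffAt
  have hφ : ContMDiffAt 𝓘(ℝ, E) 𝓘(ℝ, E) ∞ (extChartAt 𝓘(ℝ, E) (1 : G))
      (oneChartInv E G (oneCoord E G) * oneChartInv E G y) := by
    rw [oneChartInv_oneCoord, one_mul]
    exact contMDiffAt_extChartAt' (oneChartInv_mem_source hy)
  exact (hφ.comp (oneCoord E G, y) (hf.mul hs)).contDiffAt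

theorem contDiffAt_chartMulDeriv {y : E} (hy : y ∈ (extChartAt 𝓘(ℝ, E) (1 : G)).target) :
    ContDiffAt ℝ ∞ (chartMulDeriv E G) y := by
  have h := (contDiffAt_chartMul hy).fderiv_right (m := ∞) (by simp)
  have h2 : ContDiffAt ℝ ∞ (fun y => fderiv ℝ (chartMul E G) (oneCoord E G, y)) y :=
    ContDiffAt.comp (f := fun y => (oneCoord E G, y)) y h
      (contDiffAt_const.prodMk contDiffAt_id)
  exact h2.clm_comp contDiffAt_const

theorem chartMulDeriv_oneCoord :
    chartMulDeriv E G (oneCoord E G) = ContinuousLinearMap.id ℝ E := by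
  have h1 : HasFDerivAt (chartMul E G) (fderiv ℝ (chartMul E G) (oneCoord E G, oneCoord E G))
      (oneCoord E G, oneCoord E G) :=
    ((contDiffAt_chartMul (mem_extChartAt_target 1)).differentiableAt (by simp)).hasFDerivAt
  have h2 : HasFDerivAt (fun y => chartMul E G (y, oneCoord E G)) (chartMulDeriv E G (oneCoord E G))
      (oneCoord E G) :=
    HasFDerivAt.comp (f := fun y => (y, oneCoord E G)) _ h1
      ((hasFDerivAt_id _).prodMk (hasFDerivAt_const _ _))
  have h3 : (fun y => chartMul E G (y, oneCoord E G)) =ᶠ[𝓝 (oneCoord E G)] id := by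
    filter_upwards [eventuallyEq_chart_oneChartInv (E := E) (G := G)] with y hy
    simpa [chartMul, oneChartInv_oneCoord] using hy
  exact (h2.congr_of_eventuallyEq h3.symm).unique (hasFDerivAt_id _)

variable {H : Subgroup G}

/-- A smooth function along right translates of the chart at the identity. -/
def localFn (f : G ⧸ H → ℝ) (g : G) (y : E) : ℝ := f ((oneChartInv E G y * g : G) : G ⧸ H)

theorem contDiffAt_localFn (f : smoothFn E H) (g : G) {y : E}
    (hy : y ∈ (extChartAt 𝓘(ℝ, E) (1 : G)).target) :
    ContDiffAt ℝ ∞ (localFn (E := E) (f : G ⧸ H → ℝ) g) y := by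
  have hf : ContMDiff 𝓘(ℝ, E) 𝓘(ℝ, ℝ) ∞ fun a : G => (f : G ⧸ H → ℝ) (a : G ⧸ H) := f.2
  exact contDiffAt_comp_oneChartInv (hf.comp (contMDiff_mul_right (I := 𝓘(ℝ, E)) (n := ∞) (a := g)))
    hy

/-- Generators of a left action come from right-invariant fields, so in the chart shifted by g on
the right their coefficients are the derivative of multiplication in its first factor, whatever g
is. -/
theorem fderiv_localFn_comp (f : smoothFn E H) (g : G) {y : E}
    (hy : y ∈ (extChartAt 𝓘(ℝ, E) (1 : G)).target) (X : GroupLieAlgebra 𝓘(ℝ, E) G) :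
    fderiv ℝ (localFn (E := E) (f : G ⧸ H → ℝ) g) y (chartMulDeriv E G y (modelVec X))
      = -localFn (E := E) (vf X f : G ⧸ H → ℝ) g y := by
  set e := oneCoord E G with he
  have h0 : chartMul E G (e, y) = y := by
    rw [chartMul]
    simp only [he, oneChartInv_oneCoord, one_mul]
    exact (extChartAt 𝓘(ℝ, E) (1 : G)).right_inv hy
  have h1 : HasFDerivAt (chartMul E G) (fderiv ℝ (chartMul E G) (e, y)) (e, y) :=
    ((contDiffAt_chartMul hy).differentiableAt (by simp)).hasFDerivAt
  have h2 : HasFDerivAt (fun z => chartMul E G (z, y)) (chartMulDeriv E G y) e :=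
    HasFDerivAt.comp (f := fun z => (z, y)) _ h1 ((hasFDerivAt_id _).prodMk (hasFDerivAt_const _ _))
  have h3 : HasFDerivAt (localFn (E := E) (f : G ⧸ H → ℝ) g)
      (fderiv ℝ (localFn (E := E) (f : G ⧸ H → ℝ) g) y) (chartMul E G (e, y)) := by
    rw [h0]
    exact ((contDiffAt_localFn f g hy).differentiableAt (by simp)).hasFDerivAt
  have h4 := HasFDerivAt.comp (f := fun z => chartMul E G (z, y)) e h3 h2
  have hsrc : ∀ᶠ z in 𝓝 e, oneChartInv E G z * oneChartInv E G y ∈ (chartAt E (1 : G)).source := by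
    have hc : ContinuousAt (fun z => oneChartInv E G z * oneChartInv E G y) e := by
      have : IsTopologicalGroup G := topologicalGroup_of_lieGroup 𝓘(ℝ, E) ∞
      exact (contMDiffAt_oneChartInv (mem_extChartAt_target (1 : G))).continuousAt.mul
        continuousAt_const
    refine hc.eventually_mem ((chartAt E (1 : G)).open_source.mem_nhds ?_)
    simp only [he, oneChartInv_oneCoord, one_mul]
    exact oneChartInv_mem_source hy
  have h5 : (fun z => (f : G ⧸ H → ℝ) (oneChartInv E G z •
      ((oneChartInv E G y * g : G) : G ⧸ H))) =ᶠ[𝓝 e]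
      (localFn (E := E) (f : G ⧸ H → ℝ) g) ∘ fun z => chartMul E G (z, y) := by
    filter_upwards [hsrc] with z hz
    have hz' : oneChartInv E G (chartMul E G (z, y)) = oneChartInv E G z * oneChartInv E G y :=
      (extChartAt 𝓘(ℝ, E) (1 : G)).left_inv (by rwa [extChartAt_source])
    simp only [Function.comp_apply, localFn, hz', mul_assoc]
    rfl
  have h6 : localFn (E := E) (vf X f : G ⧸ H → ℝ) g y = -mvfderiv 𝓘(ℝ, E)
      (fun a : G => (f : G ⧸ H → ℝ) (a • ((oneChartInv E G y * g : G) : G ⧸ H))) 1 X := rfl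
  rw [h6, neg_neg, mvfderiv_one_eq ((contMDiff_orbit f _).mdifferentiableAt (by simp)),
    h5.fderiv_eq, h4.fderiv]
  rfl

variable [FiniteDimensional ℝ E] {ι : Type*} [Fintype ι] [DecidableEq ι]
  (T : Module.Basis ι ℝ (GroupLieAlgebra 𝓘(ℝ, E) G))

/-- The coordinate functionals of a basis of the Lie algebra. -/
def coordCLM (i : ι) : E →L[ℝ] ℝ := LinearMap.toContinuousLinearMap (show E →ₗ[ℝ] ℝ from T.coord i)

theorem coordCLM_modelVec (i j : ι) : coordCLM T i (modelVec (T j)) = if j = i then 1 else 0 := by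
  have h : coordCLM T i (modelVec (T j)) = T.coord i (T j) := rfl
  rw [h, T.coord_apply, T.repr_self, Finsupp.single_apply]

theorem sum_coordCLM (Z : E) : ∑ i, coordCLM T i Z • modelVec (T i) = Z :=
  T.sum_repr (show GroupLieAlgebra 𝓘(ℝ, E) G from Z)

theorem fderiv_eq_sum (L : E →L[ℝ] ℝ) (Z : E) :
    L Z = ∑ i, coordCLM T i Z * L (modelVec (T i)) := by
  conv_lhs => rw [← sum_coordCLM T Z]
  simp

/-- The vector fields `v_i` form a smooth frame near every point. -/
theorem exists_local_frame :
    ∃ (W : Set E) (θ : ι → E → E →L[ℝ] ℝ) (C : ℝ), IsOpen W ∧ oneCoord E G ∈ W ∧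
      W ⊆ (extChartAt 𝓘(ℝ, E) (1 : G)).target ∧
      (∀ i, ContDiffOn ℝ ∞ (θ i) W) ∧ (∀ i, ∀ y ∈ W, ‖θ i y‖ ≤ C) ∧
      (∀ i j, θ i (oneCoord E G) (modelVec (T j)) = if j = i then -1 else 0) ∧
      ∀ (f : smoothFn E H) (g : G), ∀ y ∈ W, HasFDerivAt (localFn (E := E) (f : G ⧸ H → ℝ) g)
        (∑ i, localFn (E := E) (vf (T i) f : G ⧸ H → ℝ) g y • θ i y) y := by
  have hcomp : CompleteSpace E := FiniteDimensional.complete ℝ E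
  set e := oneCoord E G with he
  have hem : e ∈ (extChartAt 𝓘(ℝ, E) (1 : G)).target := mem_extChartAt_target 1
  set B := chartMulDeriv E G with hB
  -- The dual coframe of the right-invariant frame, with the sign of `vf`. It exists near the
  -- identity because B is the identity map at `e`.
  set θ : ι → E → E →L[ℝ] ℝ := fun i y => -(coordCLM T i).comp (B y).inverse with hθ
  have hBe : B e = (ContinuousLinearEquiv.refl ℝ E : E →L[ℝ] E) := chartMulDeriv_oneCoord
  have hinv : ∀ᶠ y in 𝓝 e, (B y).IsInvertible := by
    have h1 := (contDiffAt_chartMulDeriv hem).continuousAt.eventually_mem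
      (hBe ▸ ContinuousLinearEquiv.nhds (ContinuousLinearEquiv.refl ℝ E))
    filter_upwards [h1] with y hy
    exact hy
  have hsm : ∀ y ∈ (extChartAt 𝓘(ℝ, E) (1 : G)).target, (B y).IsInvertible →
      ∀ i, ContDiffAt ℝ ∞ (θ i) y := by
    rintro y hy ⟨b, hb⟩ i
    have h1 : ContDiffAt ℝ ∞ ContinuousLinearMap.inverse (B y) := hb ▸ contDiffAt_map_inverse b
    exact (contDiffAt_const.clm_comp (h1.comp y (contDiffAt_chartMulDeriv hy))).neg
  have hinve : (B e).IsInvertible := ⟨_, hBe.symm⟩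
  have hbd : ∀ i, ∀ᶠ y in 𝓝 e, ‖θ i y‖ ≤ ‖θ i e‖ + 1 := fun i =>
    ((hsm e hem hinve i).continuousAt.norm.eventually_lt continuousAt_const
      (lt_add_one _)).mono fun y hy => le_of_lt hy
  obtain ⟨W, hW, hWo, heW⟩ := eventually_nhds_iff.1
    (((eventually_mem_target_oneCoord (E := E) (G := G)).and hinv).and (eventually_all.2 hbd))
  refine ⟨W, θ, ∑ i, (‖θ i e‖ + 1), hWo, heW, fun y hy => (hW y hy).1.1,
    fun i y hy => (hsm y (hW y hy).1.1 (hW y hy).1.2 i).contDiffWithinAt, fun i y hy =>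
      ((hW y hy).2 i).trans (Finset.single_le_sum (f := fun i => ‖θ i e‖ + 1)
        (fun i _ => by positivity) (Finset.mem_univ i)), ?_, ?_⟩
  · intro i j
    have h1 : θ i e (modelVec (T j)) = -coordCLM T i (modelVec (T j)) := by
      simp only [hθ, hBe]
      simp
    rw [h1, coordCLM_modelVec]
    split_ifs <;> simp
  · intro f g y hy
    have hyt := (hW y hy).1.1
    have hd := ((contDiffAt_localFn f g hyt).differentiableAt (by simp)).hasFDerivAt
    refine hd.congr_fderiv ?_
    ext Z
    have h1 : Z = B y ((B y).inverse Z) := ((hW y hy).1.2.self_apply_inverse Z).symm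
    conv_lhs => rw [h1]
    have h2 := fderiv_eq_sum T ((fderiv ℝ (localFn (E := E) (f : G ⧸ H → ℝ) g) y).comp (B y))
      ((B y).inverse Z)
    simp only [ContinuousLinearMap.comp_apply, hB, fderiv_localFn_comp f g hyt] at h2
    rw [h2]
    simp [hθ, hB, mul_comm]

end LocalFrame

/-! ### Completeness of the space of smooth functions -/

section Completeness

variable {E : Type*} [NormedAddCommGroup E] [NormedSpace ℝ E] [FiniteDimensional ℝ E]
  {G : Type*} [TopologicalSpace G] [ChartedSpace E G] [Group G] [LieGroup 𝓘(ℝ, E) ∞ G]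
  [CompactSpace G] {H : Subgroup G} {ι : Type*} [Fintype ι] [DecidableEq ι]
  (T : Module.Basis ι ℝ (GroupLieAlgebra 𝓘(ℝ, E) G))

/-- A family of continuous functions which looks like the family of all derivatives
`v_{i_1} ⋯ v_{i_m} f` of a function `f` comes from a smooth function. -/
theorem exists_smoothFn_of_hasFDerivAt {F : List ι → C(G ⧸ H, ℝ)} {W : Set E}
    {θ : ι → E → E →L[ℝ] ℝ} (hW : IsOpen W) (heW : oneCoord E G ∈ W)
    (hθ : ∀ i, ContDiffOn ℝ ∞ (θ i) W)
    (hθe : ∀ i j, θ i (oneCoord E G) (modelVec (T j)) = if j = i then -1 else 0)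
    (hF : ∀ w (g : G), ∀ y ∈ W, HasFDerivAt (localFn (E := E) (F w) g)
        (∑ i, localFn (E := E) (F (i :: w)) g y • θ i y) y) :
    ∃ f : smoothFn E H, ∀ w, toC (wordOp T w f) = F w := by
  -- Bootstrap: the derivative of each member is a combination of other members with smooth
  -- coefficients, so if all members are C^n, all are C^{n+1}.
  have hcd : ∀ (n : ℕ) w (g : G), ContDiffOn ℝ n (localFn (E := E) (F w) g) W := by
    intro n
    induction n with
    | zero =>
      intro w g
      exact contDiffOn_zero.2 fun y hy => (hF w g y hy).continuousAt.continuousWithinAt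
    | succ n ih =>
      intro w g
      have : ((n + 1 : ℕ) : WithTop ℕ∞) = n + 1 := by norm_cast
      rw [this, contDiffOn_succ_iff_hasFDerivWithinAt_of_uniqueDiffOn hW.uniqueDiffOn]
      refine ⟨by simp, fun y => ∑ i, localFn (E := E) (F (i :: w)) g y • θ i y, ?_,
        fun y hy => (hF w g y hy).hasFDerivWithinAt⟩
      exact ContDiffOn.sum fun i _ => (ih (i :: w) g).smul
        ((hθ i).of_le (by exact_mod_cast le_top))
  have hsm : ∀ w, (F w : G ⧸ H → ℝ) ∈ smoothFn E H := by
    intro w g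
    have h1 : ContDiffAt ℝ ∞ (localFn (E := E) (F w) g) (oneCoord E G) :=
      (contDiffOn_infty.2 fun n => hcd n w g).contDiffAt (hW.mem_nhds heW)
    have h2 : ContMDiffAt 𝓘(ℝ, E) 𝓘(ℝ, E) ∞
        (fun a : G => extChartAt 𝓘(ℝ, E) (1 : G) (a * g⁻¹)) g := by
      have h3 : ContMDiffAt 𝓘(ℝ, E) 𝓘(ℝ, E) ∞ (extChartAt 𝓘(ℝ, E) (1 : G)) (g * g⁻¹) := by
        rw [mul_inv_cancel]
        exact contMDiffAt_extChartAt
      exact h3.comp g (contMDiff_mul_right (I := 𝓘(ℝ, E)) (n := ∞) (a := g⁻¹)).contMDiffAt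
    have h4 : ContMDiffAt 𝓘(ℝ, E) 𝓘(ℝ, ℝ) ∞ (localFn (E := E) (F w) g)
        (extChartAt 𝓘(ℝ, E) (1 : G) (g * g⁻¹)) := by
      rw [mul_inv_cancel]
      exact h1.contMDiffAt
    refine (h4.comp g h2).congr_of_eventuallyEq ?_
    have : IsTopologicalGroup G := topologicalGroup_of_lieGroup 𝓘(ℝ, E) ∞
    have hsrc : ∀ᶠ a in 𝓝 g, a * g⁻¹ ∈ (extChartAt 𝓘(ℝ, E) (1 : G)).source := by
      refine (continuous_mul_const g⁻¹).continuousAt.eventually_mem ?_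
      rw [mul_inv_cancel]
      exact extChartAt_source_mem_nhds (1 : G)
    filter_upwards [hsrc] with a ha
    simp only [Function.comp_apply, localFn, oneChartInv]
    rw [(extChartAt 𝓘(ℝ, E) (1 : G)).left_inv ha, inv_mul_cancel_right]
  set f : List ι → smoothFn E H := fun w => ⟨F w, hsm w⟩ with hf
  have hvf : ∀ w j, vf (T j) (f w) = f (j :: w) := by
    intro w j
    ext x
    induction x using QuotientGroup.induction_on with
    | H g =>
      have h1 : (vf (T j) (f w) : G ⧸ H → ℝ) (g : G ⧸ H)
          = -fderiv ℝ (localFn (E := E) (F w) g) (oneCoord E G) (modelVec (T j)) := by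
        rw [vf_apply, mvfderiv_one_eq ((contMDiff_orbit (f w) _).mdifferentiableAt (by simp))]
        rfl
      rw [h1, (hF w g _ heW).fderiv]
      simp only [sum_apply, smul_apply, hθe, smul_eq_mul]
      simp [localFn, oneChartInv_oneCoord, hf]
  have hw : ∀ w, wordOp T w (f []) = f w := by
    intro w
    induction w with
    | nil => simp
    | cons i w ih => rw [wordOp_cons, Module.End.mul_apply, ih, hvf]
  exact ⟨f [], fun w => by rw [hw]; ext x; rfl⟩

/-- Because the coframe is bounded, uniform convergence of the v-derivatives is uniform convergence
of chart derivatives, and limit and derivative may be exchanged. -/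
theorem exists_smoothFn_of_tendsto {α : Type*} {l : Filter α} [l.NeBot] {f : α → smoothFn E H}
    {F : List ι → C(G ⧸ H, ℝ)}
    (h : ∀ w, Tendsto (fun n => toC (wordOp T w (f n))) l (𝓝 (F w))) :
    ∃ f : smoothFn E H, ∀ w, toC (wordOp T w f) = F w := by
  obtain ⟨W, θ, C, hW, heW, -, hθ, hC, hθe, hfr⟩ := exists_local_frame (H := H) T
  refine exists_smoothFn_of_hasFDerivAt T hW heW hθ hθe fun w g y hy => ?_
  refine hasFDerivAt_of_tendstoUniformlyOn (l := l) (s := W)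
    (f := fun n => localFn (E := E) (wordOp T w (f n) : G ⧸ H → ℝ) g)
    (f' := fun n y => ∑ i, localFn (E := E) (wordOp T (i :: w) (f n) : G ⧸ H → ℝ) g y • θ i y)
    (g' := fun y => ∑ i, localFn (E := E) (F (i :: w)) g y • θ i y)
    hW ?_ ?_ ?_ hy
  · have hC0 : 0 ≤ |C| := abs_nonneg C
    have hlim : Tendsto (fun n => ∑ i, ‖toC (wordOp T (i :: w) (f n)) - F (i :: w)‖ * |C|) l
        (𝓝 0) := by
      have : Tendsto (fun n => ∑ i, ‖toC (wordOp T (i :: w) (f n)) - F (i :: w)‖ * |C|) l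
          (𝓝 (∑ _i : ι, 0 * |C|)) :=
        tendsto_finsetSum _ fun i _ =>
          (tendsto_iff_norm_sub_tendsto_zero.1 (h (i :: w))).mul_const _
      simpa using this
    rw [Metric.tendstoUniformlyOn_iff]
    intro ε hε
    filter_upwards [hlim.eventually_lt_const hε] with n hn z hz
    refine lt_of_le_of_lt ?_ hn
    rw [dist_comm, dist_eq_norm, ← Finset.sum_sub_distrib]
    refine (norm_sum_le _ _).trans (Finset.sum_le_sum fun i _ => ?_)
    rw [← sub_smul, norm_smul]
    refine mul_le_mul ?_ ((hC i z hz).trans (le_abs_self C)) (norm_nonneg _) (norm_nonneg _)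
    exact (toC (wordOp T (i :: w) (f n)) - F (i :: w)).norm_coe_le_norm
      ((oneChartInv E G z * g : G) : G ⧸ H)
  · intro n z hz
    have := hfr (wordOp T w (f n)) g z hz
    simpa only [wordOp_cons, Module.End.mul_apply] using this
  · intro z hz
    exact ((continuous_eval_const
      ((oneChartInv E G z * g : G) : G ⧸ H)).tendsto _).comp (h w)

end Completeness

/-! ### Equicontinuity of pointwise bounded distributions -/

section BanachSteinhaus

variable {E : Type*} [NormedAddCommGroup E] [NormedSpace ℝ E] [FiniteDimensional ℝ E]
  {G : Type*} [TopologicalSpace G] [ChartedSpace E G] [Group G] [LieGroup 𝓘(ℝ, E) ∞ G]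
  [CompactSpace G] {H : Subgroup G} {ι : Type*} [Fintype ι] [DecidableEq ι]
  (T : Module.Basis ι ℝ (GroupLieAlgebra 𝓘(ℝ, E) G))

variable (H) in
/-- A smooth function together with all its derivatives. -/
def jet : smoothFn E H →ₗ[ℝ] (List ι → C(G ⧸ H, ℝ)) :=
  LinearMap.pi fun w => toC ∘ₗ wordOp T w

theorem jet_injective : Function.Injective (jet H T) := by
  intro f f' hff
  have h := congrFun hff []
  ext x
  exact DFunLike.congr_fun h x

/-- This realises the smooth functions as a closed subspace of a countable product of Banach spaces:
complete and metrizable, hence Baire and barrelled. -/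
theorem isClosed_range_jet : IsClosed (LinearMap.range (jet H T) : Set (List ι → C(G ⧸ H, ℝ))) := by
  refine isClosed_of_closure_subset fun F hF => ?_
  obtain ⟨p, hp, hlim⟩ := mem_closure_iff_seq_limit.1 hF
  choose f hf using hp
  obtain ⟨f', hf'⟩ := exists_smoothFn_of_tendsto T (f := f) (F := F) (l := atTop) fun w => by
    have := (tendsto_pi_nhds.1 hlim) w
    rw [funext fun n => (congrFun (hf n).symm w : p n w = jet H T (f n) w)] at this
    exact this
  exact ⟨f', funext hf'⟩

/-- A uniform bound on linear functionals in terms of finitely many derivatives. -/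
def HasOrderBound (m : ℕ) (C : ℝ) (U : smoothFn E H →ₗ[ℝ] ℝ) : Prop :=
  ∀ (h : smoothFn E H) (B : ℝ),
    (∀ w : List ι, w.length ≤ m → ‖toC (wordOp T w h)‖ ≤ B) → |U h| ≤ C * B

theorem isDistribution_iff (U : smoothFn E H →ₗ[ℝ] ℝ) :
    IsDistribution T U ↔ ∃ m C, HasOrderBound T m C U := by
  have key : ∀ (h : smoothFn E H) (B : ℝ) (w : List ι),
      (∀ x : G ⧸ H, |((w.map fun i => vf (T i)).prod h : G ⧸ H → ℝ) x| ≤ B) ↔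
        ‖toC (wordOp T w h)‖ ≤ B := fun h B w => by
    rw [ContinuousMap.norm_le_of_nonempty]
    rfl
  simp only [IsDistribution, HasOrderBound, key]

/-- Pointwise bounded families of distributions are equicontinuous. -/
theorem exists_hasOrderBound {κ : Type*} {V : κ → smoothFn E H →ₗ[ℝ] ℝ}
    (hV : ∀ k, IsDistribution T (V k)) (hb : ∀ h, ∃ B, ∀ k, |V k h| ≤ B) :
    ∃ m C, 0 ≤ C ∧ ∀ k, HasOrderBound T m C (V k) := by
  set R := LinearMap.range (jet H T) with hR
  have hcl : IsClosed (R : Set (List ι → C(G ⧸ H, ℝ))) := isClosed_range_jet T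
  have : CompleteSpace R := hcl.completeSpace_coe
  set e : smoothFn E H ≃ₗ[ℝ] R := LinearEquiv.ofInjective (jet H T) (jet_injective T) with he
  have hcont : ∀ k, Continuous ((V k) ∘ₗ e.symm.toLinearMap) := by
    intro k
    obtain ⟨m, C, hC⟩ := (isDistribution_iff T (V k)).1 (hV k)
    set S : Finset (List ι) := (List.finite_length_le ι m).toFinset with hS
    set N : R → ℝ := fun p => ∑ w ∈ S, ‖(p : List ι → C(G ⧸ H, ℝ)) w‖ with hN
    have hNc : Continuous N := continuous_finsetSum _ fun w _ =>
      ((continuous_apply w).comp continuous_subtype_val).norm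
    have hbound : ∀ p, |(V k ∘ₗ e.symm.toLinearMap) p| ≤ C * N p := by
      intro p
      refine hC (e.symm p) (N p) fun w hw => ?_
      have h1 : toC (wordOp T w (e.symm p)) = (p : List ι → C(G ⧸ H, ℝ)) w := by
        have : (e (e.symm p) : List ι → C(G ⧸ H, ℝ)) w = (p : List ι → C(G ⧸ H, ℝ)) w := by
          rw [e.apply_symm_apply]
        exact this
      rw [h1]
      exact Finset.single_le_sum (f := fun w => ‖(p : List ι → C(G ⧸ H, ℝ)) w‖)
        (fun _ _ => norm_nonneg _) (by simpa [hS] using hw)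
    refine continuous_of_continuousAt_zero (V k ∘ₗ e.symm.toLinearMap) ?_
    rw [ContinuousAt, map_zero]
    refine squeeze_zero_norm hbound ?_
    have : Tendsto (fun p => C * N p) (𝓝 0) (𝓝 (C * N 0)) := (hNc.const_mul C).tendsto 0
    simpa [hN] using this
  set 𝓕 : κ → R →L[ℝ] ℝ := fun k => ⟨(V k) ∘ₗ e.symm.toLinearMap, hcont k⟩ with h𝓕
  have : IsUniformAddGroup R := R.toAddSubgroup.isUniformAddGroup
  have : ContinuousSMul ℝ R := inferInstance
  have : (uniformity R).IsCountablyGenerated := Filter.comap.isCountablyGenerated _ _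
  have : BaireSpace R := inferInstance
  have : BarrelledSpace ℝ R := inferInstance
  have hue := (norm_withSeminorms ℝ ℝ).banach_steinhaus (𝓕 := 𝓕) (fun _ p => by
    obtain ⟨B, hB⟩ := hb (e.symm p)
    exact ⟨B, by rintro _ ⟨k, rfl⟩; exact hB k⟩)
  -- A neighbourhood of 0 in the product constrains finitely many words only; their lengths give the
  -- order m and their radii give δ.
  have h0 := hue.equicontinuous 0
  rw [Metric.equicontinuousAt_iff_right] at h0
  have h1 := h0 1 one_pos
  rw [nhds_subtype_eq_comap, nhds_pi, Filter.eventually_comap, Filter.eventually_iff,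
    Filter.mem_pi] at h1
  obtain ⟨I, hI, t, ht, hsub⟩ := h1
  have h2 : ∀ w, ∃ ε > 0, ∀ p : C(G ⧸ H, ℝ), ‖p‖ < ε → p ∈ t w := fun w => by
    obtain ⟨ε, hε, hb⟩ := Metric.mem_nhds_iff.1 (ht w)
    refine ⟨ε, hε, fun p hp => hb ?_⟩
    simpa [dist_eq_norm] using hp
  choose ε hε hεt using h2
  obtain ⟨δ, hδ, hδε⟩ : ∃ δ > 0, ∀ w ∈ I, δ ≤ ε w := by
    have h := (Filter.eventually_all_finite hI (l := 𝓝[>] (0 : ℝ)) (p := fun w x => x ≤ ε w)).2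
      fun w _ => eventually_nhdsWithin_of_eventually_nhds (Iic_mem_nhds (hε w))
    obtain ⟨δ, h1, h2⟩ := (h.and self_mem_nhdsWithin).exists
    exact ⟨δ, h2, h1⟩
  obtain ⟨m, hm⟩ : ∃ m, ∀ w ∈ I, w.length ≤ m := by
    obtain ⟨m, hm⟩ := (hI.image List.length).bddAbove
    exact ⟨m, fun w hw => hm ⟨w, hw, rfl⟩⟩
  refine ⟨m, 2 / δ, by positivity, fun k h B hB => ?_⟩
  have hB0 : 0 ≤ B := (norm_nonneg _).trans (hB [] (Nat.zero_le _))
  -- Rescaling h so that the relevant norms are at most δ/2 produces the constant 2/δ. Working with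
  -- B' > B and letting B' tend to B covers B = 0.
  have hs : ∀ B', B < B' → |V k h| ≤ 2 / δ * B' := fun B' hB' => by
    have hpos : 0 < B' := hB0.trans_lt hB'
    set c : ℝ := δ / (2 * B') with hc
    have hcpos : 0 < c := by positivity
    have hmem := @hsub (e (c • h) : List ι → C(G ⧸ H, ℝ)) (fun w hw => hεt w _ (by
      have : (e (c • h) : List ι → C(G ⧸ H, ℝ)) w = c • toC (wordOp T w h) := by
        rw [map_smul]; rfl
      rw [this, norm_smul, Real.norm_of_nonneg hcpos.le]
      calc c * ‖toC (wordOp T w h)‖ ≤ c * B' := by gcongr; exact (hB w (hm w hw)).trans hB'.le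
        _ = δ / 2 := by rw [hc]; field_simp
        _ < δ := by linarith
        _ ≤ ε w := hδε w hw))
    have h3 := hmem (e (c • h)) rfl k
    have h4 : 𝓕 k (e (c • h)) = c * V k h := by
      simp [h𝓕]
    rw [Function.comp_apply, map_zero, dist_zero_left, h4, norm_mul, Real.norm_of_nonneg hcpos.le, Real.norm_eq_abs] at h3
    have h5 : |V k h| ≤ 1 / c := by rw [le_div_iff₀ hcpos]; linarith
    refine h5.trans (le_of_eq ?_)
    rw [hc]; field_simp
  have hlim : Tendsto (fun B' => 2 / δ * B') (𝓝[>] B) (𝓝 (2 / δ * B)) :=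
    ((continuous_const_mul _).tendsto B).mono_left nhdsWithin_le_nhds
  exact ge_of_tendsto hlim (eventually_nhdsWithin_of_forall hs)

end BanachSteinhaus

/-! ### Derivatives from quadratic remainders -/

section QuadraticRemainder

variable {F : Type*} [NormedAddCommGroup F] [NormedSpace ℝ F]

/-- Unlike a little-o estimate, a quadratic bound with a fixed constant survives suprema over points
and limits of partial sums; this is its use below. -/
theorem hasDerivWithinAt_of_norm_sub_le {y : ℝ → F} {y' : F} {S : Set ℝ} {s M : ℝ}
    (h : ∀ r ∈ S, ‖y r - y s - (r - s) • y'‖ ≤ M * |r - s| ^ 2) :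
    HasDerivWithinAt y y' S s := by
  rw [hasDerivWithinAt_iff_isLittleO]
  have h1 : (fun r => y r - y s - (r - s) • y') =O[𝓝[S] s] fun r => (r - s) ^ 2 := by
    refine Asymptotics.IsBigO.of_bound M (eventually_nhdsWithin_of_forall fun r hr => ?_)
    simpa using h r hr
  refine h1.trans_isLittleO ?_
  have h2 : (fun r : ℝ => (r - s) * (r - s)) =o[𝓝[S] s] fun r => 1 * (r - s) := by
    refine Asymptotics.IsLittleO.mul_isBigO ?_ (Asymptotics.isBigO_refl _ _)
    rw [Asymptotics.isLittleO_one_iff]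
    have : Tendsto (fun r : ℝ => r - s) (𝓝 s) (𝓝 (s - s)) := tendsto_id.sub_const s
    rw [sub_self] at this
    exact this.mono_left nhdsWithin_le_nhds
  simpa [sq] using h2

/-- Taylor's formula with quadratic remainder, on an interval. -/
theorem abs_sub_sub_le_of_hasDerivWithinAt {y y' y'' : ℝ → ℝ} {S : Set ℝ} (hS : Convex ℝ S)
    {M : ℝ} (hy : ∀ s ∈ S, HasDerivWithinAt y (y' s) S s)
    (hy' : ∀ s ∈ S, HasDerivWithinAt y' (y'' s) S s) (hM : ∀ s ∈ S, |y'' s| ≤ M)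
    {r s : ℝ} (hr : r ∈ S) (hs : s ∈ S) :
    |y r - y s - (r - s) * y' s| ≤ M * |r - s| ^ 2 := by
  have h1 : ∀ x ∈ S, |y' x - y' s| ≤ M * |x - s| := fun x hx =>
    hS.norm_image_sub_le_of_norm_hasDerivWithin_le (f := y') (f' := y'') hy' hM hs hx
  have hseg : segment ℝ s r ⊆ S := hS.segment_subset hs hr
  have hM0 : 0 ≤ M := (abs_nonneg _).trans (hM s hs)
  have h2 := (convex_segment (𝕜 := ℝ) s r).norm_image_sub_le_of_norm_hasDerivWithin_le
    (f := fun x => y x - x * y' s) (f' := fun x => y' x - 1 * y' s) (C := M * |r - s|)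
    (fun x hx => ((hy x (hseg hx)).mono hseg).sub (((hasDerivAt_id x).mul_const _).hasDerivWithinAt))
    (fun x hx => by
      rw [one_mul]
      rw [segment_eq_uIcc] at hx
      exact (h1 x (hseg (by rwa [segment_eq_uIcc]))).trans
        (mul_le_mul_of_nonneg_left (Set.abs_sub_left_of_mem_uIcc hx) hM0)) (left_mem_segment ℝ s r) (right_mem_segment ℝ s r)
  simp only [Real.norm_eq_abs] at h2
  refine (le_of_eq ?_).trans (h2.trans (le_of_eq ?_))
  · congr 1; ring
  · rw [mul_assoc, ← sq]

theorem hasDerivWithinAt_continuousMap {M : Type*} [TopologicalSpace M] [CompactSpace M]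
    {S : Set ℝ} (hS : Convex ℝ S) {u u' : ℝ → C(M, ℝ)} {u'' : ℝ → M → ℝ} {B : ℝ}
    (hu : ∀ x, ∀ s ∈ S, HasDerivWithinAt (fun s => u s x) (u' s x) S s)
    (hu' : ∀ x, ∀ s ∈ S, HasDerivWithinAt (fun s => u' s x) (u'' s x) S s)
    (hB : ∀ s ∈ S, ∀ x, |u'' s x| ≤ B) (hB0 : 0 ≤ B) {s : ℝ} (hs : s ∈ S) :
    HasDerivWithinAt u (u' s) S s := by
  refine hasDerivWithinAt_of_norm_sub_le (M := B) fun r hr => ?_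
  rw [ContinuousMap.norm_le _ (by positivity)]
  intro x
  exact abs_sub_sub_le_of_hasDerivWithinAt hS (hu x) (hu' x) (fun s hs => hB s hs x) hr hs

end QuadraticRemainder

/-! ### Calculus of distributions of bounded order -/

section Distributions

variable {E : Type*} [NormedAddCommGroup E] [NormedSpace ℝ E] [FiniteDimensional ℝ E]
  {G : Type*} [TopologicalSpace G] [ChartedSpace E G] [Group G] [LieGroup 𝓘(ℝ, E) ∞ G]
  [CompactSpace G] {H : Subgroup G} {ι : Type*} [Fintype ι] [DecidableEq ι]
  (T : Module.Basis ι ℝ (GroupLieAlgebra 𝓘(ℝ, E) G))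

variable {T}

theorem HasOrderBound.isDistribution {m : ℕ} {C : ℝ} {U : smoothFn E H →ₗ[ℝ] ℝ}
    (hU : HasOrderBound T m C U) : IsDistribution T U := (isDistribution_iff T U).2 ⟨m, C, hU⟩

theorem HasOrderBound.sub {m m' : ℕ} {C C' : ℝ} {U U' : smoothFn E H →ₗ[ℝ] ℝ}
    (hU : HasOrderBound T m C U) (hU' : HasOrderBound T m' C' U') :
    HasOrderBound T (max m m') (C + C') (U - U') := fun h B hB => by
  have h1 := hU h B fun w hw => hB w (hw.trans (le_max_left _ _))
  have h2 := hU' h B fun w hw => hB w (hw.trans (le_max_right _ _))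
  rw [LinearMap.sub_apply, add_mul]
  exact (abs_sub _ _).trans (add_le_add h1 h2)

theorem IsDistribution.sub {U U' : smoothFn E H →ₗ[ℝ] ℝ}
    (hU : IsDistribution T U) (hU' : IsDistribution T U') : IsDistribution T (U - U') := by
  obtain ⟨m, C, h⟩ := (isDistribution_iff T U).1 hU
  obtain ⟨m', C', h'⟩ := (isDistribution_iff T U').1 hU'
  exact (h.sub h').isDistribution

theorem HasOrderBound.of_tendsto {m : ℕ} {C : ℝ} {V : ℕ → smoothFn E H →ₗ[ℝ] ℝ}
    {U : smoothFn E H →ₗ[ℝ] ℝ} (hV : ∀ n, HasOrderBound T m C (V n))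
    (hlim : ∀ h, Tendsto (fun n => V n h) atTop (𝓝 (U h))) : HasOrderBound T m C U :=
  fun h B hB => le_of_tendsto (hlim h).abs (Eventually.of_forall fun n => hV n h B hB)

theorem HasOrderBound.comp_wordOp {m : ℕ} {C : ℝ} {U : smoothFn E H →ₗ[ℝ] ℝ}
    (hU : HasOrderBound T m C U) (v : List ι) :
    HasOrderBound T (m + v.length) C (U ∘ₗ wordOp T v) := fun h B hB => by
  refine hU _ B fun w hw => ?_
  rw [← Module.End.mul_apply, ← wordOp_append]
  exact hB _ (by simpa using hw)

theorem exists_norm_wordOp_translate_le (m : ℕ) (h : smoothFn E H) :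
    ∃ B, ∀ w : List ι, w.length ≤ m → ∀ g : G, ‖toC (wordOp T w (translate g h))‖ ≤ B := by
  have h1 : ∀ w : List ι, ∃ B, ∀ g : G, ‖toC (wordOp T w (translate g h))‖ ≤ B := fun w => by
    obtain ⟨B, hB⟩ := (isCompact_range (continuous_toC_wordOp_translate T w h).norm).bddAbove
    exact ⟨B, fun g => hB ⟨g, rfl⟩⟩
  choose B hB using h1
  refine ⟨∑ w ∈ (List.finite_length_le ι m).toFinset, |B w|, fun w hw g =>
    ((hB w g).trans (le_abs_self _)).trans ?_⟩
  exact Finset.single_le_sum (f := fun w => |B w|) (fun _ _ => abs_nonneg _) (by simpa using hw)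

theorem tendsto_zero_of_hasOrderBound {κ : Type*} {l : Filter κ} {m : ℕ} {C : ℝ}
    {V : κ → smoothFn E H →ₗ[ℝ] ℝ} (hV : ∀ᶠ k in l, HasOrderBound T m C (V k))
    {c : κ → smoothFn E H} (hc : ∀ w, Tendsto (fun k => toC (wordOp T w (c k))) l (𝓝 0)) :
    Tendsto (fun k => V k (c k)) l (𝓝 0) := by
  have h1 : Tendsto (fun k => C * ∑ w ∈ (List.finite_length_le ι m).toFinset,
      ‖toC (wordOp T w (c k))‖) l (𝓝 0) := by
    have := (tendsto_finsetSum (List.finite_length_le ι m).toFinset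
      fun w _ => (hc w).norm).const_mul C
    simpa using this
  refine squeeze_zero_norm' (hV.mono fun k hk => hk _ _ fun w hw => ?_) h1
  exact Finset.single_le_sum (f := fun w => ‖toC (wordOp T w (c k))‖)
    (fun _ _ => norm_nonneg _) (by simpa using hw)

/-- Distributions are continuous along curves that are continuous in all `C^k` norms. -/
theorem IsDistribution.tendsto {U : smoothFn E H →ₗ[ℝ] ℝ} (hU : IsDistribution T U)
    {κ : Type*} {l : Filter κ} {c : κ → smoothFn E H} {c₀ : smoothFn E H}
    (hc : ∀ w, Tendsto (fun k => toC (wordOp T w (c k))) l (𝓝 (toC (wordOp T w c₀)))) :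
    Tendsto (fun k => U (c k)) l (𝓝 (U c₀)) := by
  obtain ⟨m, C, hC⟩ := (isDistribution_iff T U).1 hU
  have h1 := tendsto_zero_of_hasOrderBound (V := fun _ => U) (c := fun k => c k - c₀) (l := l)
    (Eventually.of_forall fun _ => hC) fun w => by
      simpa using (hc w).sub_const (toC (wordOp T w c₀))
  simpa using h1.add_const (U c₀)

/-- The product rule for a curve of distributions applied to a curve of test functions. -/
theorem hasDerivWithinAt_apply {V : ℝ → smoothFn E H →ₗ[ℝ] ℝ} {V' : smoothFn E H →ₗ[ℝ] ℝ}
    {S : Set ℝ} {s : ℝ} {m : ℕ} {C : ℝ} (hb : ∀ r ∈ S, HasOrderBound T m C (V r))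
    (hV : ∀ h, HasDerivWithinAt (fun r => V r h) (V' h) S s)
    {c : ℝ → smoothFn E H} {c' : smoothFn E H}
    (hc : ∀ w, HasDerivAt (fun r => toC (wordOp T w (c r))) (toC (wordOp T w c')) s) :
    HasDerivWithinAt (fun r => V r (c r)) (V' (c s) + V s c') S s := by
  rw [hasDerivWithinAt_iff_tendsto_slope]
  have hmem : ∀ᶠ r in 𝓝[S \ {s}] s, r ∈ S \ {s} := self_mem_nhdsWithin
  have h1 := (hasDerivWithinAt_iff_tendsto_slope.1 (hV (c s)))
  have h2 : Tendsto (fun r => V r c') (𝓝[S \ {s}] s) (𝓝 (V s c')) :=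
    (hV c').continuousWithinAt.mono Set.sdiff_subset
  -- The functional varies along with its argument, so the order bound must be uniform in r.
  have h3 : Tendsto (fun r => V r ((r - s)⁻¹ • (c r - c s) - c')) (𝓝[S \ {s}] s) (𝓝 0) := by
    refine tendsto_zero_of_hasOrderBound (hmem.mono fun r hr => hb r hr.1) fun w => ?_
    have := ((hasDerivWithinAt_iff_tendsto_slope.1
      ((hc w).hasDerivWithinAt (s := S))).sub_const (toC (wordOp T w c')))
    rw [sub_self] at this
    refine this.congr fun r => ?_
    simp [slope_def_module]
  refine (((h1.add h2).add h3).congr' (hmem.mono fun r hr => ?_)).trans (by simp)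
  have : r - s ≠ 0 := sub_ne_zero.2 hr.2
  simp only [slope_def_field, map_sub, map_smul, smul_eq_mul]
  field_simp
  ring

variable [T2Space G]

theorem HasOrderBound.comp_halfCasimir {m : ℕ} {C : ℝ} {U : smoothFn E H →ₗ[ℝ] ℝ}
    (hU : HasOrderBound T m C U) :
    HasOrderBound T (m + 2) (C * ∑ i, ∑ j, |(1 / 2) * (killing T)⁻¹ i j|)
      (U ∘ₗ halfCasimir T) := fun h B hB => by
  have : CompleteSpace E := FiniteDimensional.complete ℝ E
  rw [mul_assoc]
  refine hU _ _ fun w hw => ?_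
  simp only [halfCasimir, LinearMap.smul_apply, casimir_apply, map_smul, map_sum, Finset.smul_sum,
    smul_smul, Finset.sum_mul]
  refine (norm_sum_le _ _).trans (Finset.sum_le_sum fun i _ => (norm_sum_le _ _).trans
    (Finset.sum_le_sum fun j _ => ?_))
  rw [norm_smul, neg_mul, norm_neg, Real.norm_eq_abs]
  have : wordOp T w (vf (T i) (vf (T j) h)) = wordOp T (w ++ [i, j]) h := by
    simp [wordOp_append]
  rw [this]
  gcongr
  exact hB _ (by simpa using hw)

/-- No derivatives are lost: a field crossing the translation becomes a linear combination of the
v_k. -/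
theorem exists_norm_wordOp_translate_lieExp_le (φ : ι → ℝ) (t : ℝ) (w : List ι) :
    ∃ C, 0 ≤ C ∧ ∀ (h : smoothFn E H) (B : ℝ),
      (∀ v : List ι, v.length ≤ w.length → ‖toC (wordOp T v h)‖ ≤ B) →
      ‖toC (wordOp T w (translate (lieExp (t • lieVec T φ)) h))‖ ≤ C * B := by
  have : CompleteSpace E := FiniteDimensional.complete ℝ E
  induction w using List.reverseRecOn with
  | nil =>
    refine ⟨1, zero_le_one, fun h B hB => ?_⟩
    rw [one_mul, wordOp_nil, Module.End.one_apply, norm_toC_translate]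
    exact hB [] le_rfl
  | append_singleton w j ih =>
    obtain ⟨C, hC0, hC⟩ := ih
    refine ⟨(∑ k, |NormedSpace.exp (t • -adMatrix T φ) k j|) * C, by positivity,
      fun h B hB => ?_⟩
    simp only [wordOp_append, wordOp_cons, wordOp_nil, mul_one, Module.End.mul_apply,
      vf_translate_lieExp, map_sum, map_smul, Finset.sum_mul]
    refine (norm_sum_le _ _).trans (Finset.sum_le_sum fun k _ => ?_)
    rw [norm_smul, Real.norm_eq_abs, mul_assoc]
    gcongr
    refine hC _ _ fun v hv => ?_
    have : wordOp T v (vf (T k) h) = wordOp T (v ++ [k]) h := by simp [wordOp_append]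
    rw [this]
    exact hB _ (by simpa using hv)

theorem IsDistribution.comp_translate {U : smoothFn E H →ₗ[ℝ] ℝ} (hU : IsDistribution T U)
    (φ : ι → ℝ) (t : ℝ) :
    IsDistribution T (U ∘ₗ translate (lieExp (t • lieVec T φ))) := by
  obtain ⟨m, C, hC⟩ := (isDistribution_iff T U).1 hU
  choose D hD0 hD using exists_norm_wordOp_translate_lieExp_le (T := T) (H := H) φ t
  refine (isDistribution_iff T _).2
    ⟨m, C * ∑ w ∈ (List.finite_length_le ι m).toFinset, D w, fun h B hB => ?_⟩
  rw [mul_assoc]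
  refine hC _ _ fun w hw => (hD w h B fun v hv => hB v (hv.trans hw)).trans ?_
  have hB0 : 0 ≤ B := (norm_nonneg _).trans (hB [] (Nat.zero_le _))
  gcongr
  exact Finset.single_le_sum (f := D) (fun _ _ => hD0 _) (by simpa using hw)

end Distributions

/-! ### Scalar exponential series -/

section ExponentialSeries

theorem abs_le_of_mem_uIcc_zero {s β : ℝ} (hs : s ∈ Set.uIcc 0 β) : |s| ≤ |β| := by
  simpa using Set.abs_sub_left_of_mem_uIcc hs

/-- Passing from n! to (n+2)! gains the factor (n+1)(n+2), so boundedness of the terms shifted by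
two makes the original terms O(1/n²). -/
theorem summable_exp_series_of_bounded {a : ℕ → ℝ} {β M : ℝ}
    (h : ∀ n : ℕ, |β ^ n / (n.factorial : ℝ) * a (n + 2)| ≤ M) :
    Summable fun n : ℕ => |β| ^ n / (n.factorial : ℝ) * |a n| := by
  rw [← summable_nat_add_iff 2]
  have h1 : Summable fun n : ℕ => |β| ^ 2 * M * (1 / ((n : ℝ) + 1) ^ 2) := by
    refine Summable.mul_left _ ?_
    have := (summable_nat_add_iff 1).2 (Real.summable_one_div_nat_pow.2 one_lt_two)
    simpa using this
  refine Summable.of_nonneg_of_le (fun n => by positivity) (fun n => ?_) h1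
  have hn := h n
  rw [abs_mul, abs_div, abs_pow, Nat.abs_cast] at hn
  have hf : ((n + 2).factorial : ℝ) = (n + 2) * (n + 1) * n.factorial := by
    rw [Nat.factorial_succ, Nat.factorial_succ]; push_cast; ring
  have hpos : (0 : ℝ) < n.factorial := by positivity
  have hM0 : 0 ≤ M := le_trans (by positivity) hn
  calc |β| ^ (n + 2) / ((n + 2).factorial : ℝ) * |a (n + 2)|
      = |β| ^ 2 * (|β| ^ n / (n.factorial : ℝ) * |a (n + 2)|) * (1 / ((n + 2) * (n + 1))) := by
        rw [hf, pow_add]; field_simp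
    _ ≤ |β| ^ 2 * M * (1 / ((n : ℝ) + 1) ^ 2) := by
        gcongr
        nlinarith [(Nat.cast_nonneg n : (0 : ℝ) ≤ n)]

theorem hasDerivAt_exp_partial_sum (a : ℕ → ℝ) (N : ℕ) (s : ℝ) :
    HasDerivAt (fun s : ℝ => ∑ n ∈ Finset.range (N + 1), s ^ n / (n.factorial : ℝ) * a n)
      (∑ n ∈ Finset.range N, s ^ n / (n.factorial : ℝ) * a (n + 1)) s := by
  simp only [Finset.sum_range_succ' _ N, pow_zero]
  have h : ∀ n ∈ Finset.range N, HasDerivAt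
      (fun s : ℝ => s ^ (n + 1) / ((n + 1).factorial : ℝ) * a (n + 1))
      (s ^ n / (n.factorial : ℝ) * a (n + 1)) s := fun n _ => by
    refine (((hasDerivAt_pow (n + 1) s).div_const _).mul_const _).congr_deriv ?_
    have : ((n + 1).factorial : ℝ) = (n + 1) * n.factorial := by
      rw [Nat.factorial_succ]; push_cast; ring
    rw [this]
    have hpos : (n.factorial : ℝ) ≠ 0 := by positivity
    simp only [Nat.add_sub_cancel]
    push_cast
    field_simp
  exact (HasDerivAt.fun_sum h).add_const _

theorem abs_exp_term_le {a : ℕ → ℝ} {β s : ℝ} (hs : s ∈ Set.uIcc 0 β) (n : ℕ) :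
    |s ^ n / (n.factorial : ℝ) * a n| ≤ |β| ^ n / (n.factorial : ℝ) * |a n| := by
  rw [abs_mul, abs_div, abs_pow, Nat.abs_cast]
  have := pow_le_pow_left₀ (abs_nonneg s) (abs_le_of_mem_uIcc_zero hs) n
  gcongr ?_ / _ * _

theorem summable_exp_series {a : ℕ → ℝ} {β s : ℝ} (hs : s ∈ Set.uIcc 0 β)
    (h : Summable fun n : ℕ => |β| ^ n / (n.factorial : ℝ) * |a n|) :
    Summable fun n : ℕ => s ^ n / (n.factorial : ℝ) * a n := by
  refine Summable.of_norm_bounded h fun n => ?_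
  exact abs_exp_term_le hs n

theorem abs_exp_partial_sum_le {a : ℕ → ℝ} {β s : ℝ} (hs : s ∈ Set.uIcc 0 β)
    (h : Summable fun n : ℕ => |β| ^ n / (n.factorial : ℝ) * |a n|) (N : ℕ) :
    |∑ n ∈ Finset.range N, s ^ n / (n.factorial : ℝ) * a n|
      ≤ ∑' n : ℕ, |β| ^ n / (n.factorial : ℝ) * |a n| := by
  refine (Finset.abs_sum_le_sum_abs _ _).trans ?_
  refine (Finset.sum_le_sum fun n _ => ?_).trans
    (h.sum_le_tsum (Finset.range N) fun n _ => by positivity)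
  exact abs_exp_term_le hs n

theorem hasDerivWithinAt_exp_series {a : ℕ → ℝ} {β : ℝ} {y y' : ℝ → ℝ}
    (hy : ∀ s ∈ Set.uIcc 0 β, HasSum (fun n : ℕ => s ^ n / (n.factorial : ℝ) * a n) (y s))
    (hy' : ∀ s ∈ Set.uIcc 0 β, HasSum (fun n : ℕ => s ^ n / (n.factorial : ℝ) * a (n + 1)) (y' s))
    (h : Summable fun n : ℕ => |β| ^ n / (n.factorial : ℝ) * |a (n + 2)|)
    {s : ℝ} (hs : s ∈ Set.uIcc 0 β) : HasDerivWithinAt y (y' s) (Set.uIcc 0 β) s := by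
  refine hasDerivWithinAt_of_norm_sub_le
    (M := ∑' n : ℕ, |β| ^ n / (n.factorial : ℝ) * |a (n + 2)|) fun r hr => ?_
  -- Each differentiation of a partial sum drops one term, hence the lengths N + 2, N + 1 and N.
  have hN : ∀ N : ℕ, |(∑ n ∈ Finset.range (N + 2), r ^ n / (n.factorial : ℝ) * a n)
      - (∑ n ∈ Finset.range (N + 2), s ^ n / (n.factorial : ℝ) * a n)
      - (r - s) * ∑ n ∈ Finset.range (N + 1), s ^ n / (n.factorial : ℝ) * a (n + 1)|
      ≤ (∑' n : ℕ, |β| ^ n / (n.factorial : ℝ) * |a (n + 2)|) * |r - s| ^ 2 := fun N =>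
    abs_sub_sub_le_of_hasDerivWithinAt (S := Set.uIcc 0 β) (convex_uIcc 0 β)
      (fun t _ => (hasDerivAt_exp_partial_sum a (N + 1) t).hasDerivWithinAt)
      (fun t _ => (hasDerivAt_exp_partial_sum (fun n => a (n + 1)) N t).hasDerivWithinAt)
      (fun t ht => abs_exp_partial_sum_le (a := fun n => a (n + 2)) ht h N) hr hs
  have l1 := (hy r hr).tendsto_sum_nat.comp (tendsto_add_atTop_nat 2)
  have l2 := (hy s hs).tendsto_sum_nat.comp (tendsto_add_atTop_nat 2)
  have l3 := (hy' s hs).tendsto_sum_nat.comp (tendsto_add_atTop_nat 1)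
  exact le_of_tendsto ((l1.sub l2).sub (l3.const_mul (r - s))).abs (Eventually.of_forall hN)

end ExponentialSeries

/-! ### Existence of the shifted evolution -/

section Existence

variable {E : Type*} [NormedAddCommGroup E] [NormedSpace ℝ E] [FiniteDimensional ℝ E]
  {G : Type*} [TopologicalSpace G] [ChartedSpace E G] [Group G] [LieGroup 𝓘(ℝ, E) ∞ G]
  [CompactSpace G] [T2Space G] {H : Subgroup G} [MeasurableSpace (G ⧸ H)] [BorelSpace (G ⧸ H)]
  (μ : Measure (G ⧸ H)) [IsFiniteMeasure μ] {ι : Type*} [Fintype ι] [DecidableEq ι]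
  (T : Module.Basis ι ℝ (GroupLieAlgebra 𝓘(ℝ, E) G))

theorem hasOrderBound_pairing (f : smoothFn E H) :
    HasOrderBound T 0 (‖integralCLM μ‖ * ‖toC f‖) ((pairingBilin μ).flip f) := fun h B hB => by
  refine (abs_pairing_le μ h f).trans ?_
  gcongr
  exact hB [] le_rfl

variable [SMulInvariantMeasure G (G ⧸ H) μ]

theorem pairing_expV_smul_casimir_pow (β : ℝ) (φ : ι → ℝ) (n : ℕ) (h f : smoothFn E H) :
    pairing μ h (expV T φ ((((-(1 / 2) * β) • casimir T) ^ n : Module.End ℝ (smoothFn E H)) f))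
      / (n.factorial : ℝ) = β ^ n / (n.factorial : ℝ) *
        pairing μ (translate (lieExp (lieVec T φ))⁻¹ h) ((halfCasimir T ^ n) f) := by
  have : CompleteSpace E := FiniteDimensional.complete ℝ E
  rw [smul_casimir_pow, ← pairing_translate_right, map_smul, ← pairingBilin_apply, map_smul,
    pairingBilin_apply, smul_eq_mul, expV, lieVec]
  ring

theorem pairing_halfCasimir_halfCasimir (n : ℕ) (h f : smoothFn E H) :
    pairing μ (halfCasimir T (halfCasimir T h)) ((halfCasimir T ^ n) f)
      = pairing μ h ((halfCasimir T ^ (n + 2)) f) := by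
  have : CompleteSpace E := FiniteDimensional.complete ℝ E
  rw [← pairing_halfCasimir, ← pairing_halfCasimir, pow_succ', pow_succ', Module.End.mul_apply,
    Module.End.mul_apply]

/-- Convergence of the series for all test functions forces absolute convergence. -/
theorem SeriesConverges.summable {β : ℝ} {φ : ι → ℝ} {f : smoothFn E H}
    (hf : SeriesConverges T μ β φ f) (h : smoothFn E H) :
    Summable fun n : ℕ => |β| ^ n / (n.factorial : ℝ) * |pairing μ h ((halfCasimir T ^ n) f)| := by
  have : CompleteSpace E := FiniteDimensional.complete ℝ E
  obtain ⟨S, -, hS⟩ := hf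
  -- This test function undoes the translation, and symmetry of D shifts the index by two. The terms
  -- of the convergent series, differences of its partial sums, are then the bounded quantities
  -- required.
  have h1 := hS (translate (lieExp (lieVec T φ)) (halfCasimir T (halfCasimir T h)))
  simp only [pairing_expV_smul_casimir_pow, translate_inv_translate] at h1
  have h2 := (h1.comp (tendsto_add_atTop_nat 1)).sub h1
  simp only [Function.comp_def, Finset.sum_range_succ, add_sub_cancel_left] at h2
  obtain ⟨M, hM⟩ := h2.norm.bddAbove_range
  refine summable_exp_series_of_bounded (a := fun n => pairing μ h ((halfCasimir T ^ n) f))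
    (M := M) fun n => ?_
  refine le_trans (le_of_eq ?_) (hM ⟨n, rfl⟩)
  simp only [Real.norm_eq_abs, pairing_halfCasimir_halfCasimir]

/-- The evolution `e^{-(s/2) K^{ij} v_i v_j} f` as a curve of distributions. -/
theorem exists_casimir_evolution {β : ℝ} {φ : ι → ℝ} {f : smoothFn E H}
    (hf : SeriesConverges T μ β φ f) :
    ∃ F : ℝ → smoothFn E H →ₗ[ℝ] ℝ,
      (∀ s ∈ Set.uIcc 0 β, ∀ h, HasSum (fun n : ℕ => s ^ n / (n.factorial : ℝ) *
        pairing μ h ((halfCasimir T ^ n) f)) (F s h)) ∧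
      (∃ m C, ∀ s ∈ Set.uIcc 0 β, HasOrderBound T m C (F s)) ∧
      ∀ s ∈ Set.uIcc 0 β, ∀ h, HasDerivWithinAt (fun r => F r h) (F s (halfCasimir T h))
        (Set.uIcc 0 β) s := by
  have : CompleteSpace E := FiniteDimensional.complete ℝ E
  have hsum := hf.summable
  have hex : ∀ s : ℝ, ∃ V : smoothFn E H →ₗ[ℝ] ℝ, s ∈ Set.uIcc 0 β → ∀ h,
      HasSum (fun n : ℕ => s ^ n / (n.factorial : ℝ) * pairing μ h ((halfCasimir T ^ n) f))
        (V h) := by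
    intro s
    by_cases hs : s ∈ Set.uIcc 0 β
    swap
    · exact ⟨0, fun h => absurd h hs⟩
    have hS := fun h => (summable_exp_series hs (hsum h)).hasSum
    refine ⟨{ toFun := fun h => ∑' n : ℕ, s ^ n / (n.factorial : ℝ) *
                pairing μ h ((halfCasimir T ^ n) f)
              map_add' := fun h h' => ?_
              map_smul' := fun c h => ?_ }, fun _ h => hS h⟩
    · refine HasSum.tsum_eq ?_
      convert! (hS h).add (hS h') using 2 with n
      rw [← pairingBilin_apply, map_add, LinearMap.add_apply, mul_add]
      rfl
    · refine HasSum.tsum_eq ?_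
      convert! (hS h).mul_left c using 2 with n
      rw [← pairingBilin_apply, map_smul, LinearMap.smul_apply, pairingBilin_apply, smul_eq_mul]
      ring
  choose F hF using hex
  refine ⟨F, hF, ?_, fun s hs h => ?_⟩
  -- Partial sums are bounded on each test function uniformly in N and s, so Banach-Steinhaus gives
  -- one order bound for all of them, which the limits inherit.
  · set V : ℕ × Set.uIcc 0 β → smoothFn E H →ₗ[ℝ] ℝ := fun p =>
      (pairingBilin μ).flip (∑ n ∈ Finset.range p.1,
        ((p.2 : ℝ) ^ n / (n.factorial : ℝ)) • (halfCasimir T ^ n) f) with hV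
    have hVa : ∀ p h, V p h = ∑ n ∈ Finset.range p.1,
        (p.2 : ℝ) ^ n / (n.factorial : ℝ) * pairing μ h ((halfCasimir T ^ n) f) := by
      intro p h
      simp [hV, map_sum, map_smul]
    obtain ⟨m, C, -, hC⟩ := exists_hasOrderBound T (V := V)
      (fun p => (hasOrderBound_pairing μ T _).isDistribution) fun h =>
        ⟨_, fun p => by rw [hVa]; exact abs_exp_partial_sum_le p.2.2 (hsum h) p.1⟩
    refine ⟨m, C, fun s hs => HasOrderBound.of_tendsto (V := fun N => V (N, ⟨s, hs⟩))
      (fun N => hC _) fun h => ?_⟩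
    simp only [hVa]
    exact (hF s hs h).tendsto_sum_nat
  · have hshift : ∀ n, pairing μ (halfCasimir T h) ((halfCasimir T ^ n) f)
        = pairing μ h ((halfCasimir T ^ (n + 1)) f) := fun n => by
      rw [← pairing_halfCasimir, pow_succ', Module.End.mul_apply]
    refine hasDerivWithinAt_exp_series (a := fun n => pairing μ h ((halfCasimir T ^ n) f))
      (y' := fun s => F s (halfCasimir T h)) (fun s hs => hF s hs h) (fun s hs => ?_) ?_ hs
    · simpa only [hshift] using hF s hs (halfCasimir T h)
    · simpa only [pairing_halfCasimir_halfCasimir] using hsum (halfCasimir T (halfCasimir T h))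

/-- The solution F(s) ∘ e^{-s v_J} is the transposed form of e^{s v_J} F(s). The product rule yields
-A because D commutes with translations. -/
theorem exists_isShiftedHeatEvolution (hK : (killing T).PosDef) {β : ℝ} {J : ι → ℝ}
    {f : smoothFn E H} (hf : SeriesConverges T μ β (β • J) f) :
    ∃ U, IsShiftedHeatEvolution T μ β J f U ∧ ∀ h,
      HasSum (fun n : ℕ => pairing μ h (expV T (β • J)
        ((((-(1 / 2) * β) • casimir T) ^ n : Module.End ℝ (smoothFn E H)) f)) / (n.factorial : ℝ))
        (U β h) := by
  have : CompleteSpace E := FiniteDimensional.complete ℝ E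
  obtain ⟨F, hF, ⟨m, C, hC⟩, hd⟩ := exists_casimir_evolution μ T hf
  refine ⟨fun s => F s ∘ₗ translate (lieExp (s • lieVec T (-J))), ⟨fun s hs => ?_, fun h => ?_,
    fun s hs h => ?_⟩, fun h => ?_⟩
  · exact (hC s hs).isDistribution.comp_translate (-J) s
  · have h0 := hF 0 Set.left_mem_uIcc h
    simp only [zero_smul, lieExp_zero, LinearMap.comp_apply, translate_one, Module.End.one_apply]
    refine h0.unique ?_
    convert! hasSum_ite_eq (0 : ℕ) (pairing μ h f) using 2 with n
    rcases n with _ | n <;> simp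
  · refine (hasDerivWithinAt_apply hC (V' := F s ∘ₗ halfCasimir T) (fun h => hd s hs h)
      (c' := translate (lieExp (s • lieVec T (-J))) (vf (lieVec T (-J)) h))
      (fun w => hasDerivAt_toC_wordOp_translate T (-J) w h s)).congr_deriv ?_
    have hneg : lieVec T (-J) = -lieVec T J := by
      rw [← neg_one_smul ℝ J, lieVec_smul, neg_one_smul]
    have hvn : vf (H := H) (-lieVec T J) h = -vf (lieVec T J) h := by
      rw [← neg_one_smul ℝ (lieVec T J), vf_smul]; simp
    rw [distGenerator_apply]
    simp only [LinearMap.comp_apply, halfCasimir_translate T hK]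
    conv_lhs => rw [hneg, hvn, map_neg, map_neg, ← sub_eq_add_neg]
    rw [hneg]
  · simp only [pairing_expV_smul_casimir_pow]
    have h1 := hF β Set.right_mem_uIcc (translate (lieExp (lieVec T (β • J)))⁻¹ h)
    have h2 : (lieExp (lieVec T (β • J)))⁻¹ = lieExp (β • lieVec T (-J)) := by
      rw [← lieExp_neg, lieVec_smul, ← neg_one_smul ℝ J, lieVec_smul, smul_comm, neg_one_smul]
    rw [h2] at h1
    simpa only [h2, LinearMap.comp_apply] using h1

end Existence

/-! ### Uniqueness by reflection in time -/

section Uniqueness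

variable {E : Type*} [NormedAddCommGroup E] [NormedSpace ℝ E] [FiniteDimensional ℝ E]
  {G : Type*} [TopologicalSpace G] [ChartedSpace E G] [Group G] [LieGroup 𝓘(ℝ, E) ∞ G]
  [CompactSpace G] [T2Space G] {H : Subgroup G} {ι : Type*} [Fintype ι] [DecidableEq ι]
  (T : Module.Basis ι ℝ (GroupLieAlgebra 𝓘(ℝ, E) G))

theorem vf_translate_lieExp_self (X : GroupLieAlgebra 𝓘(ℝ, E) G) (t : ℝ) (f : smoothFn E H) :
    vf X (translate (lieExp (t • X)) f) = translate (lieExp (t • X)) (vf X f) := by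
  have : CompleteSpace E := FiniteDimensional.complete ℝ E
  have h1 := hasDerivAt_toC_translate X (translate (lieExp (t • X)) f) 0
  have h2 := (hasDerivAt_toC_translate X f (0 + t)).comp_add_const 0 t
  have h3 : (fun s : ℝ => toC (translate (lieExp ((s + t) • X)) f))
      = fun s : ℝ => toC (translate (lieExp (s • X)) (translate (lieExp (t • X)) f)) := by
    ext1 s
    rw [lieExp_add_smul, translate_mul, Module.End.mul_apply]
  rw [h3] at h2
  have h4 := h1.unique h2
  rw [zero_smul, lieExp_zero, translate_one, zero_add, Module.End.one_apply] at h4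
  ext x
  exact DFunLike.congr_fun h4 x

open Classical in
/-- The function `g ↦ W (g · h)` on the group, for a distribution `W`. -/
def orbitFn (W : smoothFn E H →ₗ[ℝ] ℝ) (h : smoothFn E H) : C(G, ℝ) :=
  if hW : IsDistribution T W then
    ⟨fun g => W (translate g h), continuous_iff_continuousAt.2 fun g =>
      hW.tendsto fun w => (continuous_toC_wordOp_translate T w h).tendsto g⟩
  else 0

variable {T}

theorem orbitFn_apply {W : smoothFn E H →ₗ[ℝ] ℝ} (hW : IsDistribution T W) (h : smoothFn E H)
    (g : G) : orbitFn T W h g = W (translate g h) := by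
  rw [orbitFn, dif_pos hW]
  rfl

theorem IsDistribution.comp_wordOp {W : smoothFn E H →ₗ[ℝ] ℝ} (hW : IsDistribution T W)
    (v : List ι) : IsDistribution T (W ∘ₗ wordOp T v) := by
  obtain ⟨m, C, hC⟩ := (isDistribution_iff T W).1 hW
  exact (hC.comp_wordOp v).isDistribution

theorem hasDerivAt_distribution_translate {W : smoothFn E H →ₗ[ℝ] ℝ} (hW : IsDistribution T W)
    (j : ι) (h : smoothFn E H) (τ : ℝ) :
    HasDerivAt (fun τ : ℝ => W (translate (lieExp (τ • T j)) h))
      (W (vf (T j) (translate (lieExp (τ • T j)) h))) τ := by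
  have : CompleteSpace E := FiniteDimensional.complete ℝ E
  obtain ⟨m, C, hC⟩ := (isDistribution_iff T W).1 hW
  have hj : lieVec T (Pi.single j 1) = T j := by
    simp [lieVec, Pi.single_apply]
  have h1 := hasDerivWithinAt_apply (S := Set.univ) (V := fun _ => W) (V' := 0) (s := τ)
    (fun _ _ => hC) (fun h => hasDerivWithinAt_const _ _ _)
    (fun w => hasDerivAt_toC_wordOp_translate T (Pi.single j 1) w h τ)
  rw [hasDerivWithinAt_univ, hj] at h1
  rw [vf_translate_lieExp_self]
  simpa using h1

section Haar

variable [MeasurableSpace G] [BorelSpace G] [IsTopologicalGroup G] (ν : Measure G)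
  [IsFiniteMeasure ν] [ν.IsMulLeftInvariant]

theorem integralCLM_comp_mulLeft (a : G) (F : C(G, ℝ)) :
    integralCLM ν (F.comp ⟨fun g => a * g, continuous_const_mul a⟩) = integralCLM ν F := by
  rw [integralCLM_apply, integralCLM_apply]
  exact integral_mul_left_eq_self (μ := ν) F a

/-- The derivative holds in the sup norm because the second τ-derivative is bounded uniformly: W has
finite order and all translates of h share their C^m bounds, G being compact. -/
theorem hasDerivAt_orbitFn_comp_mulLeft {W : smoothFn E H →ₗ[ℝ] ℝ} (hW : IsDistribution T W)
    (j : ι) (h : smoothFn E H) :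
    HasDerivAt (fun τ : ℝ => (orbitFn T W h).comp
        ⟨fun g => lieExp (τ • T j) * g, continuous_const_mul _⟩)
      (orbitFn T (W ∘ₗ wordOp T [j]) h) 0 := by
  have : CompleteSpace E := FiniteDimensional.complete ℝ E
  have hW1 := hW.comp_wordOp [j]
  obtain ⟨m, C, hC⟩ := (isDistribution_iff T _).1 (hW.comp_wordOp [j, j])
  obtain ⟨B, hB⟩ := exists_norm_wordOp_translate_le (T := T) m h
  have h1 := hasDerivWithinAt_continuousMap (M := G) (S := Set.univ) convex_univ
    (u := fun τ : ℝ => (orbitFn T W h).comp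
        ⟨fun g => lieExp (τ • T j) * g, continuous_const_mul _⟩)
    (u' := fun τ : ℝ => (orbitFn T (W ∘ₗ wordOp T [j]) h).comp
        ⟨fun g => lieExp (τ • T j) * g, continuous_const_mul _⟩)
    (u'' := fun τ g => (W ∘ₗ wordOp T [j, j]) (translate (lieExp (τ • T j) * g) h))
    (B := |C * B|)
    (fun g τ _ => by
      simp only [ContinuousMap.comp_apply, ContinuousMap.coe_mk, orbitFn_apply hW,
        orbitFn_apply hW1, translate_mul, Module.End.mul_apply, hasDerivWithinAt_univ]
      simpa using hasDerivAt_distribution_translate hW j (translate g h) τ)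
    (fun g τ _ => by
      simp only [ContinuousMap.comp_apply, ContinuousMap.coe_mk,
        orbitFn_apply hW1, translate_mul, Module.End.mul_apply, hasDerivWithinAt_univ]
      simpa using hasDerivAt_distribution_translate hW1 j (translate g h) τ)
    (fun τ _ g => (hC _ B fun w hw => hB w hw _).trans (le_abs_self _))
    (abs_nonneg _) (Set.mem_univ 0)
  rw [hasDerivWithinAt_univ] at h1
  refine h1.congr_deriv ?_
  ext g
  simp [lieExp_zero]

/-- Integration by parts on the group. -/
theorem integral_orbitFn_vf {W W' : smoothFn E H →ₗ[ℝ] ℝ} (hW : IsDistribution T W)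
    (hW' : IsDistribution T W') (j : ι) (h : smoothFn E H) :
    integralCLM ν (orbitFn T (W ∘ₗ wordOp T [j]) h * orbitFn T W' h)
      = -integralCLM ν (orbitFn T W h * orbitFn T (W' ∘ₗ wordOp T [j]) h) := by
  have : CompleteSpace E := FiniteDimensional.complete ℝ E
  have h1 := (integralCLM ν).hasFDerivAt.comp_hasDerivAt (0 : ℝ)
    ((hasDerivAt_orbitFn_comp_mulLeft hW j h).mul (hasDerivAt_orbitFn_comp_mulLeft hW' j h))
  have h2 := h1.unique (f := fun τ : ℝ => integralCLM ν
      ((orbitFn T W h).comp ⟨fun g => lieExp (τ • T j) * g, continuous_const_mul _⟩ *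
        (orbitFn T W' h).comp ⟨fun g => lieExp (τ • T j) * g, continuous_const_mul _⟩)) (by
    rw [show (fun τ : ℝ => integralCLM ν
      ((orbitFn T W h).comp ⟨fun g => lieExp (τ • T j) * g, continuous_const_mul _⟩ *
        (orbitFn T W' h).comp ⟨fun g => lieExp (τ • T j) * g, continuous_const_mul _⟩))
        = fun _ => integralCLM ν (orbitFn T W h * orbitFn T W' h) from funext fun τ =>
          integralCLM_comp_mulLeft ν (lieExp (τ • T j)) (orbitFn T W h * orbitFn T W' h)]
    exact hasDerivAt_const 0 _)
  have h3 : ∀ F : C(G, ℝ),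
      F.comp ⟨fun g => lieExp ((0 : ℝ) • T j) * g, continuous_const_mul _⟩ = F := fun F => by
    ext g; simp [lieExp_zero]
  rw [h3, h3, map_add] at h2
  linarith

theorem orbitFn_comp_halfCasimir {W : smoothFn E H →ₗ[ℝ] ℝ} (hW : IsDistribution T W)
    (h : smoothFn E H) : orbitFn T (W ∘ₗ halfCasimir T) h
      = ∑ i, ∑ j, (-(1 / 2) * (killing T)⁻¹ i j) •
        orbitFn T ((W ∘ₗ wordOp T [i]) ∘ₗ wordOp T [j]) h := by
  have : CompleteSpace E := FiniteDimensional.complete ℝ E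
  obtain ⟨m, C, hC⟩ := (isDistribution_iff T _).1 hW
  ext g
  rw [orbitFn_apply hC.comp_halfCasimir.isDistribution]
  simp only [ContinuousMap.coe_sum, Finset.sum_apply, ContinuousMap.coe_smul, Pi.smul_apply,
    orbitFn_apply ((hW.comp_wordOp _).comp_wordOp _), LinearMap.comp_apply, halfCasimir,
    LinearMap.smul_apply, casimir_apply, map_smul, map_sum, smul_eq_mul, Finset.mul_sum]
  simp [mul_assoc]

/-- Two integrations by parts; symmetry of K⁻¹ restores the order of the indices. D is thus
symmetric on smeared distributions. -/
theorem integral_orbitFn_halfCasimir {W W' : smoothFn E H →ₗ[ℝ] ℝ} (hW : IsDistribution T W)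
    (hW' : IsDistribution T W') (h : smoothFn E H) :
    integralCLM ν (orbitFn T (W ∘ₗ halfCasimir T) h * orbitFn T W' h)
      = integralCLM ν (orbitFn T W h * orbitFn T (W' ∘ₗ halfCasimir T) h) := by
  rw [orbitFn_comp_halfCasimir hW, orbitFn_comp_halfCasimir hW']
  simp only [Finset.sum_mul, Finset.mul_sum, smul_mul_assoc, mul_smul_comm, map_sum, map_smul]
  conv_rhs => rw [Finset.sum_comm]
  refine Finset.sum_congr rfl fun i _ => Finset.sum_congr rfl fun j _ => ?_
  rw [killing_inv_symm T i j, integral_orbitFn_vf ν (hW.comp_wordOp _) hW',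
    mul_comm (orbitFn T W h), integral_orbitFn_vf ν (hW'.comp_wordOp _) hW,
    mul_comm (orbitFn T (W' ∘ₗ wordOp T [j]) h)]

end Haar

theorem hasDerivWithinAt_orbitFn {β : ℝ} {W : ℝ → smoothFn E H →ₗ[ℝ] ℝ} {m : ℕ} {C : ℝ}
    (hb : ∀ s ∈ Set.uIcc 0 β, HasOrderBound T m C (W s))
    (hW : ∀ s ∈ Set.uIcc 0 β, ∀ h, HasDerivWithinAt (fun r => W r h) (W s (halfCasimir T h))
      (Set.uIcc 0 β) s) (h : smoothFn E H) {s : ℝ} (hs : s ∈ Set.uIcc 0 β) :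
    HasDerivWithinAt (fun r => orbitFn T (W r) h) (orbitFn T (W s ∘ₗ halfCasimir T) h)
      (Set.uIcc 0 β) s := by
  have hb1 := fun s hs => (hb s hs).comp_halfCasimir
  have hb2 := fun s hs => (hb1 s hs).comp_halfCasimir
  obtain ⟨B, hB⟩ := exists_norm_wordOp_translate_le (T := T) (m + 2 + 2) h
  refine hasDerivWithinAt_continuousMap (convex_uIcc 0 β)
    (u' := fun s => orbitFn T (W s ∘ₗ halfCasimir T) h)
    (u'' := fun s g => ((W s ∘ₗ halfCasimir T) ∘ₗ halfCasimir T) (translate g h))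
    (fun g s hs => ?_) (fun g s hs => ?_)
    (fun s hs g => (hb2 s hs _ B fun w hw => hB w hw g).trans (le_abs_self _)) (abs_nonneg _) hs
  · rw [orbitFn_apply (hb1 s hs).isDistribution]
    exact (hW s hs (translate g h)).congr_of_mem
      (fun r hr => orbitFn_apply (hb r hr).isDistribution h g) hs
  · exact (hW s hs (halfCasimir T (translate g h))).congr_of_mem
      (fun r hr => orbitFn_apply (hb1 r hr).isDistribution h g) hs

/-- In ∫ q(s) q(a+β-s) the evolution of one factor cancels that of the reflected one, by symmetry of
D alone; neither the sign of D nor that of β enters. The value is 0 at s = a and ∫ q(c)² at the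
midpoint c. -/
theorem halfCasimir_evolution_midpoint {β : ℝ} {W : ℝ → smoothFn E H →ₗ[ℝ] ℝ} {m : ℕ} {C : ℝ}
    (hb : ∀ s ∈ Set.uIcc 0 β, HasOrderBound T m C (W s))
    (hW : ∀ s ∈ Set.uIcc 0 β, ∀ h, HasDerivWithinAt (fun r => W r h) (W s (halfCasimir T h))
      (Set.uIcc 0 β) s) {a : ℝ} (ha : a ∈ Set.uIcc 0 β) (ha0 : W a = 0) : W ((a + β) / 2) = 0 := by
  have : IsTopologicalGroup G := topologicalGroup_of_lieGroup 𝓘(ℝ, E) ∞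
  let _ : MeasurableSpace G := borel G
  have : BorelSpace G := ⟨rfl⟩
  set ν : Measure G := Measure.haar with hν
  ext h
  set q : ℝ → C(G, ℝ) := fun s => orbitFn T (W s) h with hq
  set q' : ℝ → C(G, ℝ) := fun s => orbitFn T (W s ∘ₗ halfCasimir T) h with hq'
  have hsub : Set.uIcc a β ⊆ Set.uIcc 0 β := Set.uIcc_subset_uIcc ha Set.right_mem_uIcc
  have hrefl : ∀ s ∈ Set.uIcc a β, a + β - s ∈ Set.uIcc a β := fun s hs => by
    rw [Set.mem_uIcc] at hs ⊢
    rcases hs with hs | hs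
    · left; constructor <;> linarith
    · right; constructor <;> linarith
  have hqd : ∀ s ∈ Set.uIcc a β, HasDerivWithinAt q (q' s) (Set.uIcc a β) s := fun s hs =>
    (hasDerivWithinAt_orbitFn hb hW h (hsub hs)).mono hsub
  have hE : ∀ s ∈ Set.uIcc a β, HasDerivWithinAt
      (fun s => integralCLM ν (q s * q (a + β - s))) 0 (Set.uIcc a β) s := fun s hs => by
    have h1 : HasDerivWithinAt (fun s => q (a + β - s)) (-q' (a + β - s)) (Set.uIcc a β) s := by
      have := (hqd _ (hrefl s hs)).scomp s
        ((hasDerivWithinAt_id s (Set.uIcc a β)).const_sub (a + β)) hrefl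
      rw [neg_one_smul] at this
      exact this
    have h2 := (integralCLM ν).hasFDerivAt.comp_hasDerivWithinAt s ((hqd s hs).mul h1)
    refine h2.congr_deriv ?_
    rw [mul_neg, map_add, map_neg, integral_orbitFn_halfCasimir ν
      (hb s (hsub hs)).isDistribution (hb _ (hsub (hrefl s hs))).isDistribution]
    ring
  set c := (a + β) / 2 with hc
  have hcm : c ∈ Set.uIcc a β := by
    rw [Set.mem_uIcc]
    rcases le_total a β with h | h
    · left; constructor <;> linarith
    · right; constructor <;> linarith
  have hconst := (convex_uIcc a β).norm_image_sub_le_of_norm_hasDerivWithin_le (C := 0) hE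
    (fun s _ => by simp) Set.left_mem_uIcc hcm
  have hqa : q a = 0 := by
    ext g
    rw [hq, orbitFn_apply (hb a ha).isDistribution, ha0]
    rfl
  rw [zero_mul, norm_le_zero_iff, hqa, zero_mul, map_zero, sub_zero,
    show a + β - c = c by rw [hc]; ring, integralCLM_apply] at hconst
  have h3 := (integral_eq_zero_iff_of_nonneg (μ := ν) (f := fun g => (q c * q c) g)
    (fun g => mul_self_nonneg (q c g)) (integrable_continuousMap ν _)).1 hconst
  -- Haar measure charges open sets, so the continuous function q(c) vanishes everywhere; at g = 1
  -- it is the value of W(c) at h.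
  have h4 : (fun g => (q c * q c) g) = fun _ => 0 :=
    Continuous.ae_eq_iff_eq ν (q c * q c).continuous continuous_const |>.1 h3
  have h5 : q c 1 = 0 := by simpa using congrFun h4 1
  rw [hq] at h5
  simpa [orbitFn_apply (hb c (hsub hcm)).isDistribution, translate_one] using h5

/-- Uniqueness for the backward heat equation in the space of distributions. -/
theorem halfCasimir_evolution_eq_zero {β : ℝ} {W : ℝ → smoothFn E H →ₗ[ℝ] ℝ}
    (hd : ∀ s ∈ Set.uIcc 0 β, IsDistribution T (W s))
    (hW : ∀ s ∈ Set.uIcc 0 β, ∀ h, HasDerivWithinAt (fun r => W r h) (W s (halfCasimir T h))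
      (Set.uIcc 0 β) s) (h0 : W 0 = 0) : W β = 0 := by
  obtain ⟨m, C, -, hC⟩ := exists_hasOrderBound T (κ := Set.uIcc (0 : ℝ) β) (V := fun s => W s)
    (fun s => hd s s.2) fun h => by
      have hcont : ContinuousOn (fun r => W r h) (Set.uIcc 0 β) :=
        fun s hs => (hW s hs h).continuousWithinAt
      obtain ⟨B, hB⟩ := isCompact_uIcc.exists_bound_of_continuousOn hcont
      exact ⟨B, fun s => hB s s.2⟩
  have hb : ∀ s ∈ Set.uIcc 0 β, HasOrderBound T m C (W s) := fun s hs => hC ⟨s, hs⟩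
  -- The successive midpoints with β, starting at 0; β itself is reached only in the limit.
  set a : ℕ → ℝ := fun n => β - β * (1 / 2) ^ n with ha
  have hmem : ∀ n, a n ∈ Set.uIcc 0 β := fun n => by
    have h1 : (0 : ℝ) ≤ (1 / 2) ^ n := by positivity
    have h2 : ((1 : ℝ) / 2) ^ n ≤ 1 := pow_le_one₀ (by norm_num) (by norm_num)
    rw [Set.mem_uIcc]
    rcases le_total 0 β with h | h
    · left; constructor <;> simp only [ha] <;> nlinarith
    · right; constructor <;> simp only [ha] <;> nlinarith
  have hzero : ∀ n, W (a n) = 0 := fun n => by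
    induction n with
    | zero => simpa [ha] using h0
    | succ n ih =>
      have := halfCasimir_evolution_midpoint hb hW (hmem n) ih
      rw [show (a n + β) / 2 = a (n + 1) by simp only [ha, pow_succ]; ring] at this
      exact this
  ext h
  have hlim : Tendsto a atTop (𝓝[Set.uIcc 0 β] β) := by
    refine tendsto_nhdsWithin_iff.2 ⟨?_, Eventually.of_forall hmem⟩
    have := (tendsto_pow_atTop_nhds_zero_of_lt_one (r := (1 / 2 : ℝ)) (by norm_num)
      (by norm_num)).const_mul β |>.const_sub β
    simpa [ha] using this
  have h1 := (hW β Set.right_mem_uIcc h).continuousWithinAt.tendsto.comp hlim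
  refine tendsto_nhds_unique h1 ?_
  simp [Function.comp_def, hzero]

variable (T) in
theorem IsShiftedHeatEvolution.unique [MeasurableSpace (G ⧸ H)] [BorelSpace (G ⧸ H)]
    {μ : Measure (G ⧸ H)} [IsFiniteMeasure μ] (hK : (killing T).PosDef)
    {β : ℝ} {J : ι → ℝ} {f : smoothFn E H} {U₁ U₂ : ℝ → smoothFn E H →ₗ[ℝ] ℝ}
    (h₁ : IsShiftedHeatEvolution T μ β J f U₁) (h₂ : IsShiftedHeatEvolution T μ β J f U₂) :
    U₁ β = U₂ β := by
  have : CompleteSpace E := FiniteDimensional.complete ℝ E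
  set V : ℝ → smoothFn E H →ₗ[ℝ] ℝ := fun s => U₁ s - U₂ s with hV
  have hVdist : ∀ s ∈ Set.uIcc 0 β, IsDistribution T (V s) := fun s hs =>
    (h₁.isDistribution s hs).sub (h₂.isDistribution s hs)
  have hVd : ∀ s ∈ Set.uIcc 0 β, ∀ h, HasDerivWithinAt (fun r => V r h)
      ((V s ∘ₗ (halfCasimir T - vf (lieVec T J))) h) (Set.uIcc 0 β) s := fun s hs h => by
    refine ((h₁.evolution s hs h).sub (h₂.evolution s hs h)).congr_deriv ?_
    rw [distGenerator_apply, distGenerator_apply]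
    simp only [hV, LinearMap.comp_apply, LinearMap.sub_apply, map_sub]
    ring
  obtain ⟨m, C, -, hC⟩ := exists_hasOrderBound T (κ := Set.uIcc (0 : ℝ) β) (V := fun s => V s)
    (fun s => hVdist s s.2) fun h => by
      have hcont : ContinuousOn (fun r => V r h) (Set.uIcc 0 β) :=
        fun s hs => (hVd s hs h).continuousWithinAt
      obtain ⟨B, hB⟩ := isCompact_uIcc.exists_bound_of_continuousOn hcont
      exact ⟨B, fun s => hB s s.2⟩
  -- Composing with e^{s v_J} adds v_J to the generator D - v_J and so removes the shift.
  have key := halfCasimir_evolution_eq_zero (T := T) (β := β)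
    (W := fun s => V s ∘ₗ translate (lieExp (s • lieVec T J)))
    (fun s hs => (hVdist s hs).comp_translate J s) (fun s hs h => ?_) ?_
  · ext h
    have h3 := LinearMap.congr_fun key (translate (lieExp (β • lieVec T J))⁻¹ h)
    simp only [LinearMap.comp_apply, translate_translate_inv, hV, LinearMap.sub_apply,
      LinearMap.zero_apply] at h3
    exact sub_eq_zero.1 h3
  · refine (hasDerivWithinAt_apply (fun r hr => hC ⟨r, hr⟩) (hVd s hs)
      (c' := translate (lieExp (s • lieVec T J)) (vf (lieVec T J) h))
      (fun w => hasDerivAt_toC_wordOp_translate T J w h s)).congr_deriv ?_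
    simp only [LinearMap.comp_apply, LinearMap.sub_apply, map_sub, halfCasimir_translate T hK,
      vf_translate_lieExp_self, sub_add_cancel]
  · ext h
    simp [hV, h₁.initial, h₂.initial, lieExp_zero, translate_one]

end Uniqueness

/-- Termwise integration of the exponential series; it brings ω into the integral form in which
Duhamel's formula produces it. -/
theorem hasSum_integral_exp {𝔸 : Type*} [NormedRing 𝔸] [NormedAlgebra ℝ 𝔸] [CompleteSpace 𝔸] (Y : 𝔸) :
    HasSum (fun n : ℕ => (((n + 1).factorial : ℝ)⁻¹) • Y ^ n)
      (∫ t in (0 : ℝ)..1, NormedSpace.exp (t • Y)) := by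
  set f : ℕ → C(ℝ, 𝔸) := fun n =>
    ⟨fun t => t ^ n • ((n.factorial : ℝ)⁻¹ • Y ^ n), by fun_prop⟩ with hf
  have h1 : Summable fun n => ‖(f n).restrict
      (⟨Set.uIcc (0 : ℝ) 1, isCompact_uIcc⟩ : TopologicalSpace.Compacts ℝ)‖ := by
    refine Summable.of_nonneg_of_le (fun n => norm_nonneg _) (fun n => ?_)
      (NormedSpace.norm_expSeries_summable' (𝕂 := ℝ) Y)
    rw [ContinuousMap.norm_le _ (norm_nonneg _)]
    rintro ⟨t, ht⟩
    have ht' : t ∈ Set.uIcc (0 : ℝ) 1 := ht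
    have h2 : ‖t ^ n‖ ≤ 1 := by
      rw [norm_pow]
      exact pow_le_one₀ (norm_nonneg _) (by simpa using abs_le_of_mem_uIcc_zero ht')
    calc ‖t ^ n • ((n.factorial : ℝ)⁻¹ • Y ^ n)‖
        = ‖t ^ n‖ * ‖(n.factorial : ℝ)⁻¹ • Y ^ n‖ := norm_smul _ _
      _ ≤ 1 * ‖(n.factorial : ℝ)⁻¹ • Y ^ n‖ := by gcongr
      _ = _ := one_mul _
  have h2 := intervalIntegral.hasSum_intervalIntegral_of_summable_norm (a := 0) (b := 1) h1
  have h3 : ∀ t : ℝ, ∑' n, f n t = NormedSpace.exp (t • Y) := fun t => by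
    rw [NormedSpace.exp_eq_tsum ℝ]
    refine tsum_congr fun n => ?_
    rw [smul_pow, smul_comm]
    rfl
  have h4 : ∀ n : ℕ, ∫ t in (0 : ℝ)..1, f n t = (((n + 1).factorial : ℝ)⁻¹) • Y ^ n := fun n => by
    simp only [hf, ContinuousMap.coe_mk]
    rw [intervalIntegral.integral_smul_const, integral_pow, smul_smul, Nat.factorial_succ]
    congr 1
    have : (n.factorial : ℝ) ≠ 0 := by positivity
    push_cast
    field_simp
    simp
  simpa only [h3, h4] using h2

/-! ### The matrix ω and density of its regular points -/

section OmegaMatrix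

open scoped Matrix.Norms.Operator Matrix

variable {ι : Type*} [Fintype ι] [DecidableEq ι]

theorem analyticOnNhd_tsum_pow_div_factorial_succ :
    AnalyticOnNhd ℝ (fun Y : Matrix ι ι ℝ => ∑' n : ℕ, (((n + 1).factorial : ℝ)⁻¹) • Y ^ n)
      Set.univ := by
  set c : ℕ → ℝ := fun n => ((n + 1).factorial : ℝ)⁻¹ with hc
  have hr : (FormalMultilinearSeries.ofScalars (Matrix ι ι ℝ) c).radius = ⊤ := by
    refine FormalMultilinearSeries.ofScalars_radius_eq_top_of_tendsto _ _
      (Eventually.of_forall fun n => by positivity) ?_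
    have h : ∀ n : ℕ, ‖c n.succ‖ / ‖c n‖ = 1 / ((n : ℝ) + 1 + 1) := fun n => by
      simp only [hc, norm_inv, Real.norm_natCast, Nat.factorial_succ (n + 1), Nat.succ_eq_add_one]
      have : ((n + 1).factorial : ℝ) ≠ 0 := by positivity
      push_cast
      field_simp
    simp only [h]
    exact (tendsto_one_div_add_atTop_nhds_zero_nat (𝕜 := ℝ)).comp (tendsto_add_atTop_nat 1)
      |>.congr fun n => by simp
  have h1 := (FormalMultilinearSeries.ofScalars (Matrix ι ι ℝ) c).hasFPowerSeriesOnBall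
    (by rw [hr]; exact ENNReal.zero_lt_top)
  rw [hr] at h1
  have h2 := h1.analyticOnNhd
  rw [Metric.eball_top] at h2
  refine h2.congr isOpen_univ fun Y _ => ?_
  exact FormalMultilinearSeries.ofScalars_sum_eq c Y

variable {E : Type*} [NormedAddCommGroup E] [NormedSpace ℝ E]
  {G : Type*} [TopologicalSpace G] [ChartedSpace E G] [Group G] [LieGroup 𝓘(ℝ, E) ∞ G]
  (T : Module.Basis ι ℝ (GroupLieAlgebra 𝓘(ℝ, E) G))

/-- `ω(φ) = ∫_0^1 e^{-t φ^k C_k} dt`, in terms of a primitive of the integrand. -/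
theorem exists_primitive_exp_adMatrix (φ : ι → ℝ) :
    ∃ N : ℝ → Matrix ι ι ℝ, N 0 = 0 ∧ N 1 = omegaMatrix T φ ∧ ∀ t k j,
      HasDerivAt (fun t => N t k j) (NormedSpace.exp (t • -adMatrix T φ) k j) t := by
  set Y := -adMatrix T φ with hY
  have hcont : Continuous fun t : ℝ => NormedSpace.exp (t • Y) :=
    continuous_iff_continuousAt.2 fun t => (hasDerivAt_exp_smul_const' Y t).continuousAt
  refine ⟨fun t => ∫ s in (0 : ℝ)..t, NormedSpace.exp (s • Y), by simp,
    (hasSum_integral_exp Y).tsum_eq.symm, fun t k j => ?_⟩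
  exact (LinearMap.toContinuousLinearMap (Matrix.entryLinearMap ℝ ℝ k j)).hasFDerivAt.comp_hasDerivAt
    t (hcont.integral_hasStrictDerivAt 0 t).hasDerivAt

/-- The linear map `φ ↦ φ^k C_k`. -/
def adMatrixLinear : (ι → ℝ) →ₗ[ℝ] Matrix ι ι ℝ where
  toFun := adMatrix T
  map_add' φ ψ := by
    ext j l
    simp [adMatrix, add_mul, Finset.sum_add_distrib]
  map_smul' c φ := by
    ext j l
    simp [adMatrix, Finset.mul_sum, mul_assoc]

theorem contDiff_omegaMatrix (k j : ι) : ContDiff ℝ ω fun φ => omegaMatrix T φ k j := by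
  have h1 : ContDiff ℝ ω fun Y : Matrix ι ι ℝ =>
      ∑' n : ℕ, (((n + 1).factorial : ℝ)⁻¹) • Y ^ n :=
    analyticOnNhd_tsum_pow_div_factorial_succ.contDiff
  have h2 : ContDiff ℝ ω fun φ => -LinearMap.toContinuousLinearMap (adMatrixLinear T) φ :=
    (ContinuousLinearMap.contDiff _).neg
  exact (LinearMap.toContinuousLinearMap (Matrix.entryLinearMap ℝ ℝ k j)).contDiff.comp
    (h1.comp h2)

theorem contDiff_det_omegaMatrix : ContDiff ℝ ω fun φ => (omegaMatrix T φ).det := by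
  simp only [Matrix.det_apply]
  refine ContDiff.sum fun σ _ => ContDiff.const_smul _ ?_
  exact contDiff_prod fun i _ => contDiff_omegaMatrix T _ _

theorem isOpen_regularSet : IsOpen (regularSet T) := by
  have : regularSet T = (fun φ => (omegaMatrix T φ).det) ⁻¹' {0}ᶜ := by
    ext φ
    simp [regularSet]
  rw [this]
  exact isOpen_compl_singleton.preimage (contDiff_det_omegaMatrix T).continuous

theorem omegaMatrix_zero : omegaMatrix T 0 = 1 := by
  have h0 : -adMatrix T 0 = 0 := by ext j l; simp [adMatrix]
  rw [omegaMatrix, h0, tsum_eq_single 0 fun n hn => by rw [zero_pow hn, smul_zero]]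
  simp

/-- Along the ray sφ the determinant is analytic and equals 1 at s = 0, so it does not vanish
identically near s = 1 and regular points sφ tend to φ. -/
theorem mem_closure_regularSet (φ : ι → ℝ) : φ ∈ closure (regularSet T) := by
  set d : ℝ → ℝ := fun s => (omegaMatrix T (s • φ)).det with hd
  have han : AnalyticOnNhd ℝ d Set.univ := by
    rw [← contDiff_omega_iff_analyticOnNhd]
    exact (contDiff_det_omegaMatrix T).comp (contDiff_id.smul contDiff_const)
  have hne : ∀ᶠ s in 𝓝[≠] (1 : ℝ), d s ≠ 0 := by
    rcases (han 1 (Set.mem_univ _)).eventually_eq_zero_or_eventually_ne_zero with h | h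
    · have := han.eqOn_zero_of_preconnected_of_eventuallyEq_zero isPreconnected_univ
        (Set.mem_univ 1) h (Set.mem_univ 0)
      simp [hd, omegaMatrix_zero] at this
    · exact h
  refine mem_closure_of_tendsto (f := fun s : ℝ => s • φ) (b := 𝓝[≠] (1 : ℝ)) ?_
    (hne.mono fun s hs => isUnit_iff_ne_zero.2 hs)
  have h1 : Tendsto (fun s : ℝ => s • φ) (𝓝 1) (𝓝 ((1 : ℝ) • φ)) :=
    (continuous_id.smul continuous_const).tendsto 1
  rw [one_smul] at h1
  exact h1.mono_left nhdsWithin_le_nhds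

end OmegaMatrix

/-! ### Duhamel's formula and the action of the u_i -/

section DerivativeExpansion

variable {E : Type*} [NormedAddCommGroup E] [NormedSpace ℝ E] [FiniteDimensional ℝ E]
  {G : Type*} [TopologicalSpace G] [ChartedSpace E G] [Group G] [LieGroup 𝓘(ℝ, E) ∞ G]
  [CompactSpace G] [T2Space G] {H : Subgroup G} [MeasurableSpace (G ⧸ H)] [BorelSpace (G ⧸ H)]
  (μ : Measure (G ⧸ H)) [IsFiniteMeasure μ] {ι : Type*} [Fintype ι] [DecidableEq ι]
  (T : Module.Basis ι ℝ (GroupLieAlgebra 𝓘(ℝ, E) G))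

theorem expV_smul (t : ℝ) (φ : ι → ℝ) :
    expV (H := H) T (t • φ) = translate (lieExp (t • lieVec T φ)) := by
  have : CompleteSpace E := FiniteDimensional.complete ℝ E
  rw [← lieVec_smul]
  rfl

theorem norm_toC_expV (φ : ι → ℝ) (f : smoothFn E H) : ‖toC (expV T φ f)‖ = ‖toC f‖ :=
  norm_toC_translate _ f

theorem pairing_comm (h f : smoothFn E H) : pairing μ h f = pairing μ f h := by
  simp only [pairing, mul_comm]

variable [SMulInvariantMeasure G (G ⧸ H) μ]

theorem pairing_expV_sub_one (t : ℝ) (φ : ι → ℝ) (h f : smoothFn E H) :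
    pairing μ (expV T ((t - 1) • φ) h) (expV T (t • φ) f) = pairing μ h (expV T φ f) := by
  have : CompleteSpace E := FiniteDimensional.complete ℝ E
  have h1 : expV (H := H) T φ f = translate (lieExp ((1 - t) • lieVec T φ))
      (translate (lieExp (t • lieVec T φ)) f) := by
    rw [← Module.End.mul_apply, ← translate_mul, ← lieExp_add_smul, sub_add_cancel, ← expV_smul,
      one_smul]
  rw [h1, pairing_translate_right, ← lieExp_neg, ← neg_smul, neg_sub, expV_smul, expV_smul]

theorem pairing_expV_neg (φ : ι → ℝ) (h f : smoothFn E H) :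
    pairing μ (expV T ((0 - 1 : ℝ) • φ) h) f = pairing μ h (expV T φ f) := by
  have : CompleteSpace E := FiniteDimensional.complete ℝ E
  have h1 := pairing_expV_sub_one μ T 0 φ h f
  rw [expV_smul T 0, zero_smul, lieExp_zero, translate_one] at h1
  exact h1

/-- The function interpolates between ⟨h, e^{Av} f⟩ at t = 0 and ⟨h, e^{Bv} f⟩ at t = 1. -/
theorem hasDerivAt_duhamel (A B : ι → ℝ) (h f : smoothFn E H) (t : ℝ) :
    HasDerivAt (fun t : ℝ => pairing μ (expV T ((t - 1) • A) h) (expV T (t • B) f))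
      (pairing μ (expV T ((t - 1) • A) h) (vf (lieVec T (B - A)) (expV T (t • B) f))) t := by
  have : CompleteSpace E := FiniteDimensional.complete ℝ E
  simp only [expV_smul]
  have h1 := (hasDerivAt_toC_translate (lieVec T A) h (t - 1)).comp_sub_const t 1
  have h2 := hasDerivAt_toC_translate (lieVec T B) f t
  have h3 := (integralCLM μ).hasFDerivAt.comp_hasDerivAt t (h1.mul h2)
  refine HasDerivAt.congr_deriv (f := fun t : ℝ => pairing μ
    (translate (lieExp ((t - 1) • lieVec T A)) h) (translate (lieExp (t • lieVec T B)) f)) h3 ?_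
  have hBA : vf (H := H) (lieVec T (B - A)) = vf (lieVec T B) - vf (lieVec T A) := by
    rw [sub_eq_add_neg B, ← neg_one_smul ℝ A, lieVec_add, lieVec_smul, vf_add, vf_smul]
    ext1 f
    simp [sub_eq_add_neg]
  rw [map_add, ← pairing_eq, ← pairing_eq, hBA, ← vf_translate_lieExp_self,
    ← vf_translate_lieExp_self, LinearMap.sub_apply, ← pairingBilin_apply μ _ (_ - _), map_sub,
    pairingBilin_apply, pairingBilin_apply, pairing_vf μ (lieVec T A)]
  ring

theorem abs_pairing_vf_lieVec_le {K : ℝ} (ψ : ι → ℝ) (h f : smoothFn E H)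
    (hK : ∀ j, ‖toC (vf (T j) f)‖ ≤ K) :
    |pairing μ h (vf (lieVec T ψ) f)| ≤
      ‖integralCLM μ‖ * (Fintype.card ι * (‖ψ‖ * K)) * ‖toC h‖ := by
  have : CompleteSpace E := FiniteDimensional.complete ℝ E
  refine (abs_pairing_le μ _ _).trans ?_
  gcongr
  rw [vf_lieVec, LinearMap.sum_apply, map_sum]
  refine (norm_sum_le _ _).trans ((Finset.sum_le_card_nsmul _ _ (‖ψ‖ * K) fun j _ => ?_).trans ?_)
  · rw [LinearMap.smul_apply, map_smul, norm_smul]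
    exact mul_le_mul (norm_le_pi_norm ψ j) (hK j) (norm_nonneg _) (norm_nonneg _)
  · simp

/-- The constant is uniform in A, F and s; this allows A to be replaced by B inside Duhamel's
integrand with an error of order ‖B - A‖. -/
theorem exists_abs_pairing_expV_sub_le (B : ι → ℝ) (h : smoothFn E H) :
    ∃ K, 0 ≤ K ∧ ∀ (A : ι → ℝ) (F : smoothFn E H) (s : ℝ), |s| ≤ 1 →
      |pairing μ F (expV T (s • B) h) - pairing μ F (expV T (s • A) h)|
        ≤ K * ‖B - A‖ * ‖toC F‖ := by
  have : CompleteSpace E := FiniteDimensional.complete ℝ E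
  obtain ⟨K, hK⟩ := exists_norm_wordOp_translate_le (T := T) 1 h
  have hK0 : 0 ≤ K := (norm_nonneg _).trans (hK [] (Nat.zero_le _) 1)
  refine ⟨‖integralCLM μ‖ * (Fintype.card ι * K), by positivity, fun A F s hs => ?_⟩
  have h1 := (convex_Icc (0 : ℝ) 1).norm_image_sub_le_of_norm_hasDerivWithin_le
    (C := ‖integralCLM μ‖ * (Fintype.card ι * K) * ‖B - A‖ * ‖toC F‖)
    (fun t _ => (hasDerivAt_duhamel μ T (s • A) (s • B) F h t).hasDerivWithinAt)
    (fun t _ => by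
      refine (abs_pairing_vf_lieVec_le μ T (K := K) _ _ _ fun j => ?_).trans ?_
      · have h2 := hK [j] le_rfl (lieExp (lieVec T (t • s • B)))
        rw [wordOp_cons, wordOp_nil, mul_one] at h2
        exact h2
      · rw [norm_toC_expV, ← smul_sub, norm_smul]
        have : ‖s‖ * ‖B - A‖ ≤ ‖B - A‖ := mul_le_of_le_one_left (norm_nonneg _) hs
        calc ‖integralCLM μ‖ * (Fintype.card ι * (‖s‖ * ‖B - A‖ * K)) * ‖toC F‖
            ≤ ‖integralCLM μ‖ * (Fintype.card ι * (‖B - A‖ * K)) * ‖toC F‖ := by gcongr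
          _ = _ := by ring)
    (Set.left_mem_Icc.2 zero_le_one) (Set.right_mem_Icc.2 zero_le_one)
  simp only [pairing_expV_neg, zero_smul, one_smul, sub_self] at h1
  simpa [expV, lieExp_zero, translate_one, pairing_expV_neg] using h1

theorem hasFDerivAt_pairing_expV (h f : smoothFn E H) (B : ι → ℝ) :
    HasFDerivAt (fun φ => pairing μ h (expV T φ f))
      (∑ j, (∑ k, omegaMatrix T B k j * pairing μ h (expV T B (vf (T k) f))) •
        (ContinuousLinearMap.proj j : (ι → ℝ) →L[ℝ] ℝ)) B := by
  have : CompleteSpace E := FiniteDimensional.complete ℝ E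
  obtain ⟨K, hK0, hK⟩ := exists_abs_pairing_expV_sub_le μ T B h
  obtain ⟨N, hN0, hN1, hN⟩ := exists_primitive_exp_adMatrix T B
  set M : ℝ → ι → ι → ℝ := fun t k j => NormedSpace.exp (t • -adMatrix T B) k j with hM
  set c : ι → ℝ := fun k => pairing μ h (expV T B (vf (T k) f)) with hc
  have hMb : ∀ k j, ∃ D, ∀ t ∈ Set.Icc (0 : ℝ) 1, ‖M t k j‖ ≤ D := fun k j =>
    isCompact_Icc.exists_bound_of_continuousOn fun t _ =>
      (hasDerivAt_exp_smul_entry (-adMatrix T B) k j t).continuousAt.continuousWithinAt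
  choose D hD using hMb
  -- In Duhamel's derivative the field crosses e^{tB}, giving (B - A)_j (e^{-tX})_{kj}. Replacing A
  -- by B in the other factor costs one more ‖B - A‖, so after subtraction of the primitive N the
  -- derivative is quadratically small. The end value N(1) = ω gives the linear term.
  have hquad : ∀ A : ι → ℝ, |pairing μ h (expV T B f) - pairing μ h (expV T A f)
      - ∑ j, ∑ k, (B - A) j * (omegaMatrix T B k j * c k)|
      ≤ (∑ j, ∑ k, D k j * K * ‖toC (vf (T k) f)‖) * ‖B - A‖ ^ 2 := by
    intro A
    have hd : ∀ t, HasDerivAt (fun t : ℝ => pairing μ (expV T ((t - 1) • A) h) (expV T (t • B) f)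
        - ∑ j, ∑ k, (B - A) j * (N t k j * c k))
        (∑ j, ∑ k, (B - A) j * (M t k j *
          (pairing μ (expV T ((t - 1) • A) h) (expV T (t • B) (vf (T k) f)) - c k))) t := by
      intro t
      refine ((hasDerivAt_duhamel μ T A B h f t).sub (HasDerivAt.fun_sum fun j _ =>
        HasDerivAt.fun_sum fun k _ => ((hN t k j).mul_const (c k)).const_mul _)).congr_deriv ?_
      rw [vf_lieVec, LinearMap.sum_apply]
      simp only [LinearMap.smul_apply, expV_smul, vf_translate_lieExp]
      simp only [← pairingBilin_apply, map_sum, map_smul, smul_eq_mul, Finset.mul_sum, mul_sub,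
        Finset.sum_sub_distrib, hM]
    have h1 := (convex_Icc (0 : ℝ) 1).norm_image_sub_le_of_norm_hasDerivWithin_le
      (C := (∑ j, ∑ k, D k j * K * ‖toC (vf (T k) f)‖) * ‖B - A‖ ^ 2)
      (fun t _ => (hd t).hasDerivWithinAt)
      (fun t ht => by
        rw [Finset.sum_mul]
        refine (norm_sum_le _ _).trans (Finset.sum_le_sum fun j _ => ?_)
        rw [Finset.sum_mul]
        refine (norm_sum_le _ _).trans (Finset.sum_le_sum fun k _ => ?_)
        have h2 : |pairing μ (expV T ((t - 1) • A) h) (expV T (t • B) (vf (T k) f)) - c k|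
            ≤ K * ‖B - A‖ * ‖toC (vf (T k) f)‖ := by
          have h3 := hK A (expV T (t • B) (vf (T k) f)) (t - 1)
            (abs_le.2 ⟨by linarith [ht.1], by linarith [ht.2]⟩)
          rw [pairing_comm μ _ (expV T ((t - 1) • B) h), pairing_comm μ _ (expV T ((t - 1) • A) h),
            pairing_expV_sub_one, abs_sub_comm] at h3
          rwa [norm_toC_expV] at h3
        have hD0 : 0 ≤ D k j := (norm_nonneg _).trans (hD k j t ht)
        rw [norm_mul, norm_mul]
        calc ‖(B - A) j‖ * (‖M t k j‖ * ‖_‖)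
            ≤ ‖B - A‖ * (D k j * (K * ‖B - A‖ * ‖toC (vf (T k) f)‖)) := by
              gcongr
              · exact norm_le_pi_norm (B - A) j
              · exact hD k j t ht
              · exact h2
          _ = _ := by ring)
      (Set.left_mem_Icc.2 zero_le_one) (Set.right_mem_Icc.2 zero_le_one)
    rw [hN0, hN1, pairing_expV_neg, sub_self, zero_smul, zero_smul] at h1
    have hz : expV (H := H) T 0 = 1 := by simp [expV, lieExp_zero, translate_one]
    simp only [hz, one_smul, Module.End.one_apply, Matrix.zero_apply, zero_mul, mul_zero,
      Finset.sum_const_zero, sub_zero, mul_one, norm_one] at h1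
    refine (le_of_eq ?_).trans h1
    rw [Real.norm_eq_abs]
    congr 1
    ring
  rw [hasFDerivAt_iff_isLittleO]
  have hO : (fun A => pairing μ h (expV T A f) - pairing μ h (expV T B f)
      - (∑ j, (∑ k, omegaMatrix T B k j * c k) •
        (ContinuousLinearMap.proj j : (ι → ℝ) →L[ℝ] ℝ)) (A - B)) =O[𝓝 B]
      fun A => ‖A - B‖ ^ 2 := by
    refine Asymptotics.IsBigO.of_bound (∑ j, ∑ k, D k j * K * ‖toC (vf (T k) f)‖)
      (Eventually.of_forall fun A => ?_)
    refine (le_of_eq ?_).trans ((hquad A).trans (le_of_eq ?_))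
    · rw [← abs_neg, Real.norm_eq_abs]
      congr 1
      simp only [sum_apply, smul_apply, ContinuousLinearMap.proj_apply, smul_eq_mul, Pi.sub_apply,
        ← Finset.mul_sum]
      have h4 : ∑ j, (∑ k, omegaMatrix T B k j * c k) * (A j - B j)
          = -∑ j, (B j - A j) * ∑ k, omegaMatrix T B k j * c k := by
        rw [← Finset.sum_neg_distrib]
        exact Finset.sum_congr rfl fun j _ => by ring
      rw [h4]
      ring
    · rw [norm_pow, norm_norm, norm_sub_rev]
  refine hO.trans_isLittleO ((Asymptotics.isLittleO_norm_pow_id one_lt_two).comp_tendsto ?_)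
  have h5 : Tendsto (fun A : ι → ℝ => A - B) (𝓝 B) (𝓝 (B - B)) := tendsto_id.sub_const B
  rwa [sub_self] at h5

theorem fderiv_pairing_expV (h f : smoothFn E H) (φ : ι → ℝ) (j : ι) :
    fderiv ℝ (fun φ => pairing μ h (expV T φ f)) φ (Pi.single j 1)
      = ∑ k, omegaMatrix T φ k j * pairing μ h (expV T φ (vf (T k) f)) := by
  rw [(hasFDerivAt_pairing_expV μ T h f φ).fderiv]
  simp [sum_apply, Pi.single_apply]

/-- Partial derivatives are combinations of matrix elements of the same kind, with f replaced by v_k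
f and smooth coefficients from ω, so induction on the order applies. -/
theorem contDiff_pairing_expV (h f : smoothFn E H) :
    ContDiff ℝ ∞ fun φ => pairing μ h (expV T φ f) := by
  rw [contDiff_infty]
  intro n
  induction n generalizing f with
  | zero =>
    rw [Nat.cast_zero, contDiff_zero]
    exact continuous_iff_continuousAt.2 fun φ => (hasFDerivAt_pairing_expV μ T h f φ).continuousAt
  | succ n ih =>
    rw [Nat.cast_succ, contDiff_succ_iff_hasFDerivAt]
    refine ⟨_, ?_, hasFDerivAt_pairing_expV μ T h f⟩
    refine ContDiff.sum fun j _ => ContDiff.fun_smul (ContDiff.sum fun k _ => ?_) contDiff_const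
    exact ((contDiff_omegaMatrix T k j).of_le le_top).mul (ih (vf (T k) f))

/-- On regular points, `u_i` acts on matrix elements of `e^{φ^i v_i}` as `v_i`. -/
theorem uOp_pairing_expV (h f : smoothFn E H) (i : ι) {φ : ι → ℝ} (hφ : φ ∈ regularSet T) :
    uOp T i (fun φ => pairing μ h (expV T φ f)) φ = pairing μ h (expV T φ (vf (T i) f)) := by
  simp only [uOp, fderiv_pairing_expV, Finset.mul_sum]
  rw [Finset.sum_comm]
  have h1 : ∀ k, ∑ j, (omegaMatrix T φ)⁻¹ j i *
      (omegaMatrix T φ k j * pairing μ h (expV T φ (vf (T k) f)))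
      = (1 : Matrix ι ι ℝ) k i * pairing μ h (expV T φ (vf (T k) f)) := fun k => by
    rw [← Matrix.mul_nonsing_inv _ hφ, Matrix.mul_apply, Finset.sum_mul]
    exact Finset.sum_congr rfl fun j _ => by ring
  simp only [h1, Matrix.one_apply, ite_mul, one_mul, zero_mul]
  simp

/-- At singular points the matrix inverse takes its default value 0, so identities can be iterated
on the regular set only; it is open, hence derivatives there depend only on values there. -/
theorem uOp_congr {Ψ Ψ' : (ι → ℝ) → ℝ} (hΨ : Set.EqOn Ψ Ψ' (regularSet T)) (i : ι) :
    Set.EqOn (uOp T i Ψ) (uOp T i Ψ') (regularSet T) := fun φ hφ => by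
  have h1 : Ψ =ᶠ[𝓝 φ] Ψ' :=
    Filter.mem_of_superset ((isOpen_regularSet T).mem_nhds hφ) fun ψ hψ => hΨ hψ
  simp only [uOp, h1.fderiv_eq]

theorem uCasimir_congr {Ψ Ψ' : (ι → ℝ) → ℝ} (hΨ : Set.EqOn Ψ Ψ' (regularSet T)) (β : ℝ) :
    Set.EqOn (uCasimir T β Ψ) (uCasimir T β Ψ') (regularSet T) := fun φ hφ => by
  simp only [uCasimir, uOp_congr T (uOp_congr T hΨ _) _ hφ]

theorem uCasimir_pairing_expV (β : ℝ) (h f : smoothFn E H) :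
    Set.EqOn (uCasimir T β fun φ => pairing μ h (expV T φ f))
      (fun φ => pairing μ h (expV T φ (((-(1 / 2) * β) • casimir T : Module.End ℝ (smoothFn E H)) f)))
      (regularSet T) := fun φ hφ => by
  have : CompleteSpace E := FiniteDimensional.complete ℝ E
  have h1 : ∀ i j, uOp T i (uOp T j fun φ => pairing μ h (expV T φ f)) φ
      = pairing μ h (expV T φ (vf (T i) (vf (T j) f))) := fun i j => by
    rw [uOp_congr T (fun ψ hψ => uOp_pairing_expV μ T h f j hψ) i hφ,
      uOp_pairing_expV μ T h _ i hφ]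
  simp only [uCasimir, h1, LinearMap.smul_apply, casimir_apply]
  simp only [← pairingBilin_apply, map_sum, map_smul, smul_eq_mul]

theorem iterate_uCasimir_pairing_expV (β : ℝ) (h f : smoothFn E H) (n : ℕ) :
    Set.EqOn ((uCasimir T β)^[n] fun φ => pairing μ h (expV T φ f))
      (fun φ => pairing μ h
        (expV T φ ((((-(1 / 2) * β) • casimir T) ^ n : Module.End ℝ (smoothFn E H)) f)))
      (regularSet T) := by
  induction n with
  | zero => exact fun φ _ => rfl
  | succ n ih =>
    rw [Function.iterate_succ_apply', pow_succ']
    exact (uCasimir_congr T ih β).trans (uCasimir_pairing_expV μ T β h _)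

/-- On regular points each term agrees with a function smooth across φ₀, whose value at φ₀ is
therefore the limit. -/
theorem hasDerivativeExpansion_of_hasSum {β a : ℝ} {φ₀ : ι → ℝ} {h f : smoothFn E H}
    (hs : HasSum (fun n : ℕ => pairing μ h (expV T φ₀
      ((((-(1 / 2) * β) • casimir T) ^ n : Module.End ℝ (smoothFn E H)) f)) / (n.factorial : ℝ)) a) :
    HasDerivativeExpansion T β (fun φ => pairing μ h (expV T φ f)) φ₀ a := by
  refine ⟨contDiff_pairing_expV μ T h f, _, fun n => ?_, hs.tendsto_sum_nat⟩
  refine (((contDiff_pairing_expV μ T h _).continuous.tendsto φ₀).mono_left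
    nhdsWithin_le_nhds |>.div_const (n.factorial : ℝ)).congr' ?_
  filter_upwards [self_mem_nhdsWithin] with φ hφ
  rw [iterate_uCasimir_pairing_expV μ T β h f n hφ]

end DerivativeExpansion

end HomSpace

end

theorem theorem2
    {E : Type*} [NormedAddCommGroup E] [NormedSpace ℝ E] [FiniteDimensional ℝ E]
    {G : Type*} [TopologicalSpace G] [ChartedSpace E G] [Group G]
    [LieGroup 𝓘(ℝ, E) ∞ G] [CompactSpace G] [T2Space G]
    (H : Subgroup G) (hH : IsClosed (H : Set G))
    [MeasurableSpace (G ⧸ H)] [BorelSpace (G ⧸ H)]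
    (μ : MeasureTheory.Measure (G ⧸ H)) [MeasureTheory.IsFiniteMeasure μ]
    [MeasureTheory.SMulInvariantMeasure G (G ⧸ H) μ] (hμ : μ ≠ 0)
    {ι : Type*} [Fintype ι] [DecidableEq ι]
    (T : Module.Basis ι ℝ (GroupLieAlgebra 𝓘(ℝ, E) G))
    (hK : (HomSpace.killing T).PosDef)
    (β : ℝ) (J : ι → ℝ) (f : HomSpace.smoothFn E H)
    (hf : HomSpace.SeriesConverges T μ β (β • J) f) :
    β • J ∈ closure (HomSpace.regularSet T) ∧
    (∃ U, HomSpace.IsShiftedHeatEvolution T μ β J f U) ∧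
    ∀ U, HomSpace.IsShiftedHeatEvolution T μ β J f U →
      ∀ h : HomSpace.smoothFn E H,
        HomSpace.HasDerivativeExpansion T β
          (fun φ => HomSpace.pairing μ h (HomSpace.expV T φ f)) (β • J) (U β h) := by
  obtain ⟨U₀, hU₀, hsum⟩ := HomSpace.exists_isShiftedHeatEvolution μ T hK hf
  refine ⟨HomSpace.mem_closure_regularSet T _, ⟨U₀, hU₀⟩, fun U hU h => ?_⟩
  rw [HomSpace.IsShiftedHeatEvolution.unique T hK hU hU₀]
  exact HomSpace.hasDerivativeExpansion_of_hasSum μ T (hsum h)
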